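/- Work over $\mathbb{C}$ and let $N\ge 2$, $d\ge 3$, $e\ge 1$. For a hyperplane $\Pi\subset\mathbb{P}^N$ let $V_{\Pi,k}=\Gamma(\Pi,\mathcal{O}_\Pi(k))$ and let $\mathbb{P}_{\Pi,k}$ be its projectivization. A good $P$-cone of degree $d$ in $\Pi$ (where $P\in\Pi$) is a degree $d$ hypersurface $C$ of $\Pi$ that is a cone with vertex $P$ and is smooth outside $P$. Let $\mathcal{P}^{e,0}_d$ be the variety of $e$-tuples $\mathcal{L}=(\Pi_i,P_i,C_i)_{i=1}^e$, where $\Pi_i$ is a hyperplane in $\mathbb{P}^N$, $P_i\in\Pi_i$, $C_i$ is a good $P_i$-cone of degree $d$ in $\Pi_i$, and $P_i\notin\Pi_j$ for $i\ne j$. Let $\mathcal{V}_{d,e}\subset\mathcal{P}^{e,0}_d$ be the set of those $\mathcal{L}$ for which there is an irreducible hypersurface $X\subset\mathbb{P}^N$ of degree $d$ with $X\cap\Pi_i=C_i$ (as schemes) for all $i$, and let $\mathcal{V}'_{d,e}\supseteq\mathcal{V}_{d,e}$ be the set defined in the same way without requiring $X$ to be irreducible. Let $\mathcal{G}^e$ be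 the variety of pairs $(g,\mathcal{L})$, where $\mathcal{L}\in\mathcal{P}^{e,0}_d$ and $g=(g_2,\dots,g_e)$ consists of linear subsystems $g_i\subset\mathbb{P}_{\Pi_i,d}$ such that, if $i\le d+1$, $g_i$ has dimension $\binom{N+d-i}{N-1}$ and contains $(\Pi_1\cap\Pi_i)+\dots+(\Pi_{i-1}\cap\Pi_i)+\mathbb{P}_{\Pi_i,d-i+1}$, and, if $i>d+1$, $g_i$ has dimension $0$. Let $\tau:\mathcal{G}^e\to\mathcal{P}^{e,0}_d$ be the projection, and put $$f=\sum_{i=2}^{\min(e,d+1)}\left[\binom{N+d-1}{N-1}-\binom{N+d-i}{N-1}-1\right]+\max(e-d-1,0)\left[\binom{N+d-1}{N-1}-1\right].$$ Then: 1. $\tau$ is a smooth morphism of relative dimension $f$; more precisely, every point of $\mathcal{G}^e$ has a Zariski-open neighbourhood that is isomorphic over $\mathcal{P}^{e,0}_d$ to an open subset of $\mathcal{P}^{e,0}_d\times\mathbb{A}^f$. 2. There are two sections $S_1,S_2$ of $\tau$ (morphisms $\mathcal{P}^{e,0}_d\to\mathcal{G}^e$ whose composition with $\tau$ is the identity) such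 that $\mathcal{V}'_{d,e}=\tau(S_1\cap S_2)$. If $e\le d$ or $N\ge 4$, then also $\mathcal{V}_{d,e}=\tau(S_1\cap S_2)$. 3. Every irreducible component of $\mathcal{V}_{d,e}$ has codimension at most $f$ in $\mathcal{P}^{e,0}_d$. -/

import Mathlib

namespace StarPoints

open MvPolynomial TopologicalSpace Topology
open scoped LinearAlgebra.Projectivization

/-! ### Classical complex varieties given by homogeneous-type coordinates

A variety `X` is given by its set of points together with a relation `rel : M → X → Prop`
("the vector `D` is a system of coordinates of the point `x`"), where `M` is a finite-dimensional
complex vector space, every vector is a system of coordinates of at most one point and every point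
has at least one. (For projective space, `M` is the underlying vector space and `rel D x` says that
`D` spans the line `x`; for a Grassmannian, `M` consists of tuples of vectors and `rel D x` says
that `D` is a basis of the subspace `x`.) -/

/-- The algebra of polynomial functions on a complex vector space. -/
def polyFun (M : Type*) [AddCommGroup M] [Module ℂ M] : Subalgebra ℂ (M → ℂ) :=
  Algebra.adjoin ℂ (Set.range fun l : Module.Dual ℂ M => (l : M → ℂ))

/-- Polynomial maps between complex vector spaces. -/
def IsPolyMap {M M' : Type*} [AddCommGroup M] [Module ℂ M] [AddCommGroup M'] [Module ℂ M']
    (Ψ : M → M') : Prop :=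
  ∀ l : Module.Dual ℂ M', (fun D => l (Ψ D)) ∈ polyFun M

/-- The Zariski topology of a complex vector space. -/
@[reducible]
def zariskiVec (M : Type*) [AddCommGroup M] [Module ℂ M] : TopologicalSpace M :=
  TopologicalSpace.generateFrom {U | ∃ h ∈ polyFun M, U = {D | h D ≠ 0}}

/-- The Zariski topology of `X`: the quotient topology for the map that sends a coordinate system
to its point. -/
@[reducible]
def zariski {M X : Type*} [AddCommGroup M] [Module ℂ M] (rel : M → X → Prop) :
    TopologicalSpace X :=
  TopologicalSpace.coinduced (fun z : {z : M × X // rel z.1 z.2} => z.1.2)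
    (TopologicalSpace.induced (fun z : {z : M × X // rel z.1 z.2} => z.1.1) (zariskiVec M))

/-- `φ` is a regular map on `U`: locally in the coordinates of the source, coordinates of the
image point are given by quotients of polynomials `Ψ / h` with `h` nowhere zero. -/
def IsRegularOn {M X M' X' : Type*} [AddCommGroup M] [Module ℂ M]
    [AddCommGroup M'] [Module ℂ M'] (rel : M → X → Prop) (rel' : M' → X' → Prop)
    (φ : X → X') (U : Set X) : Prop :=
  ∀ D₀ : M, ∀ x₀ ∈ U, rel D₀ x₀ →
    ∃ h ∈ polyFun M, ∃ Ψ : M → M', IsPolyMap Ψ ∧ h D₀ ≠ 0 ∧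
      ∀ D : M, ∀ x ∈ U, rel D x → h D ≠ 0 → rel' ((h D)⁻¹ • Ψ D) (φ x)

/-- Coordinates on the product of `X` with affine `n`-space. -/
def prodAffine {M X : Type*} (rel : M → X → Prop) (n : ℕ) :
    M × (Fin n → ℂ) → X × (Fin n → ℂ) → Prop :=
  fun D z => rel D.1 z.1 ∧ D.2 = z.2

/-- `τ : Y → X` is smooth of relative dimension `n`, in the strong sense that every point of `Y` has
an open neighbourhood which is isomorphic over `X` to an open subset of `X × 𝔸ⁿ`. -/
def IsSmoothOfRelDim {M X M' Y : Type*} [AddCommGroup M] [Module ℂ M]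
    [AddCommGroup M'] [Module ℂ M'] (relY : M' → Y → Prop) (relX : M → X → Prop)
    (τ : Y → X) (n : ℕ) : Prop :=
  ∀ y : Y, ∃ (U : Set Y) (W : Set (X × (Fin n → ℂ))) (φ : Y → X × (Fin n → ℂ))
    (ψ : X × (Fin n → ℂ) → Y),
    IsOpen[zariski relY] U ∧ y ∈ U ∧ IsOpen[zariski (prodAffine relX n)] W ∧
    Set.MapsTo φ U W ∧ Set.MapsTo ψ W U ∧ Set.InvOn ψ φ U W ∧
    IsRegularOn relY (prodAffine relX n) φ U ∧ IsRegularOn (prodAffine relX n) relY ψ W ∧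
    ∀ z ∈ U, (φ z).1 = τ z

/-- The codimension in `X` of (the closure of) an irreducible subset `Z`: the supremum of the
lengths of chains of irreducible closed subsets of `X` that start with the closure of `Z`. -/
noncomputable def codim {X : Type*} [TopologicalSpace X] (Z : Set X) (hZ : IsIrreducible Z) : ℕ∞ :=
  Order.coheight (⟨closure Z, hZ.closure, isClosed_closure⟩ : IrreducibleCloseds X)

/-! ### Hyperplanes, forms and good cones -/

/-- The vector space whose lines are the points of `ℙ^N`. -/
abbrev Vec (N : ℕ) := Fin (N + 1) → ℂ

/-- Forms of degree `d` on `ℙ^N`, that is, the global sections of `𝒪(d)`. -/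
abbrev Form (N d : ℕ) := homogeneousSubmodule (Fin (N + 1)) ℂ d

/-- Restriction of polynomials to a linear subspace, as polynomial functions on it. -/
noncomputable def restr {N : ℕ} (H : Submodule ℂ (Vec N)) :
    MvPolynomial (Fin (N + 1)) ℂ →ₗ[ℂ] (H → ℂ) where
  toFun F := fun x => eval (x : Vec N) F
  map_add' F G := by ext x; simp
  map_smul' a F := by ext x; simp [smul_eval]

/-- The space of forms of degree `d` on the linear subspace `H`. -/
noncomputable def formsOn {N : ℕ} (H : Submodule ℂ (Vec N)) (d : ℕ) : Submodule ℂ (H → ℂ) :=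
  (homogeneousSubmodule (Fin (N + 1)) ℂ d).map (restr H)

/-- Triples `(Π, P, C)`: a hyperplane of `ℙ^N`, a point on it, and a good `P`-cone of degree `d`
in `Π`. The hypersurface `C` of `Π` is given by the line spanned by its equation. -/
structure Triple (N d : ℕ) where
  hyp : Submodule ℂ (Vec N)
  hyp_rank : Module.finrank ℂ hyp = N
  pt : ℙ ℂ (Vec N)
  pt_le : pt.submodule ≤ hyp
  cone : Submodule ℂ (hyp → ℂ)
  cone_le : cone ≤ formsOn hyp d
  cone_rank : Module.finrank ℂ cone = 1
  /-- `C` is a cone with vertex `P`. -/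
  cone_vertex : ∀ c ∈ cone, ∀ x v : hyp, (v : Vec N) ∈ pt.submodule → c (x + v) = c x
  /-- `C` is smooth outside `P`. -/
  cone_smooth : ∀ c ∈ cone, c ≠ 0 → ∀ x : hyp, (x : Vec N) ∉ pt.submodule → c x = 0 →
    ∃ v : hyp, lineDeriv ℂ c x v ≠ 0

/-- The space `𝒫_d^{e,0}` of `e`-tuples of triples with `P_i ∉ Π_j` for `i ≠ j`. -/
def Config (N d e : ℕ) :=
  {T : Fin e → Triple N d // ∀ i j, i ≠ j → ¬ (T i).pt.submodule ≤ (T j).hyp}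

/-- Coordinates for configurations: for each index an equation of `Π`, a vector spanning `P`, and
a form of degree `d` on `ℙ^N` whose restriction to `Π` is an equation of `C`. -/
noncomputable abbrev ConfigCoord (N d e : ℕ) := Fin e → Module.Dual ℂ (Vec N) × Vec N × Form N d

/-- `D` is a system of coordinates of the configuration `L`. -/
def ConfigRel {N d e : ℕ} (D : ConfigCoord N d e) (L : Config N d e) : Prop :=
  ∀ i, (L.1 i).hyp = LinearMap.ker (D i).1 ∧
    (L.1 i).pt.submodule = Submodule.span ℂ {(D i).2.1} ∧
    (L.1 i).cone = Submodule.span ℂ {restr (L.1 i).hyp (D i).2.2}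

noncomputable instance (N d e : ℕ) : TopologicalSpace (Config N d e) := zariski ConfigRel

/-- Configurations cut out by a hypersurface `X = Z(F)` of degree `d`: `X ∩ Π_i = C_i` as schemes
for all `i`. -/
def suitedLocus (N d e : ℕ) : Set (Config N d e) :=
  {L | ∃ F : MvPolynomial (Fin (N + 1)) ℂ, F.IsHomogeneous d ∧
    ∀ i, (L.1 i).cone = Submodule.span ℂ {restr (L.1 i).hyp F}}

/-- `𝒱_{d,e}`: configurations cut out by an irreducible hypersurface of degree `d`. -/
def V (N d e : ℕ) : Set (Config N d e) :=
  {L | ∃ F : MvPolynomial (Fin (N + 1)) ℂ, F.IsHomogeneous d ∧ Irreducible F ∧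
    ∀ i, (L.1 i).cone = Submodule.span ℂ {restr (L.1 i).hyp F}}

/-! ### The space `𝒢^e` -/

/-- The dimension of the linear system `g_i`; here `i = 2, …, e`. -/
def sysDim (N d i : ℕ) : ℕ := if i ≤ d + 1 then (N + d - i).choose (N - 1) else 0

/-- The indices `2, …, e`: the element `k` of `Fin e` stands for the index `k + 1`. -/
abbrev Idx (e : ℕ) := {k : Fin e // 0 < k.1}

/-- The forms on `Π_i` of the linear system
`g'_i = Π_{1,i} + ⋯ + Π_{i-1,i} + ℙ_{Π_i,d-i+1}` if `i ≤ d + 1` (spanned by the products of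
equations of `Π_1, …, Π_{i-1}` with a form of degree `d - i + 1` on `Π_i`), and the zero space if
`i > d + 1`. -/
noncomputable def fixedSys {N d e : ℕ} (L : Config N d e) (k : Fin e) :
    Submodule ℂ ((L.1 k).hyp → ℂ) :=
  if k.1 ≤ d then
    Submodule.span ℂ {φ | ∃ l : Fin e → Module.Dual ℂ (Vec N),
      (∀ j, (L.1 j).hyp ≤ LinearMap.ker (l j)) ∧ ∃ G ∈ formsOn (L.1 k).hyp (d - k.1),
        φ = fun x : (L.1 k).hyp => (∏ j ∈ Finset.univ.filter (· < k), l j (x : Vec N)) * G x}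
  else ⊥

/-- The space `𝒢^e` of pairs `(g, ℒ)`. A linear system of dimension `r` on `Π_i` is given by an
`(r+1)`-dimensional space of forms on `Π_i`. -/
structure GSpace (N d e : ℕ) where
  conf : Config N d e
  sys : ∀ k : Idx e, Submodule ℂ ((conf.1 k.1).hyp → ℂ)
  sys_le : ∀ k, sys k ≤ formsOn (conf.1 k.1).hyp d
  sys_rank : ∀ k, Module.finrank ℂ (sys k) = sysDim N d (k.1.1 + 1) + 1
  fixedSys_le : ∀ k, fixedSys conf k.1 ≤ sys k

/-- Coordinates for `𝒢^e`: coordinates of the configuration, and for every `i = 2, …, e` a tuple of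
forms on `ℙ^N` that restricts to a basis of the space of forms of `g_i`. -/
noncomputable abbrev GCoord (N d e : ℕ) :=
  ConfigCoord N d e × (∀ k : Idx e, Fin (sysDim N d (k.1.1 + 1) + 1) → Form N d)

/-- `D` is a system of coordinates of the point `x` of `𝒢^e`. -/
def GRel {N d e : ℕ} (D : GCoord N d e) (x : GSpace N d e) : Prop :=
  ConfigRel D.1 x.conf ∧
    ∀ k, x.sys k = Submodule.span ℂ (Set.range fun m => restr (x.conf.1 k.1).hyp (D.2 k m))

/-- The projection `τ : 𝒢^e → 𝒫_d^{e,0}`. -/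
def tau {N d e : ℕ} : GSpace N d e → Config N d e := GSpace.conf

/-- A section of `τ`: a regular map `S : 𝒫_d^{e,0} → 𝒢^e` with `τ ∘ S = id`. -/
def IsSection {N d e : ℕ} (S : Config N d e → GSpace N d e) : Prop :=
  IsRegularOn ConfigRel GRel S Set.univ ∧ ∀ L, tau (S L) = L

/-- The relative dimension `f` of `τ`. -/
def relDim (N d e : ℕ) : ℕ :=
  if e ≤ d + 1 then
    ∑ i ∈ Finset.Icc 2 e, ((N + d - 1).choose (N - 1) - (N + d - i).choose (N - 1) - 1)
  else
    ∑ i ∈ Finset.Icc 2 (d + 1), ((N + d - 1).choose (N - 1) - (N + d - i).choose (N - 1) - 1)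
      + (e - d - 1) * ((N + d - 1).choose (N - 1) - 1)

/-- The image in `X` of an irreducible component of a subspace is irreducible. -/
theorem isIrreducible_image {X : Type*} [TopologicalSpace X] {A : Set X} {Z : Set A}
    (hZ : Z ∈ irreducibleComponents A) : IsIrreducible (Subtype.val '' Z) :=
  IsIrreducible.image hZ.1 _ continuous_subtype_val.continuousOn

end StarPoints

namespace StarPoints

open MvPolynomial TopologicalSpace Topology
open scoped LinearAlgebra.Projectivization

/-! ### Polynomial and rational functions on vector spaces -/

section Calculus

set_option linter.unusedSectionVars false

variable {M M' M'' : Type*} [AddCommGroup M] [Module ℂ M] [AddCommGroup M'] [Module ℂ M']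
  [AddCommGroup M''] [Module ℂ M'']

/-! Configurations are handled through coordinates: equations l_k of the hyperplanes Π_k, vectors
P_k and forms f_k cutting out C_k on Π_k, numbered from 0. Regularity means that coordinates of the
image are locally rational functions of such data (`ratAt`, `MapIn`).

Smoothness of τ. The fixed part of the system on Π_k consists of the multiples of l_0⋯l_{k-1}. Since
P_k lies on Π_k and on no other hyperplane, this product is a nonzerodivisor on Π_k. So the fixed
part has constant rank, the system is one dimension larger, and the fibres of τ are products of
projective spaces. Forms that are a basis modulo the fixed part at one configuration remain so
nearby (`exists_coefficients`), and normalizing the leading coefficient to 1 gives affine charts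
(`isSmoothOfRelDim_tau`).

Sections. S₁ adds the cone C_k to the fixed part; S₂ adds the restriction to Π_k of a form
interpolating C_0, …, C_{k-1}. They coincide exactly when a common hypersurface exists
(`mem_suitedLocus_iff`). The difficulty is to make S₂ defined and regular also where the cones are
incompatible. Two devices achieve this. (a) Newton interpolation (`newton`) in which division by l_j
on Π_k is performed along the direction P_k. It is possible because l_j(P_k) ≠ 0, and it descends to
forms on Π_k because l_k(P_k) = 0. (b) A canonical factor by which f_j must be multiplied to agree
with f_0 on Π_0 ∩ Π_j (`coneRatio`). There f_j is smooth, so a discriminant Δ does not vanish at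
f_j, and dΔ(f_0)/dΔ(f_j), with both differentials taken at f_j, is the right factor whenever one
exists; the denominator is nonzero by Euler's formula. Instead of choosing coordinates on Π_0 ∩ Π_j,
the proof uses the form f∘pr + l^d + m^d on the whole space, which is smooth if and only if f is
smooth on l = m = 0. The discriminant comes from `exists_discriminant`, and independence of the
choices rests on `discDeriv_coneForm_eq_mul`.

Irreducibility. Every proper factor of a form cutting out C_0 vanishes at P_0
(`eval_vertex_eq_zero`). If e ≤ d, a multiple of l_0⋯l_{e-1} can be added so that the form becomes
smooth at P_0, which excludes two such factors. If N ≥ 4, two factors would meet in Π_0 outside P_0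
and make C_0 singular there.

Codimension. In a chart of τ the coincidence of S₁ and S₂ amounts to as many equations as the
relative dimension. The irreducible locus is open in the coincidence locus, and Krull's height
theorem in the coordinate ring bounds the codimension (`CoordChange.codim_component_le`). -/

theorem linear_mem_polyFun (l : M →ₗ[ℂ] ℂ) : (fun D => l D) ∈ polyFun M :=
  Algebra.subset_adjoin ⟨l, rfl⟩

theorem const_mem_subalgebra (O : Subalgebra ℂ (M → ℂ)) (c : ℂ) : (fun _ => c) ∈ O :=
  O.algebraMap_mem c

/-- All linear functionals of the map `G` belong to the algebra of functions `O`. -/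
def MapIn (O : Subalgebra ℂ (M → ℂ)) (G : M → M') : Prop :=
  ∀ l : Module.Dual ℂ M', (fun D => l (G D)) ∈ O

theorem polyFun_comp {O : Subalgebra ℂ (M → ℂ)} {G : M → M'} (hG : MapIn O G) {h : M' → ℂ}
    (hh : h ∈ polyFun M') : (fun D => h (G D)) ∈ O := by
  induction hh using Algebra.adjoin_induction with
  | mem x hx => obtain ⟨l, rfl⟩ := hx; exact hG l
  | algebraMap r => exact const_mem_subalgebra O r
  | add x y _ _ hx hy => exact O.add_mem hx hy
  | mul x y _ _ hx hy => exact O.mul_mem hx hy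

theorem MapIn.comp {O : Subalgebra ℂ (M → ℂ)} {G : M → M'} (hG : MapIn O G) {Ψ : M' → M''}
    (hΨ : IsPolyMap Ψ) : MapIn O (fun D => Ψ (G D)) :=
  fun l => polyFun_comp hG (hΨ l)

theorem MapIn.mono {O O' : Subalgebra ℂ (M → ℂ)} (h : O ≤ O') {G : M → M'} (hG : MapIn O G) :
    MapIn O' G := fun l => h (hG l)

theorem MapIn.linear {O : Subalgebra ℂ (M → ℂ)} {G : M → M'} (hG : MapIn O G)
    (T : M' →ₗ[ℂ] M'') : MapIn O (fun D => T (G D)) := fun l => hG (l.comp T)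

theorem MapIn.const (O : Subalgebra ℂ (M → ℂ)) (v : M') : MapIn O (fun _ => v) :=
  fun l => const_mem_subalgebra O (l v)

theorem MapIn.add {O : Subalgebra ℂ (M → ℂ)} {G G' : M → M'} (hG : MapIn O G)
    (hG' : MapIn O G') : MapIn O (fun D => G D + G' D) := fun l => by
  simp only [map_add]
  exact O.add_mem (hG l) (hG' l)

theorem MapIn.sub {O : Subalgebra ℂ (M → ℂ)} {G G' : M → M'} (hG : MapIn O G)
    (hG' : MapIn O G') : MapIn O (fun D => G D - G' D) := fun l => by
  simp only [map_sub]
  exact O.sub_mem (hG l) (hG' l)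

theorem MapIn.smul {O : Subalgebra ℂ (M → ℂ)} {c : M → ℂ} {G : M → M'} (hc : c ∈ O)
    (hG : MapIn O G) : MapIn O (fun D => c D • G D) := fun l => by
  simp only [map_smul]
  exact O.mul_mem hc (hG l)

theorem sum_mem_subalgebra {O : Subalgebra ℂ (M → ℂ)} {ι : Type*} (s : Finset ι)
    {c : ι → M → ℂ} (hc : ∀ i ∈ s, c i ∈ O) : (fun D => ∑ i ∈ s, c i D) ∈ O := by
  convert O.sum_mem hc using 1
  ext D
  simp

theorem prod_mem_subalgebra {O : Subalgebra ℂ (M → ℂ)} {ι : Type*} (s : Finset ι)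
    {c : ι → M → ℂ} (hc : ∀ i ∈ s, c i ∈ O) : (fun D => ∏ i ∈ s, c i D) ∈ O := by
  convert O.prod_mem hc using 1
  ext D
  simp

theorem MapIn.sum {O : Subalgebra ℂ (M → ℂ)} {ι : Type*} (s : Finset ι)
    {G : ι → M → M'} (hG : ∀ i ∈ s, MapIn O (G i)) : MapIn O (fun D => ∑ i ∈ s, G i D) :=
  fun l => by
    simp only [map_sum]
    exact sum_mem_subalgebra s fun i hi => hG i hi l

theorem MapIn.prodMk {O : Subalgebra ℂ (M → ℂ)} {G : M → M'} {G' : M → M''} (hG : MapIn O G)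
    (hG' : MapIn O G') : MapIn O (fun D => (G D, G' D)) := by
  convert (hG.linear (LinearMap.inl ℂ M' M'')).add (hG'.linear (LinearMap.inr ℂ M' M'')) using 2
  simp

theorem MapIn.pi {O : Subalgebra ℂ (M → ℂ)} {ι : Type*} [Finite ι] {E : ι → Type*}
    [∀ i, AddCommGroup (E i)] [∀ i, Module ℂ (E i)] {G : ∀ i, M → E i}
    (hG : ∀ i, MapIn O (G i)) : MapIn O (fun D i => G i D) := by
  classical
  have := Fintype.ofFinite ι
  convert MapIn.sum (O := O) Finset.univ (fun i _ => (hG i).linear (LinearMap.single ℂ E i)) using 2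
  ext i
  simp

theorem mapIn_scalar {O : Subalgebra ℂ (M → ℂ)} {c : M → ℂ} : MapIn O c ↔ c ∈ O := by
  refine ⟨fun h => h LinearMap.id, fun h l => ?_⟩
  have : (fun D => l (c D)) = fun D => c D * l 1 := by
    ext D
    simpa using l.map_smul (c D) 1
  rw [this]
  exact O.mul_mem h (const_mem_subalgebra O _)

theorem MapIn.id : MapIn (polyFun M) (fun D : M => D) := fun l => linear_mem_polyFun l

theorem MapIn.linearMap (T : M →ₗ[ℂ] M') : MapIn (polyFun M) (fun D : M => T D) :=
  MapIn.id.linear T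

/-- Functions that are quotients of polynomials `q / h` on a neighbourhood `h ≠ 0` of `D₀`. -/
def ratAt (D₀ : M) : Subalgebra ℂ (M → ℂ) where
  carrier := {f | ∃ h ∈ polyFun M, ∃ q ∈ polyFun M, h D₀ ≠ 0 ∧ ∀ D, h D ≠ 0 → h D * f D = q D}
  mul_mem' := by
    rintro f f' ⟨h, hh, q, hq, h0, H⟩ ⟨h', hh', q', hq', h0', H'⟩
    refine ⟨_, mul_mem hh hh', _, mul_mem hq hq', mul_ne_zero h0 h0', fun D hD => ?_⟩
    have h1 : h D ≠ 0 := left_ne_zero_of_mul hD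
    have h2 : h' D ≠ 0 := right_ne_zero_of_mul hD
    simp only [Pi.mul_apply, ← H D h1, ← H' D h2]
    ring
  add_mem' := by
    rintro f f' ⟨h, hh, q, hq, h0, H⟩ ⟨h', hh', q', hq', h0', H'⟩
    refine ⟨_, mul_mem hh hh', _, add_mem (mul_mem hq hh') (mul_mem hq' hh), mul_ne_zero h0 h0',
      fun D hD => ?_⟩
    have h1 : h D ≠ 0 := left_ne_zero_of_mul hD
    have h2 : h' D ≠ 0 := right_ne_zero_of_mul hD
    simp only [Pi.mul_apply, Pi.add_apply, ← H D h1, ← H' D h2]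
    ring
  algebraMap_mem' c :=
    ⟨_, one_mem _, _, (polyFun M).algebraMap_mem c, one_ne_zero, fun D _ => one_mul _⟩

theorem polyFun_le_ratAt (D₀ : M) : polyFun M ≤ ratAt D₀ := fun q hq =>
  ⟨_, one_mem _, q, hq, one_ne_zero, fun _ _ => one_mul _⟩

theorem inv_mem_ratAt {D₀ : M} {f : M → ℂ} (hf : f ∈ ratAt D₀) (h0 : f D₀ ≠ 0) :
    (fun D => (f D)⁻¹) ∈ ratAt D₀ := by
  obtain ⟨h, hh, q, hq, hD₀, H⟩ := hf
  have hq0 : q D₀ ≠ 0 := by rw [← H D₀ hD₀]; exact mul_ne_zero hD₀ h0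
  -- The denominator is `h * q` rather than `q`, since the relation between `f` and `q` is only
  -- available where `h` does not vanish.
  refine ⟨_, mul_mem hh hq, _, mul_mem hh hh, mul_ne_zero hD₀ hq0, fun D hD => ?_⟩
  have h1 : h D ≠ 0 := left_ne_zero_of_mul hD
  have h2 : q D ≠ 0 := right_ne_zero_of_mul hD
  have h3 : f D ≠ 0 := by rw [← H D h1] at h2; exact right_ne_zero_of_mul h2
  simp only [Pi.mul_apply, ← H D h1]
  field_simp

/-- A rational function that does not vanish at `D₀` does not vanish near `D₀`. -/
theorem exists_polyFun_of_ratAt {D₀ : M} {f : M → ℂ} (hf : f ∈ ratAt D₀) (h0 : f D₀ ≠ 0) :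
    ∃ h ∈ polyFun M, h D₀ ≠ 0 ∧ ∀ D, h D ≠ 0 → f D ≠ 0 := by
  obtain ⟨h, hh, q, hq, hD₀, H⟩ := hf
  have hq0 : q D₀ ≠ 0 := by rw [← H D₀ hD₀]; exact mul_ne_zero hD₀ h0
  refine ⟨_, mul_mem hh hq, mul_ne_zero hD₀ hq0, fun D hD => ?_⟩
  have h2 : q D ≠ 0 := right_ne_zero_of_mul hD
  rw [← H D (left_ne_zero_of_mul hD)] at h2
  exact right_ne_zero_of_mul h2

/-- Finitely many neighbourhoods of `D₀` can be shrunk to a single one. -/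
theorem exists_common_neighbourhood {D₀ : M} {ι : Type*} [Finite ι] {Q : ι → M → Prop}
    (H : ∀ i, ∃ h ∈ polyFun M, h D₀ ≠ 0 ∧ ∀ D, h D ≠ 0 → Q i D) :
    ∃ h ∈ polyFun M, h D₀ ≠ 0 ∧ ∀ D, h D ≠ 0 → ∀ i, Q i D := by
  have := Fintype.ofFinite ι
  choose h hh h0 hQ using H
  refine ⟨fun D => ∏ i, h i D, prod_mem_subalgebra _ fun i _ => hh i,
    Finset.prod_ne_zero_iff.2 fun i _ => h0 i, fun D hD i => hQ i D ?_⟩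
  exact Finset.prod_ne_zero_iff.1 hD i (Finset.mem_univ i)

theorem exists_denominator {D₀ : M} {ι : Type*} [Finite ι] {f : ι → M → ℂ}
    (hf : ∀ i, f i ∈ ratAt D₀) :
    ∃ h ∈ polyFun M, h D₀ ≠ 0 ∧ ∃ q : ι → M → ℂ, (∀ i, q i ∈ polyFun M) ∧
      ∀ D, h D ≠ 0 → ∀ i, h D * f i D = q i D := by
  classical
  have := Fintype.ofFinite ι
  choose h hh q hq h0 H using hf
  refine ⟨fun D => ∏ i, h i D, prod_mem_subalgebra _ fun i _ => hh i,
    Finset.prod_ne_zero_iff.2 fun i _ => h0 i,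
    fun i D => (∏ j ∈ Finset.univ.erase i, h j D) * q i D,
    fun i => mul_mem (prod_mem_subalgebra _ fun i _ => hh i) (hq i), fun D hD i => ?_⟩
  have hi := Finset.prod_ne_zero_iff.1 hD i (Finset.mem_univ i)
  change (∏ i, h i D) * f i D = (∏ j ∈ Finset.univ.erase i, h j D) * q i D
  rw [← H i D hi, ← Finset.prod_erase_mul _ _ (Finset.mem_univ i), mul_assoc]

theorem MapIn.exists_isPolyMap [Module.Finite ℂ M'] {D₀ : M} {G : M → M'}
    (hG : MapIn (ratAt D₀) G) :
    ∃ h ∈ polyFun M, ∃ Ψ : M → M', IsPolyMap Ψ ∧ h D₀ ≠ 0 ∧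
      ∀ D, h D ≠ 0 → (h D)⁻¹ • Ψ D = G D := by
  let b := Module.finBasis ℂ M'
  obtain ⟨h, hh, h0, q, hq, H⟩ := exists_denominator (fun i => hG (b.coord i))
  refine ⟨h, hh, fun D => ∑ i, q i D • b i,
    MapIn.sum _ fun i _ => (MapIn.const _ (b i)).smul (hq i), h0, fun D hD => ?_⟩
  rw [inv_smul_eq_iff₀ hD, ← b.sum_repr (G D), Finset.smul_sum]
  refine Finset.sum_congr rfl fun i _ => ?_
  rw [← H D hD i, mul_smul]
  rfl

/-- To prove that `φ` is regular it suffices to give coordinates of the image that are locally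
rational functions. -/
theorem isRegularOn_of_mapIn {X X' : Type*} [Module.Finite ℂ M'] {rel : M → X → Prop}
    {rel' : M' → X' → Prop} {φ : X → X'} {U : Set X}
    (H : ∀ D₀, ∀ x₀ ∈ U, rel D₀ x₀ → ∃ G : M → M', MapIn (ratAt D₀) G ∧
      ∃ k ∈ polyFun M, k D₀ ≠ 0 ∧ ∀ D, ∀ x ∈ U, rel D x → k D ≠ 0 → rel' (G D) (φ x)) :
    IsRegularOn rel rel' φ U := by
  intro D₀ x₀ hx₀ hD₀
  obtain ⟨G, hG, k, hk, hk0, hrel⟩ := H D₀ x₀ hx₀ hD₀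
  obtain ⟨h, hh, Ψ, hΨ, h0, hGΨ⟩ := hG.exists_isPolyMap
  refine ⟨_, mul_mem hk hh, fun D => k D • Ψ D, MapIn.smul hk hΨ, mul_ne_zero hk0 h0,
    fun D x hx hD hkh => ?_⟩
  have h1 : k D ≠ 0 := left_ne_zero_of_mul hkh
  have h2 : h D ≠ 0 := right_ne_zero_of_mul hkh
  have := hrel D x hx hD h1
  rw [← hGΨ D h2] at this
  convert this using 1
  simp only [Pi.mul_apply, smul_smul]
  congr 1
  field_simp

theorem IsRegularOn.exists_mapIn {X X' : Type*} {rel : M → X → Prop}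
    {rel' : M' → X' → Prop} {φ : X → X'} {U : Set X} (H : IsRegularOn rel rel' φ U)
    {D₀ : M} {x₀ : X} (hx₀ : x₀ ∈ U) (hD₀ : rel D₀ x₀) :
    ∃ G : M → M', MapIn (ratAt D₀) G ∧
      ∃ k ∈ polyFun M, k D₀ ≠ 0 ∧ ∀ D, ∀ x ∈ U, rel D x → k D ≠ 0 → rel' (G D) (φ x) := by
  obtain ⟨h, hh, Ψ, hΨ, h0, hrel⟩ := H D₀ x₀ hx₀ hD₀
  exact ⟨fun D => (h D)⁻¹ • Ψ D, MapIn.smul (inv_mem_ratAt (polyFun_le_ratAt _ hh) h0)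
    (MapIn.mono (polyFun_le_ratAt _) hΨ), h, hh, h0, hrel⟩

/-- Membership in `ratAt D₀` is local at `D₀`, so arbitrary values of choice-based constructions at
degenerate coordinates do no harm. -/
theorem ratAt_congr {D₀ : M} {f f' : M → ℂ} (hf' : f' ∈ ratAt D₀) {k : M → ℂ}
    (hk : k ∈ ratAt D₀) (hk0 : k D₀ ≠ 0) (H : ∀ D, k D ≠ 0 → f D = f' D) : f ∈ ratAt D₀ := by
  obtain ⟨h, hh, q, hq, h0, Hf⟩ := hf'
  obtain ⟨k', hk', hk0', K⟩ := exists_polyFun_of_ratAt hk hk0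
  refine ⟨_, mul_mem hk' hh, _, mul_mem hk' hq, mul_ne_zero hk0' h0, fun D hD => ?_⟩
  rw [H D (K D (left_ne_zero_of_mul hD)), Pi.mul_apply, Pi.mul_apply,
    ← Hf D (right_ne_zero_of_mul hD), mul_assoc]

/-- Rational functions pull back along rational maps. -/
theorem ratAt_comp {D₀ : M} {G : M → M'} (hG : MapIn (ratAt D₀) G) {f : M' → ℂ}
    (hf : f ∈ ratAt (G D₀)) : (fun D => f (G D)) ∈ ratAt D₀ := by
  obtain ⟨h, hh, q, hq, h0, H⟩ := hf
  refine ratAt_congr (mul_mem (inv_mem_ratAt (polyFun_comp hG hh) h0) (polyFun_comp hG hq))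
    (polyFun_comp hG hh) h0 fun D hD => ?_
  rw [Pi.mul_apply, ← H _ hD, inv_mul_cancel_left₀ hD]

/-! ### Polynomial functions in a basis -/

/-- A polynomial in the coordinates with respect to a basis, as a function. -/
noncomputable def polyOfBasis {ι : Type*} (b : Module.Basis ι ℂ M) :
    MvPolynomial ι ℂ →ₐ[ℂ] (M → ℂ) :=
  aeval fun i D => b.repr D i

theorem polyOfBasis_apply {ι : Type*} (b : Module.Basis ι ℂ M) (p : MvPolynomial ι ℂ) (D : M) :
    polyOfBasis b p D = eval (fun i => b.repr D i) p := by
  have : ((Pi.evalAlgHom ℂ (fun _ : M => ℂ) D).comp (polyOfBasis b)) =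
      aeval (fun i => b.repr D i) := by
    ext i
    simp [polyOfBasis]
  exact DFunLike.congr_fun this p

theorem polyOfBasis_range {ι : Type*} [Finite ι] (b : Module.Basis ι ℂ M) :
    (polyOfBasis b).range = polyFun M := by
  have := Fintype.ofFinite ι
  apply le_antisymm
  · rintro _ ⟨p, rfl⟩
    induction p using MvPolynomial.induction_on with
    | C a => simp [polyOfBasis]
    | add p q hp hq => simpa using add_mem hp hq
    | mul_X p i hp =>
      rw [map_mul]
      refine mul_mem hp ?_
      simpa [polyOfBasis] using linear_mem_polyFun (b.coord i)
  · refine Algebra.adjoin_le ?_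
    rintro _ ⟨l, rfl⟩
    refine ⟨∑ i, C (l (b i)) * X i, ?_⟩
    ext D
    change polyOfBasis b _ D = l D
    rw [polyOfBasis_apply]
    have h := congrArg l (b.sum_repr D)
    rw [map_sum] at h
    simp only [map_smul] at h
    rw [← h]
    simp [mul_comm]

theorem polyOfBasis_injective {ι : Type*} (b : Module.Basis ι ℂ M) [Finite ι] :
    Function.Injective (polyOfBasis b) := by
  intro p q h
  refine MvPolynomial.funext fun x => ?_
  have := congrFun h (b.equivFun.symm x)
  rw [polyOfBasis_apply, polyOfBasis_apply] at this
  have hx : (fun i => b.repr (b.equivFun.symm x) i) = x := by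
    ext i
    exact congrFun (b.equivFun.apply_symm_apply x) i
  rwa [hx] at this

/-- Polynomial functions are polynomials in the coordinates. -/
noncomputable def polyFunEquiv {ι : Type*} [Finite ι] (b : Module.Basis ι ℂ M) :
    MvPolynomial ι ℂ ≃ₐ[ℂ] polyFun M :=
  (AlgEquiv.ofInjective _ (polyOfBasis_injective b)).trans
    (Subalgebra.equivOfEq _ _ (polyOfBasis_range b))

theorem polyFunEquiv_apply {ι : Type*} [Finite ι] (b : Module.Basis ι ℂ M) (p : MvPolynomial ι ℂ)
    (D : M) : (polyFunEquiv b p : M → ℂ) D = eval (fun i => b.repr D i) p :=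
  polyOfBasis_apply b p D

instance [Module.Finite ℂ M] : IsDomain (polyFun M) :=
  (polyFunEquiv (Module.finBasis ℂ M)).symm.toMulEquiv.isDomain _

instance [Module.Finite ℂ M] : IsNoetherianRing (polyFun M) :=
  isNoetherianRing_of_ringEquiv _ (polyFunEquiv (Module.finBasis ℂ M)).toRingEquiv

theorem polyFun_mul_eq_zero [Module.Finite ℂ M] {a b : M → ℂ} (ha : a ∈ polyFun M)
    (hb : b ∈ polyFun M) (hab : ∀ D, a D * b D = 0) : (∀ D, a D = 0) ∨ ∀ D, b D = 0 := by
  have : (⟨a, ha⟩ : polyFun M) * ⟨b, hb⟩ = 0 := Subtype.ext (funext hab)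
  rcases mul_eq_zero.1 this with h | h
  · exact Or.inl fun D => congrFun (congrArg Subtype.val h) D
  · exact Or.inr fun D => congrFun (congrArg Subtype.val h) D

theorem exists_ne_zero_of_polyFun [Module.Finite ℂ M] {a b : M → ℂ} (ha : a ∈ polyFun M)
    (hb : b ∈ polyFun M) (ha0 : ∃ D, a D ≠ 0) (hb0 : ∃ D, b D ≠ 0) :
    ∃ D, a D ≠ 0 ∧ b D ≠ 0 := by
  by_contra! h
  rcases polyFun_mul_eq_zero ha hb (fun D => by
    by_cases h' : a D = 0
    · rw [h', zero_mul]
    · rw [h D h', mul_zero]) with h' | h'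
  · exact ha0.elim fun D hD => hD (h' D)
  · exact hb0.elim fun D hD => hD (h' D)

/-- The Nullstellensatz for prime ideals of polynomial functions. -/
theorem mem_of_vanishes_on_zeros [Module.Finite ℂ M] (q : Ideal (polyFun M)) [q.IsPrime]
    {a : polyFun M} (ha : ∀ D, (∀ c ∈ q, (c : M → ℂ) D = 0) → (a : M → ℂ) D = 0) : a ∈ q := by
  let b := Module.finBasis ℂ M
  let φ := polyFunEquiv b
  have hp : (q.comap φ.toRingEquiv.toRingHom).IsPrime := Ideal.comap_isPrime _ _
  have key : φ.symm a ∈ vanishingIdeal ℂ (zeroLocus ℂ (q.comap φ.toRingEquiv.toRingHom)) := by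
    intro x hx
    have hxe : (fun i => b.repr (b.equivFun.symm x) i) = x := by
      ext i
      exact congrFun (b.equivFun.apply_symm_apply x) i
    have := ha (b.equivFun.symm x) fun c hc => by
      have h1 := hx (φ.symm c) (by
        rw [Ideal.mem_comap]
        change φ (φ.symm c) ∈ q
        rwa [φ.apply_symm_apply])
      rw [← φ.apply_symm_apply c, polyFunEquiv_apply, hxe]
      exact h1
    rw [← φ.apply_symm_apply a, polyFunEquiv_apply, hxe] at this
    exact this
  rw [IsPrime.vanishingIdeal_zeroLocus, Ideal.mem_comap] at key
  change φ (φ.symm a) ∈ q at key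
  rwa [φ.apply_symm_apply] at key

end Calculus


/-! ### Families of polynomials -/

section Families

set_option linter.unusedSectionVars false

variable {M : Type*} [AddCommGroup M] [Module ℂ M] {σ τ : Type*}

instance [Finite σ] (n : ℕ) : Module.Finite ℂ (homogeneousSubmodule σ ℂ n) :=
  Module.Finite.iff_fg.2 (homogeneousSubmodule_fg _ _ n)

/-- The exponents of the monomials of degree `n`. -/
noncomputable def degMonomials (σ : Type*) [Finite σ] (n : ℕ) : Finset (σ →₀ ℕ) :=
  (Finsupp.finite_of_degree_eq (σ := σ) n).toFinset

theorem mem_degMonomials [Finite σ] {n : ℕ} {s : σ →₀ ℕ} :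
    s ∈ degMonomials σ n ↔ s.degree = n := by
  simp [degMonomials]

theorem sum_degMonomials [Finite σ] {F : MvPolynomial σ ℂ} {n : ℕ} (hF : F.IsHomogeneous n) :
    F = ∑ s ∈ degMonomials σ n, monomial s (coeff s F) := by
  classical
  ext s
  rw [coeff_sum]
  simp only [coeff_monomial]
  rw [Finset.sum_ite_eq' (degMonomials σ n) s]
  split_ifs with h
  · rfl
  · exact hF.coeff_eq_zero (fun h' => h (mem_degMonomials.2 h'))

/-- All coefficients of the family of polynomials `F` belong to `O`. -/
def CoeffIn (O : Subalgebra ℂ (M → ℂ)) (F : M → MvPolynomial σ ℂ) : Prop :=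
  ∀ s, (fun D => coeff s (F D)) ∈ O

variable {O : Subalgebra ℂ (M → ℂ)} {F G : M → MvPolynomial σ ℂ}

theorem CoeffIn.const (p : MvPolynomial σ ℂ) : CoeffIn O fun _ => p :=
  fun s => const_mem_subalgebra O (coeff s p)

theorem CoeffIn.add (hF : CoeffIn O F) (hG : CoeffIn O G) : CoeffIn O fun D => F D + G D :=
  fun s => by simp only [coeff_add]; exact O.add_mem (hF s) (hG s)

theorem CoeffIn.sub (hF : CoeffIn O F) (hG : CoeffIn O G) : CoeffIn O fun D => F D - G D :=
  fun s => by simp only [coeff_sub]; exact O.sub_mem (hF s) (hG s)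

theorem CoeffIn.mul (hF : CoeffIn O F) (hG : CoeffIn O G) : CoeffIn O fun D => F D * G D :=
  fun s => by
    classical
    simp only [coeff_mul]
    exact sum_mem_subalgebra _ fun x _ => O.mul_mem (hF x.1) (hG x.2)

theorem CoeffIn.scalar {c : M → ℂ} (hc : c ∈ O) : CoeffIn (σ := σ) O fun D => C (c D) :=
  fun s => by
    classical
    simp only [coeff_C]
    by_cases h : 0 = s
    · simp only [h, if_true]; exact hc
    · simp only [h, if_false]; exact const_mem_subalgebra O 0

theorem CoeffIn.sum {ι : Type*} (s : Finset ι) {F : ι → M → MvPolynomial σ ℂ}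
    (hF : ∀ i ∈ s, CoeffIn O (F i)) : CoeffIn O fun D => ∑ i ∈ s, F i D :=
  fun m => by simp only [coeff_sum]; exact sum_mem_subalgebra s fun i hi => hF i hi m

theorem CoeffIn.prod {ι : Type*} (s : Finset ι) {F : ι → M → MvPolynomial σ ℂ}
    (hF : ∀ i ∈ s, CoeffIn O (F i)) : CoeffIn O fun D => ∏ i ∈ s, F i D := by
  classical
  induction s using Finset.induction_on with
  | empty => simpa using CoeffIn.const 1
  | insert i s hi ih =>
    simp only [Finset.prod_insert hi]
    exact (hF i (Finset.mem_insert_self i s)).mul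
      (ih fun j hj => hF j (Finset.mem_insert_of_mem hj))

theorem CoeffIn.pow (hF : CoeffIn O F) (n : ℕ) : CoeffIn O fun D => F D ^ n := by
  simpa using CoeffIn.prod (Finset.range n) (fun _ _ => hF)

theorem aeval_eq_sum_degMonomials {S : Type*} [CommRing S] [Algebra ℂ S] [Fintype σ]
    {p : MvPolynomial σ ℂ} {n : ℕ} (hp : p.IsHomogeneous n) (g : σ → S) :
    aeval g p = ∑ s ∈ degMonomials σ n, algebraMap ℂ S (coeff s p) * ∏ i, g i ^ s i := by
  conv_lhs => rw [sum_degMonomials hp, map_sum]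
  refine Finset.sum_congr rfl fun s _ => ?_
  rw [aeval_monomial, Finsupp.prod_fintype _ _ (fun i => pow_zero _)]

theorem CoeffIn.subst [Fintype σ] {n : ℕ} (hF : CoeffIn O F) (hn : ∀ D, (F D).IsHomogeneous n)
    {g : σ → M → MvPolynomial τ ℂ} (hg : ∀ i, CoeffIn O (g i)) :
    CoeffIn O fun D => aeval (fun i => g i D) (F D) := by
  simp only [aeval_eq_sum_degMonomials (hn _)]
  exact CoeffIn.sum _ fun s _ => (CoeffIn.scalar (hF s)).mul
    (CoeffIn.prod _ fun i _ => (hg i).pow _)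

theorem CoeffIn.eval [Fintype σ] {n : ℕ} (hF : CoeffIn O F) (hn : ∀ D, (F D).IsHomogeneous n)
    {v : M → σ → ℂ} (hv : ∀ i, (fun D => v D i) ∈ O) :
    (fun D => MvPolynomial.eval (v D) (F D)) ∈ O := by
  simp only [← MvPolynomial.coe_aeval_eq_eval, RingHom.coe_coe,
    aeval_eq_sum_degMonomials (hn _)]
  exact sum_mem_subalgebra _ fun s _ => O.mul_mem (hF s)
    (prod_mem_subalgebra _ fun i _ => O.pow_mem (hv i) _)

theorem coeff_mem_polyFun (n : ℕ) (s : σ →₀ ℕ) :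
    (fun p : homogeneousSubmodule σ ℂ n => coeff s p.1) ∈ polyFun (homogeneousSubmodule σ ℂ n) :=
  linear_mem_polyFun ((lcoeff ℂ s).comp (homogeneousSubmodule σ ℂ n).subtype)

theorem MapIn.coeffIn {n : ℕ} {F : M → homogeneousSubmodule σ ℂ n} (hF : MapIn O F) :
    CoeffIn O fun D => (F D : MvPolynomial σ ℂ) :=
  fun s => hF ((lcoeff ℂ s).comp (homogeneousSubmodule σ ℂ n).subtype)

theorem CoeffIn.mapIn [Finite σ] {n : ℕ} {F : M → homogeneousSubmodule σ ℂ n}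
    (hF : CoeffIn O fun D => (F D : MvPolynomial σ ℂ)) : MapIn O F := by
  classical
  let e : (σ →₀ ℕ) → homogeneousSubmodule σ ℂ n := fun s =>
    if h : s.degree = n then ⟨monomial s 1, isHomogeneous_monomial _ h⟩ else 0
  have : F = fun D => ∑ s ∈ degMonomials σ n, coeff s (F D).1 • e s := by
    ext1 D
    refine Subtype.ext ?_
    rw [AddSubmonoidClass.coe_finsetSum]
    conv_lhs => rw [sum_degMonomials (F D).2]
    refine Finset.sum_congr rfl fun s hs => ?_
    simp [e, mem_degMonomials.1 hs, smul_monomial]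
  rw [this]
  exact MapIn.sum _ fun s _ => MapIn.smul (hF s) (MapIn.const _ _)

end Families

/-! ### Homogeneous polynomials -/

section Homogeneous

variable {σ : Type*}

theorem homogeneousComponent_mul_of_isHomogeneous {p q : MvPolynomial σ ℂ} {m : ℕ}
    (hp : p.IsHomogeneous m) (k : ℕ) :
    homogeneousComponent (m + k) (p * q) = p * homogeneousComponent k q := by
  conv_lhs => rw [← sum_homogeneousComponent q, Finset.mul_sum, map_sum]
  have h : ∀ i, homogeneousComponent (m + k) (p * homogeneousComponent i q) =
      if i = k then p * homogeneousComponent k q else 0 := by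
    intro i
    rw [homogeneousComponent_of_mem (hp.mul (homogeneousComponent_isHomogeneous i q))]
    by_cases h : i = k
    · simp [h]
    · rw [if_neg (by omega), if_neg h]
  simp only [h, Finset.sum_ite_eq', Finset.mem_range]
  split_ifs with hk
  · rfl
  · rw [homogeneousComponent_eq_zero _ _ (by omega), mul_zero]

theorem homogeneousComponent_mul_of_lt {p q : MvPolynomial σ ℂ} {m n : ℕ}
    (hp : p.IsHomogeneous m) (hn : n < m) : homogeneousComponent n (p * q) = 0 := by
  conv_lhs => rw [← sum_homogeneousComponent q, Finset.mul_sum, map_sum]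
  refine Finset.sum_eq_zero fun i _ => ?_
  rw [homogeneousComponent_of_mem (hp.mul (homogeneousComponent_isHomogeneous i q)),
    if_neg (by omega)]

theorem isHomogeneous_right_of_mul {p q : MvPolynomial σ ℂ} {m n : ℕ} (hp : p.IsHomogeneous m)
    (hp0 : p ≠ 0) (hpq : (p * q).IsHomogeneous n) : q.IsHomogeneous (n - m) := by
  by_cases hmn : m ≤ n
  · obtain ⟨k, rfl⟩ := Nat.exists_eq_add_of_le hmn
    have h := homogeneousComponent_mul_of_isHomogeneous (q := q) hp k
    rw [homogeneousComponent_eq_self hpq] at h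
    rw [mul_left_cancel₀ hp0 h, Nat.add_sub_cancel_left]
    exact homogeneousComponent_isHomogeneous _ _
  · have h := homogeneousComponent_mul_of_lt (q := q) hp (not_le.1 hmn)
    rw [homogeneousComponent_eq_self hpq] at h
    rw [(mul_eq_zero.1 h).resolve_left hp0]
    exact isHomogeneous_zero _ _ _

theorem eq_zero_of_mul_isHomogeneous {p q : MvPolynomial σ ℂ} {m n : ℕ} (hp : p.IsHomogeneous m)
    (hp0 : p ≠ 0) (hpq : (p * q).IsHomogeneous n) (hmn : n < m) : q = 0 := by
  have h := homogeneousComponent_mul_of_lt (q := q) hp hmn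
  rw [homogeneousComponent_eq_self hpq] at h
  exact (mul_eq_zero.1 h).resolve_left hp0

/-- The polynomial in a new variable whose coefficients are the homogeneous components. -/
noncomputable def gradedHom (σ : Type*) :
    MvPolynomial σ ℂ →ₐ[ℂ] Polynomial (MvPolynomial σ ℂ) :=
  aeval fun i => Polynomial.X * Polynomial.C (X i)

theorem gradedHom_monomial (s : σ →₀ ℕ) (c : ℂ) : gradedHom σ (monomial s c) =
    Polynomial.monomial s.degree (monomial s c) := by
  rw [gradedHom, aeval_monomial, ← Polynomial.C_mul_X_pow_eq_monomial, monomial_eq]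
  simp only [Finsupp.prod, mul_pow, Finset.prod_mul_distrib, Finset.prod_pow_eq_pow_sum,
    Finsupp.degree_apply, map_mul, map_prod, map_pow]
  rw [show (algebraMap ℂ (Polynomial (MvPolynomial σ ℂ))) c = Polynomial.C (C c) from rfl]
  ring

theorem coeff_gradedHom (r : MvPolynomial σ ℂ) (k : ℕ) :
    (gradedHom σ r).coeff k = homogeneousComponent k r := by
  induction r using MvPolynomial.monomial_add_induction_on with
  | C c =>
    rw [← monomial_zero', gradedHom_monomial, Polynomial.coeff_monomial,
      homogeneousComponent_of_mem (isHomogeneous_monomial c rfl)]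
    simp [eq_comm]
  | monomial_add s c f _ _ ih =>
    rw [map_add, Polynomial.coeff_add, ih, map_add, gradedHom_monomial, Polynomial.coeff_monomial,
      homogeneousComponent_of_mem (isHomogeneous_monomial c rfl)]
    simp [eq_comm]

theorem gradedHom_ne_zero {r : MvPolynomial σ ℂ} (hr : r ≠ 0) : gradedHom σ r ≠ 0 := by
  intro h
  refine hr ?_
  rw [← sum_homogeneousComponent r]
  exact Finset.sum_eq_zero fun i _ => by rw [← coeff_gradedHom, h, Polynomial.coeff_zero]

theorem isHomogeneous_of_gradedHom {r : MvPolynomial σ ℂ} {n : ℕ}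
    (h1 : (gradedHom σ r).natDegree = n) (h2 : (gradedHom σ r).natTrailingDegree = n) :
    r.IsHomogeneous n := by
  have : r = homogeneousComponent n r := by
    conv_lhs => rw [← sum_homogeneousComponent r]
    have hne : ∀ i, i ≠ n → homogeneousComponent i r = 0 := by
      intro i hi
      rw [← coeff_gradedHom]
      rcases lt_or_gt_of_ne hi with h | h
      · exact Polynomial.coeff_eq_zero_of_lt_natTrailingDegree (h2 ▸ h)
      · exact Polynomial.coeff_eq_zero_of_natDegree_lt (h1 ▸ h)
    by_cases hlt : n < r.totalDegree + 1
    · exact Finset.sum_eq_single_of_mem _ (Finset.mem_range.2 hlt) fun i _ hi => hne i hi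
    · rw [homogeneousComponent_eq_zero _ _ (by omega)]
      exact Finset.sum_eq_zero fun i hi => hne i (by rw [Finset.mem_range] at hi; omega)
  rw [this]
  exact homogeneousComponent_isHomogeneous _ _

/-- The factors of a nonzero homogeneous polynomial are homogeneous. -/
theorem exists_isHomogeneous_of_mul {p q : MvPolynomial σ ℂ} {n : ℕ}
    (hpq : (p * q).IsHomogeneous n) (h0 : p * q ≠ 0) :
    ∃ a b, p.IsHomogeneous a ∧ q.IsHomogeneous b ∧ a + b = n := by
  have hp0 := gradedHom_ne_zero (left_ne_zero_of_mul h0)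
  have hq0 := gradedHom_ne_zero (right_ne_zero_of_mul h0)
  have hΦ : gradedHom σ p * gradedHom σ q = Polynomial.monomial n (p * q) := by
    rw [← map_mul]
    ext1 k
    rw [coeff_gradedHom, Polynomial.coeff_monomial, homogeneousComponent_of_mem hpq]
    simp [eq_comm]
  -- Degree and trailing degree are both additive and agree for the product, which is a monomial;
  -- hence they agree for each factor.
  have h1 := Polynomial.natDegree_mul hp0 hq0
  have h2 := Polynomial.natTrailingDegree_mul hp0 hq0
  rw [hΦ, Polynomial.natDegree_monomial_eq _ h0] at h1
  rw [hΦ, Polynomial.natTrailingDegree_monomial h0] at h2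
  have h3 := Polynomial.natTrailingDegree_le_natDegree (gradedHom σ p)
  have h4 := Polynomial.natTrailingDegree_le_natDegree (gradedHom σ q)
  exact ⟨_, _, isHomogeneous_of_gradedHom rfl (by omega),
    isHomogeneous_of_gradedHom rfl (by omega), h1.symm⟩

theorem eval_smul_of_isHomogeneous {p : MvPolynomial σ ℂ} {n : ℕ} (hp : p.IsHomogeneous n)
    (c : ℂ) (x : σ → ℂ) : eval (c • x) p = c ^ n * eval x p := by
  rw [eval_eq, eval_eq, Finset.mul_sum]
  refine Finset.sum_congr rfl fun s hs => ?_
  rw [hp.degree_eq_sum_deg_support hs, ← Finset.prod_pow_eq_pow_sum]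
  simp only [Pi.smul_apply, smul_eq_mul, mul_pow, Finset.prod_mul_distrib]
  ring

theorem eval_zero_of_isHomogeneous {p : MvPolynomial σ ℂ} {n : ℕ} (hp : p.IsHomogeneous n)
    (hn : n ≠ 0) : eval (0 : σ → ℂ) p = 0 := by
  have := eval_smul_of_isHomogeneous hp 0 0
  rwa [zero_pow hn, zero_mul, zero_smul] at this

end Homogeneous

/-! ### Directional derivatives -/

section DirDeriv

variable {σ : Type*} [Fintype σ]

/-- The derivative of `F` at `x` in the direction `v`. -/
noncomputable def dirDeriv (F : MvPolynomial σ ℂ) (x v : σ → ℂ) : ℂ :=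
  ∑ i, v i * eval x (pderiv i F)

theorem dirDeriv_add (F G : MvPolynomial σ ℂ) (x v : σ → ℂ) :
    dirDeriv (F + G) x v = dirDeriv F x v + dirDeriv G x v := by
  simp [dirDeriv, mul_add, Finset.sum_add_distrib]

theorem dirDeriv_sub (F G : MvPolynomial σ ℂ) (x v : σ → ℂ) :
    dirDeriv (F - G) x v = dirDeriv F x v - dirDeriv G x v := by
  simp [dirDeriv, mul_sub, Finset.sum_sub_distrib]

theorem dirDeriv_C_mul (c : ℂ) (F : MvPolynomial σ ℂ) (x v : σ → ℂ) :
    dirDeriv (C c * F) x v = c * dirDeriv F x v := by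
  simp only [dirDeriv, pderiv_C_mul, map_mul, eval_C, Finset.mul_sum]
  exact Finset.sum_congr rfl fun i _ => by ring

theorem dirDeriv_sum {ι : Type*} (s : Finset ι) (F : ι → MvPolynomial σ ℂ) (x v : σ → ℂ) :
    dirDeriv (∑ j ∈ s, F j) x v = ∑ j ∈ s, dirDeriv (F j) x v := by
  simp only [dirDeriv, map_sum, Finset.mul_sum]
  exact Finset.sum_comm

theorem dirDeriv_X (i : σ) (x v : σ → ℂ) : dirDeriv (X i) x v = v i := by
  classical
  simp [dirDeriv, pderiv_X, Pi.single_apply, apply_ite]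

theorem dirDeriv_mul (F G : MvPolynomial σ ℂ) (x v : σ → ℂ) :
    dirDeriv (F * G) x v = dirDeriv F x v * eval x G + eval x F * dirDeriv G x v := by
  simp only [dirDeriv, Derivation.leibniz, map_add, smul_eq_mul, map_mul, Finset.sum_mul,
    Finset.mul_sum, ← Finset.sum_add_distrib]
  exact Finset.sum_congr rfl fun i _ => by ring

theorem dirDeriv_pow (F : MvPolynomial σ ℂ) (n : ℕ) (x v : σ → ℂ) :
    dirDeriv (F ^ n) x v = n * eval x F ^ (n - 1) * dirDeriv F x v := by
  induction n with
  | zero => simp [dirDeriv]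
  | succ n ih =>
    rw [pow_succ, dirDeriv_mul, ih, map_pow]
    rcases n with _ | n
    · simp
    · simp only [Nat.add_sub_cancel, Nat.cast_add, Nat.cast_one]
      ring

theorem dirDeriv_smul_right (F : MvPolynomial σ ℂ) (x : σ → ℂ) (c : ℂ) (v : σ → ℂ) :
    dirDeriv F x (c • v) = c * dirDeriv F x v := by
  simp [dirDeriv, Finset.mul_sum, mul_assoc]

theorem dirDeriv_add_right (F : MvPolynomial σ ℂ) (x v w : σ → ℂ) :
    dirDeriv F x (v + w) = dirDeriv F x v + dirDeriv F x w := by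
  simp [dirDeriv, add_mul, Finset.sum_add_distrib]

theorem dirDeriv_single [DecidableEq σ] (F : MvPolynomial σ ℂ) (x : σ → ℂ) (i : σ) :
    dirDeriv F x (Pi.single i 1) = eval x (pderiv i F) := by
  simp [dirDeriv, Pi.single_apply]

/-- Links the formal derivative to the analytic one. Uniqueness of derivatives then gives the chain
rule for linear substitutions and lets derivatives be compared for forms that agree only on a
hyperplane. -/
theorem hasDerivAt_eval (F : MvPolynomial σ ℂ) (x v : σ → ℂ) :
    HasDerivAt (fun t : ℂ => eval (x + t • v) F) (dirDeriv F x v) 0 := by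
  classical
  induction F using MvPolynomial.induction_on with
  | C a => simpa [dirDeriv] using hasDerivAt_const (0 : ℂ) a
  | add p q hp hq =>
    simp only [map_add]
    rw [dirDeriv_add]
    exact hp.add hq
  | mul_X p i hp =>
    have hX : HasDerivAt (fun t : ℂ => eval (x + t • v) (X i : MvPolynomial σ ℂ))
        (dirDeriv (X i) x v) 0 := by
      simp only [eval_X, Pi.add_apply, Pi.smul_apply, smul_eq_mul, dirDeriv, pderiv_X]
      have : HasDerivAt (fun t : ℂ => x i + t * v i) (v i) 0 := by
        simpa using ((hasDerivAt_id (0 : ℂ)).mul_const (v i)).const_add (x i)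
      convert this using 1
      simp [Pi.single_apply, apply_ite]
    have h := hp.mul hX
    rw [dirDeriv_mul]
    simp only [zero_smul, add_zero] at h
    simp only [map_mul]
    exact h

theorem dirDeriv_self {F : MvPolynomial σ ℂ} {n : ℕ} (hF : F.IsHomogeneous n) (x : σ → ℂ) :
    dirDeriv F x x = n * eval x F := by
  have := congrArg (eval x) hF.sum_X_mul_pderiv
  simpa [dirDeriv] using this

end DirDeriv


/-! ### Elimination -/

section Elimination

variable {M : Type*} [AddCommGroup M] [Module ℂ M] {σ : Type*}

theorem det_mem_subalgebra {O : Subalgebra ℂ (M → ℂ)} {ι : Type*} [Fintype ι] [DecidableEq ι]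
    {A : M → Matrix ι ι ℂ} (hA : ∀ i j, (fun D => A D i j) ∈ O) : (fun D => (A D).det) ∈ O := by
  simp only [Matrix.det_apply, Units.smul_def, zsmul_eq_mul]
  exact sum_mem_subalgebra _ fun s _ => O.mul_mem (const_mem_subalgebra O _)
    (prod_mem_subalgebra _ fun i _ => hA _ _)

/-- If homogeneous polynomials have no nontrivial common zero, then they generate all polynomials
of high degree. -/
theorem exists_monomials_mem_span [Fintype σ] {J : Type*} (f : J → MvPolynomial σ ℂ)
    (h0 : ∀ y : σ → ℂ, y ≠ 0 → ∃ j, eval y (f j) ≠ 0) :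
    ∃ K, ∀ s : σ →₀ ℕ, K ≤ s.degree → monomial s (1 : ℂ) ∈ Ideal.span (Set.range f) := by
  classical
  set I := Ideal.span (Set.range f)
  -- The only possible common zero is the origin, so by the Nullstellensatz every variable has a
  -- power in the ideal.
  have hX : ∀ i : σ, ∃ k, (X i : MvPolynomial σ ℂ) ^ k ∈ I := by
    intro i
    change X i ∈ I.radical
    rw [← vanishingIdeal_zeroLocus_eq_radical (K := ℂ)]
    intro y hy
    have hy0 : y = 0 := by
      by_contra hy0
      obtain ⟨j, hj⟩ := h0 y hy0
      exact hj (hy _ (Ideal.subset_span ⟨j, rfl⟩))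
    simp [hy0]
  choose k hk using hX
  refine ⟨∑ i, k i + 1, fun s hs => ?_⟩
  obtain ⟨i, hi⟩ : ∃ i, k i ≤ s i := by
    by_contra! h
    have : s.degree ≤ ∑ i, k i := by
      rw [Finsupp.degree_eq_sum]
      exact Finset.sum_le_sum fun i _ => (h i).le
    omega
  have : monomial s (1 : ℂ) = monomial (s - Finsupp.single i (k i)) 1 * X i ^ k i := by
    rw [X_pow_eq_monomial, monomial_mul, one_mul, tsub_add_cancel_of_le]
    rwa [Finsupp.single_le_iff]
  rw [this]
  exact I.mul_mem_left _ (hk i)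

/-- The parameters for which homogeneous equations have only the trivial common zero form an open
set. -/
theorem exists_neighbourhood_no_common_zero [Fintype σ] {J : Type*} [Finite J] (deg : J → ℕ)
    (f : J → M → MvPolynomial σ ℂ) (hf : ∀ j, CoeffIn (polyFun M) (f j))
    (hdeg : ∀ j D, (f j D).IsHomogeneous (deg j)) (D₀ : M)
    (h0 : ∀ y : σ → ℂ, y ≠ 0 → ∃ j, eval y (f j D₀) ≠ 0) :
    ∃ g ∈ polyFun M, g D₀ ≠ 0 ∧ ∀ D, g D ≠ 0 → ∀ y : σ → ℂ, y ≠ 0 → ∃ j, eval y (f j D) ≠ 0 := by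
  classical
  have := Fintype.ofFinite J
  obtain ⟨K₀, hK₀⟩ := exists_monomials_mem_span (fun j => f j D₀) h0
  -- Large enough for all monomials of degree `K` to lie in the ideal at `D₀`, and for the cofactor
  -- degrees `K - deg j` not to truncate.
  set K := K₀ + ∑ j, deg j + 1 with hK
  have hdegK : ∀ j, deg j ≤ K := fun j =>
    (Finset.single_le_sum (fun _ _ => Nat.zero_le _) (Finset.mem_univ j)).trans (by omega)
  have hmem : ∀ s : degMonomials σ K, ∃ a : J → MvPolynomial σ ℂ,
      (∀ j, (a j).IsHomogeneous (K - deg j)) ∧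
        ∑ j, a j * f j D₀ = monomial s.1 (1 : ℂ) := by
    intro s
    have hs := mem_degMonomials.1 s.2
    obtain ⟨a, ha⟩ := (Ideal.mem_span_range_iff_exists_fun).1 (hK₀ s.1 (by omega))
    refine ⟨fun j => homogeneousComponent (K - deg j) (a j),
      fun j => homogeneousComponent_isHomogeneous _ _, ?_⟩
    have h1 := congrArg (homogeneousComponent K) ha
    rw [map_sum, homogeneousComponent_eq_self (isHomogeneous_monomial _ hs)] at h1
    rw [← h1]
    refine Finset.sum_congr rfl fun j _ => ?_
    rw [mul_comm (a j), mul_comm _ (f j D₀),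
      ← homogeneousComponent_mul_of_isHomogeneous (hdeg j D₀), Nat.add_sub_cancel' (hdegK j)]
  choose a ha hsum using hmem
  -- The cofactors found at `D₀` are kept while the equations vary. At `D₀` the matrix is the
  -- identity. A common zero `y` puts the vector of monomials of `y` in its kernel, so the
  -- determinant is the required open condition.
  let T : M → Matrix (degMonomials σ K) (degMonomials σ K) ℂ := fun D => Matrix.of fun s s' =>
    coeff s'.1 (∑ j, a s j * f j D)
  refine ⟨fun D => (T D).det, det_mem_subalgebra fun s s' => ?_, ?_, fun D hD y hy => ?_⟩
  · exact CoeffIn.sum Finset.univ (fun j _ => (CoeffIn.const (a s j)).mul (hf j)) s'.1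
  · have : T D₀ = 1 := by
      ext s s'
      simp only [T, Matrix.of_apply, hsum, coeff_monomial, Matrix.one_apply, Subtype.ext_iff]
    simp [this]
  · by_contra! h
    have hker : (T D).mulVec (fun s => ∏ i, y i ^ s.1 i) = 0 := by
      ext s
      have hhom : (∑ j, a s j * f j D).IsHomogeneous K :=
        IsHomogeneous.sum _ _ _ fun j _ => by
          have := (ha s j).mul (hdeg j D)
          rwa [Nat.sub_add_cancel (hdegK j)] at this
      have h1 := aeval_eq_sum_degMonomials hhom y
      have h2 : aeval y (∑ j, a s j * f j D) = 0 := by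
        rw [map_sum]
        refine Finset.sum_eq_zero fun j _ => ?_
        rw [map_mul, show aeval y (f j D) = 0 from h j, mul_zero]
      rw [h2, ← Finset.sum_coe_sort] at h1
      exact h1.symm
    have h3 := Matrix.eq_zero_of_mulVec_eq_zero hD hker
    refine hy (funext fun i => ?_)
    have hi : (Finsupp.single i K) ∈ degMonomials σ K := mem_degMonomials.2 (by simp)
    have h4 := congrFun h3 ⟨_, hi⟩
    simp only [Pi.zero_apply] at h4
    rw [Finset.prod_eq_single i (fun j _ hj => by simp [hj.symm]) (by simp),
      Finsupp.single_eq_same] at h4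
    exact eq_zero_of_pow_eq_zero h4

end Elimination

/-! ### Principal ideals -/

section Principal

/-- A nonzero prime ideal of `B[X]` that meets `B` trivially is generated by an irreducible
polynomial, if `B` is a unique factorization domain. -/
theorem exists_generator_of_isPrime {B : Type*} [CommRing B] [IsDomain B]
    [UniqueFactorizationMonoid B] (I : Ideal (Polynomial B)) [I.IsPrime] (hI : I ≠ ⊥)
    (hB : ∀ b : B, Polynomial.C b ∈ I → b = 0) :
    ∃ R ∈ I, ∀ g ∈ I, R ∣ g := by
  classical
  obtain ⟨g, hg, hg0⟩ := Submodule.exists_mem_ne_zero_of_ne_bot hI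
  obtain ⟨R, hRI, hR⟩ : ∃ R ∈ I, Irreducible R := by
    have hfac : ∀ g : Polynomial B, g ≠ 0 → g ∈ I → ∃ R ∈ I, Irreducible R := by
      intro g hg0
      induction g using UniqueFactorizationMonoid.induction_on_prime with
      | h₁ => exact absurd rfl hg0
      | h₂ x hx => exact fun h => absurd (I.eq_top_of_isUnit_mem h hx) Ideal.IsPrime.ne_top'
      | h₃ a p ha hp ih =>
        intro h
        rcases Ideal.IsPrime.mem_or_mem ‹_› h with h | h
        · exact ⟨p, h, hp.irreducible⟩
        · exact ih ha h
    exact hfac g hg0 hg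
  refine ⟨R, hRI, fun g hg => ?_⟩
  have hdeg : R.natDegree ≠ 0 := by
    intro h
    obtain ⟨b, hb⟩ := Polynomial.natDegree_eq_zero.1 h
    rw [← hb] at hRI hR
    rw [hB b hRI, Polynomial.C_0] at hR
    exact not_irreducible_zero hR
  have hprim : R.IsPrimitive := hR.isPrimitive hdeg
  have hirr := (hprim.irreducible_iff_irreducible_map_fraction_map (K := FractionRing B)).1 hR
  -- The resultant lies in the ideal and in `B`, hence vanishes. So `R` and `g` have a common factor
  -- over the fraction field; as `R` is irreducible there, it divides `g`, and primitivity brings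
  -- the divisibility back to `B[X]`.
  obtain ⟨p, q, -, -, hpq⟩ := Polynomial.exists_mul_add_mul_eq_C_resultant R g le_rfl le_rfl
    (Or.inl hdeg)
  have hres : R.resultant g R.natDegree g.natDegree = 0 :=
    hB _ (hpq ▸ I.add_mem (I.mul_mem_right _ hRI) (I.mul_mem_right _ hg))
  have hinj := IsFractionRing.injective B (FractionRing B)
  have hres' : (R.map (algebraMap B (FractionRing B))).resultant
      (g.map (algebraMap B (FractionRing B))) = 0 := by
    rw [Polynomial.natDegree_map_eq_of_injective hinj, Polynomial.natDegree_map_eq_of_injective hinj,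
      Polynomial.resultant_map_map, hres, map_zero]
  have hcop := (Polynomial.resultant_eq_zero_iff.1 hres').2
  exact hprim.dvd_of_fraction_map_dvd_fraction_map
    ((EuclideanDomain.dvd_or_coprime _ _ hirr).resolve_right hcop)

theorem exists_algEquiv_polynomial {ι : Type*} (i₀ : ι) :
    ∃ e : MvPolynomial ι ℂ ≃ₐ[ℂ] Polynomial (MvPolynomial {i // i ≠ i₀} ℂ),
      ∀ b, e (rename Subtype.val b) = Polynomial.C b := by
  classical
  refine ⟨(renameEquiv ℂ (Equiv.optionSubtypeNe i₀).symm).trans (optionEquivLeft ℂ _),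
    fun b => ?_⟩
  have h : ((Equiv.optionSubtypeNe i₀).symm ∘ Subtype.val : {i // i ≠ i₀} → _) = some :=
    funext fun i => Equiv.optionSubtypeNe_symm_of_ne i.2
  rw [AlgEquiv.trans_apply, renameEquiv_apply, rename_rename, h]
  have h2 : ((optionEquivLeft ℂ {i // i ≠ i₀}).toAlgHom.comp (rename some)) =
      (Algebra.ofId (MvPolynomial {i // i ≠ i₀} ℂ)
        (Polynomial (MvPolynomial {i // i ≠ i₀} ℂ))).restrictScalars ℂ := by
    refine MvPolynomial.algHom_ext fun i => ?_
    simp [Algebra.ofId_apply]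
  exact DFunLike.congr_fun h2 b

theorem exists_generator_of_isPrime_mvPolynomial {ι : Type*} [Finite ι] (i₀ : ι)
    (I : Ideal (MvPolynomial ι ℂ)) [I.IsPrime] (hI : I ≠ ⊥)
    (hB : ∀ b : MvPolynomial {i // i ≠ i₀} ℂ, rename Subtype.val b ∈ I → b = 0) :
    ∃ R ∈ I, ∀ g ∈ I, R ∣ g := by
  obtain ⟨e, he⟩ := exists_algEquiv_polynomial i₀
  have hprime : (I.comap e.symm.toRingEquiv.toRingHom).IsPrime := Ideal.comap_isPrime _ _
  have hmem : ∀ f, f ∈ I.comap e.symm.toRingEquiv.toRingHom ↔ e.symm f ∈ I := fun f => Iff.rfl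
  obtain ⟨R, hR, hdvd⟩ := exists_generator_of_isPrime (I.comap e.symm.toRingEquiv.toRingHom) (by
    obtain ⟨g, hg, hg0⟩ := Submodule.exists_mem_ne_zero_of_ne_bot hI
    refine Submodule.ne_bot_iff _ |>.2 ⟨e g, ?_, ?_⟩
    · rw [hmem]; simpa using hg
    · simpa using hg0) (fun b hb => hB b (by
      rw [hmem, ← he, e.symm_apply_apply] at hb
      exact hb))
  refine ⟨e.symm R, hR, fun g hg => ?_⟩
  obtain ⟨c, hc⟩ := hdvd (e g) (by rw [hmem]; simpa using hg)
  exact ⟨e.symm c, by rw [← map_mul, ← hc, e.symm_apply_apply]⟩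

end Principal


/-! ### Linear forms and linear substitutions -/

section LinForm

variable {N : ℕ}

/-- A linear functional as a linear form. -/
noncomputable def linForm : Module.Dual ℂ (Vec N) →ₗ[ℂ] MvPolynomial (Fin (N + 1)) ℂ where
  toFun l := ∑ i, C (l (Pi.single i 1)) * X i
  map_add' l l' := by simp [add_mul, Finset.sum_add_distrib]
  map_smul' c l := by simp [Finset.smul_sum, smul_eq_C_mul, mul_assoc]

@[simp]
theorem eval_linForm (l : Module.Dual ℂ (Vec N)) (x : Vec N) : eval x (linForm l) = l x := by
  have h := congrArg l (pi_eq_sum_univ' x)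
  rw [map_sum] at h
  rw [h]
  simp [linForm, mul_comm]

theorem linForm_isHomogeneous (l : Module.Dual ℂ (Vec N)) : (linForm l).IsHomogeneous 1 :=
  IsHomogeneous.sum _ _ _ fun _ _ => isHomogeneous_C_mul_X _ _

theorem linForm_ne_zero {l : Module.Dual ℂ (Vec N)} (hl : l ≠ 0) : linForm l ≠ 0 := by
  intro h
  exact hl (LinearMap.ext fun x => by rw [← eval_linForm, h]; simp)

/-- Substitution of a linear map into a polynomial. -/
noncomputable def compLin (T : Vec N →ₗ[ℂ] Vec N) :
    MvPolynomial (Fin (N + 1)) ℂ →ₐ[ℂ] MvPolynomial (Fin (N + 1)) ℂ :=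
  aeval fun i => linForm ((LinearMap.proj i).comp T)

@[simp]
theorem eval_compLin (T : Vec N →ₗ[ℂ] Vec N) (F : MvPolynomial (Fin (N + 1)) ℂ) (x : Vec N) :
    eval x (compLin T F) = eval (T x) F := by
  induction F using MvPolynomial.induction_on with
  | C a => simp [compLin]
  | add p q hp hq => simp only [map_add, hp, hq]
  | mul_X p i hp =>
    rw [map_mul, map_mul, map_mul, hp, compLin, aeval_X, eval_linForm, eval_X]
    rfl

theorem compLin_isHomogeneous (T : Vec N →ₗ[ℂ] Vec N) {F : MvPolynomial (Fin (N + 1)) ℂ} {n : ℕ}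
    (hF : F.IsHomogeneous n) : (compLin T F).IsHomogeneous n := by
  have := hF.aeval (n := 1) _ fun i => linForm_isHomogeneous ((LinearMap.proj i).comp T)
  rwa [one_mul] at this

theorem dirDeriv_compLin (T : Vec N →ₗ[ℂ] Vec N) (F : MvPolynomial (Fin (N + 1)) ℂ)
    (x v : Vec N) : dirDeriv (compLin T F) x v = dirDeriv F (T x) (T v) := by
  have h1 := hasDerivAt_eval (compLin T F) x v
  simp only [eval_compLin, map_add, map_smul] at h1
  exact h1.unique (hasDerivAt_eval F (T x) (T v))

theorem dirDeriv_linForm (l : Module.Dual ℂ (Vec N)) (x v : Vec N) :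
    dirDeriv (linForm l) x v = l v := by
  have h1 := hasDerivAt_eval (linForm l) x v
  simp only [eval_linForm, map_add, map_smul, smul_eq_mul] at h1
  have h2 : HasDerivAt (fun t : ℂ => l x + t * l v) (l v) 0 := by
    simpa using ((hasDerivAt_id (0 : ℂ)).mul_const (l v)).const_add (l x)
  exact h1.unique h2

theorem dirDeriv_linForm_pow (l : Module.Dual ℂ (Vec N)) (n : ℕ) (x v : Vec N) :
    dirDeriv (linForm l ^ n) x v = n * l x ^ (n - 1) * l v := by
  rw [dirDeriv_pow, dirDeriv_linForm, eval_linForm]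

variable {M : Type*} [AddCommGroup M] [Module ℂ M] {O : Subalgebra ℂ (M → ℂ)}

theorem coeffIn_linForm {l : M → Module.Dual ℂ (Vec N)} (hl : ∀ v, (fun D => l D v) ∈ O) :
    CoeffIn O fun D => linForm (l D) :=
  CoeffIn.sum _ fun _ _ => (CoeffIn.scalar (hl _)).mul (CoeffIn.const _)

theorem CoeffIn.compLin {T : M → Vec N →ₗ[ℂ] Vec N} (hT : ∀ v i, (fun D => T D v i) ∈ O)
    {F : M → MvPolynomial (Fin (N + 1)) ℂ} (hF : CoeffIn O F) {n : ℕ}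
    (hn : ∀ D, (F D).IsHomogeneous n) : CoeffIn O fun D => StarPoints.compLin (T D) (F D) :=
  hF.subst hn fun i => coeffIn_linForm fun v => hT v i

end LinForm

/-! ### The discriminant -/

section Discriminant

/-- The monomials form a basis of the homogeneous polynomials. -/
noncomputable def formBasis (σ : Type*) [Finite σ] (n : ℕ) :
    Module.Basis (degMonomials σ n) ℂ (homogeneousSubmodule σ ℂ n) :=
  Module.Basis.ofEquivFun
    { toFun := fun p s => coeff s.1 p.1
      map_add' := fun p q => by ext; simp
      map_smul' := fun c p => by ext; simp
      invFun := fun c => ⟨∑ s, monomial s.1 (c s), IsHomogeneous.sum _ _ _ fun s _ =>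
        isHomogeneous_monomial _ (mem_degMonomials.1 s.2)⟩
      left_inv := fun p => Subtype.ext <| by
        conv_rhs => rw [sum_degMonomials p.2]
        rw [← Finset.sum_coe_sort]
      right_inv := fun c => by
        classical
        ext s
        simp [coeff_sum, coeff_monomial] }

variable {N d : ℕ}

/-- All partial derivatives of `p` vanish at `x`. -/
def IsSingularAt (p : MvPolynomial (Fin (N + 1)) ℂ) (x : Vec N) : Prop :=
  ∀ i, eval x (pderiv i p) = 0

theorem isSingularAt_iff_dirDeriv {p : MvPolynomial (Fin (N + 1)) ℂ} {x : Vec N} :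
    IsSingularAt p x ↔ ∀ v, dirDeriv p x v = 0 := by
  refine ⟨fun h v => ?_, fun h i => ?_⟩
  · simp [dirDeriv, h _]
  · rw [← dirDeriv_single, h]

theorem isHomogeneous_pderiv {p : MvPolynomial (Fin (N + 1)) ℂ} {n : ℕ} (hp : p.IsHomogeneous n)
    (i : Fin (N + 1)) : (pderiv i p).IsHomogeneous (n - 1) :=
  hp.pderiv

theorem IsSingularAt.smul {p : MvPolynomial (Fin (N + 1)) ℂ} (hp : p.IsHomogeneous d)
    {x : Vec N} (hx : IsSingularAt p x) (c : ℂ) : IsSingularAt p (c • x) := fun i => by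
  rw [eval_smul_of_isHomogeneous (isHomogeneous_pderiv hp i), hx i, mul_zero]

theorem exists_neighbourhood_smooth (p₀ : Form N d)
    (h₀ : ∀ x, x ≠ 0 → ¬ IsSingularAt p₀.1 x) :
    ∃ g ∈ polyFun (Form N d), g p₀ ≠ 0 ∧ ∀ p : Form N d, g p ≠ 0 →
      ∀ x, x ≠ 0 → ¬ IsSingularAt p.1 x := by
  have := exists_neighbourhood_no_common_zero (M := Form N d) (J := Fin (N + 1))
    (fun _ => d - 1) (fun i p => pderiv i p.1) (fun i s => linear_mem_polyFun
      ((lcoeff ℂ s).comp ((pderiv i).toLinearMap.comp (Submodule.subtype _))))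
    (fun i p => isHomogeneous_pderiv p.2 i) p₀ (fun x hx => by simpa [IsSingularAt] using h₀ x hx)
  simpa [IsSingularAt] using this

/-- Change a form by multiples of `x₀ ^ (d - 1) x_i` so that it becomes singular at `u`. -/
noncomputable def makeSingular (p : MvPolynomial (Fin (N + 1)) ℂ) (d : ℕ) (u : Vec N) :
    MvPolynomial (Fin (N + 1)) ℂ :=
  p - X 0 ^ (d - 1) * ∑ i, C (eval u (pderiv i p)) * (X i - C (u i) * X 0) -
    C (eval u p) * X 0 ^ d

/-- Together with `isSingularAt_makeSingular`, this makes `makeSingular` a projection onto the forms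
singular at `u`, for `u 0 = 1`. Forms with a singular point in this chart are thus the image of an
affine space under a polynomial map. -/
theorem makeSingular_eq_self {p : MvPolynomial (Fin (N + 1)) ℂ} (hp : p.IsHomogeneous d)
    (hd : d ≠ 0) {u : Vec N} (hu : IsSingularAt p u) : makeSingular p d u = p := by
  have h1 : eval u p = 0 := by
    have := dirDeriv_self hp u
    rw [isSingularAt_iff_dirDeriv.1 hu] at this
    simpa [hd] using this.symm
  simp [makeSingular, hu _, h1]

theorem makeSingular_isHomogeneous {p : MvPolynomial (Fin (N + 1)) ℂ} (hp : p.IsHomogeneous d)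
    (hd : d ≠ 0) (u : Vec N) : (makeSingular p d u).IsHomogeneous d := by
  refine (hp.sub ?_).sub (isHomogeneous_C_mul_X_pow _ _ _)
  have := (isHomogeneous_X_pow (R := ℂ) (0 : Fin (N + 1)) (d - 1)).mul
    (IsHomogeneous.sum Finset.univ _ 1 fun i _ => ((isHomogeneous_X ℂ i).sub
      (isHomogeneous_C_mul_X (u i) (0 : Fin (N + 1)))).C_mul (eval u (pderiv i p)))
  rwa [Nat.sub_add_cancel (Nat.pos_of_ne_zero hd)] at this

theorem isSingularAt_makeSingular {p : MvPolynomial (Fin (N + 1)) ℂ} (hp : p.IsHomogeneous d)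
    {u : Vec N} (hu : u 0 = 1) : IsSingularAt (makeSingular p d u) u := by
  rw [isSingularAt_iff_dirDeriv]
  intro v
  have he := dirDeriv_self hp u
  have h0 : eval u (∑ i, C (eval u (pderiv i p)) * (X i - C (u i) * X 0)) = 0 := by
    simp [hu]
  have h1 : dirDeriv (∑ i, C (eval u (pderiv i p)) * (X i - C (u i) * X 0)) u v =
      dirDeriv p u v - v 0 * dirDeriv p u u := by
    simp only [dirDeriv_sum, dirDeriv_C_mul, dirDeriv_sub, dirDeriv_X]
    rw [dirDeriv, dirDeriv, Finset.mul_sum, ← Finset.sum_sub_distrib]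
    exact Finset.sum_congr rfl fun i _ => by ring
  rw [makeSingular, dirDeriv_sub, dirDeriv_sub, dirDeriv_mul, h0, h1, dirDeriv_C_mul,
    dirDeriv_pow, dirDeriv_pow, dirDeriv_X, he, map_pow, eval_X, hu]
  simp only [one_pow]
  ring

end Discriminant


/-! ### Existence of a single polynomial whose zeros are exactly the singular forms -/

section Discriminant

variable {N d : ℕ}

theorem eval_map_ofReal {σ : Type*} (q : MvPolynomial σ ℝ) (y : σ → ℝ) :
    eval (fun i => (y i : ℂ)) (map Complex.ofRealHom q) = ((eval y q : ℝ) : ℂ) := by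
  have := eval₂_comp_left Complex.ofRealHom (RingHom.id ℝ) y q
  rw [RingHom.comp_id] at this
  rw [eval_map]
  exact this.symm

theorem deriv_eval_real (p : MvPolynomial (Fin (N + 1)) ℝ) (x v : Fin (N + 1) → ℝ) :
    HasDerivAt (fun t : ℝ => eval (x + t • v) p) (∑ i, v i * eval x (pderiv i p)) 0 := by
  have h := hasDerivAt_eval (map Complex.ofRealHom p) (fun i => (x i : ℂ)) (fun i => (v i : ℂ))
  have h' := HasDerivAt.real_of_complex (z := 0) (by rw [Complex.ofReal_zero]; exact h)
  have e1 : (dirDeriv (map Complex.ofRealHom p) (fun i => (x i : ℂ)) (fun i => (v i : ℂ))).re =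
      ∑ i, v i * eval x (pderiv i p) := by
    simp only [dirDeriv, pderiv_map, eval_map_ofReal, ← Complex.ofReal_mul, ← Complex.ofReal_sum,
      Complex.ofReal_re]
  rw [e1] at h'
  convert h' using 2 with t
  have e2 : ((fun i => (x i : ℂ)) + (t : ℂ) • fun i => (v i : ℂ)) =
      fun i => (((x + t • v) i : ℝ) : ℂ) := by
    ext i
    simp
  rw [e2, eval_map_ofReal, Complex.ofReal_re]

/-- A small perturbation of `-∑ x_i ^ 2` has a critical point. -/
theorem exists_critical_point (n : ℕ) (q : MvPolynomial (Fin (N + 1)) ℝ)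
    (hq : ∀ y : Fin N → ℝ, (∀ i, |y i| ≤ 1) → |eval (Fin.cons 1 y : Fin (N + 1) → ℝ) q| < 1 / 2) :
    ∃ y : Fin N → ℝ, ∀ i : Fin N, eval (Fin.cons 1 y : Fin (N + 1) → ℝ)
      (pderiv i.succ (q - ∑ i : Fin N, X 0 ^ n * X i.succ ^ 2)) = 0 := by
  classical
  set p := q - ∑ i : Fin N, X 0 ^ n * X i.succ ^ 2 with hp
  have hcons : Continuous fun y : Fin N → ℝ => (Fin.cons 1 y : Fin (N + 1) → ℝ) := by
    refine continuous_pi fun i => ?_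
    refine Fin.cases ?_ (fun j => ?_) i
    · simpa using continuous_const
    · simpa using continuous_apply j
  have hcont : Continuous fun y : Fin N → ℝ => eval (Fin.cons 1 y : Fin (N + 1) → ℝ) p :=
    (MvPolynomial.continuous_eval p).comp hcons
  have hval : ∀ y : Fin N → ℝ, eval (Fin.cons 1 y : Fin (N + 1) → ℝ) p =
      eval (Fin.cons 1 y : Fin (N + 1) → ℝ) q - ∑ i, y i ^ 2 := by
    intro y
    simp [hp]
  have hmem : ∀ y : Fin N → ℝ, y ∈ Set.Icc (-1 : Fin N → ℝ) 1 ↔ ∀ i, |y i| ≤ 1 := by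
    intro y
    simp only [Set.mem_Icc, Pi.le_def, Pi.neg_apply, Pi.one_apply, abs_le]
    exact forall_and.symm
  obtain ⟨y, hy, hmax⟩ := (isCompact_Icc (a := (-1 : Fin N → ℝ)) (b := 1)).exists_isMaxOn
    ⟨0, (hmem 0).2 (by simp)⟩ hcont.continuousOn
  -- On the boundary of the cube the function is less than 1/2 - 1, while at the origin it exceeds
  -- -1/2. So the maximum is attained in the interior and is critical.
  have hy1 := (hmem y).1 hy
  have hlt : ∀ i, |y i| < 1 := by
    intro i
    refine lt_of_le_of_ne (hy1 i) fun hi => ?_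
    have h0 := hmax ((hmem 0).2 (by simp))
    simp only [hval, Set.mem_ofPred_eq] at h0
    have h1 := abs_lt.1 (hq y hy1)
    have h2 := abs_lt.1 (hq 0 (by simp))
    have h3 : (1 : ℝ) ≤ ∑ i, y i ^ 2 := by
      have := Finset.single_le_sum (f := fun i => y i ^ 2) (fun j _ => sq_nonneg (y j))
        (Finset.mem_univ i)
      rw [← sq_abs, hi] at this
      simpa using this
    simp only [Pi.zero_apply, ne_eq, OfNat.ofNat_ne_zero, not_false_eq_true, zero_pow,
      Finset.sum_const_zero, sub_zero] at h0
    linarith [h1.2, h2.1]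
  refine ⟨y, fun i => ?_⟩
  have hderiv := deriv_eval_real p (Fin.cons 1 y) (Pi.single i.succ 1)
  have hsum : ∑ j, (Pi.single i.succ 1 : Fin (N + 1) → ℝ) j *
      eval (Fin.cons 1 y : Fin (N + 1) → ℝ) (pderiv j p) =
      eval (Fin.cons 1 y : Fin (N + 1) → ℝ) (pderiv i.succ p) := by
    simp [Pi.single_apply]
  rw [hsum] at hderiv
  have hline : ∀ t : ℝ, (Fin.cons 1 y + t • Pi.single i.succ 1 : Fin (N + 1) → ℝ) =
      Fin.cons 1 (y + t • Pi.single i 1) := by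
    intro t
    ext j
    refine Fin.cases ?_ (fun k => ?_) j
    · simp
    · simp [Pi.single_apply]
  simp only [hline] at hderiv
  refine IsLocalMax.hasDerivAt_eq_zero ?_ hderiv
  have hopen : IsOpen {t : ℝ | |y i + t| < 1} :=
    isOpen_lt (continuous_abs.comp (continuous_const.add continuous_id)) continuous_const
  filter_upwards [hopen.mem_nhds (by simpa using hlt i)] with t ht
  simp only [zero_smul, add_zero]
  refine hmax ((hmem _).2 fun j => ?_)
  by_cases hj : j = i
  · subst hj
    simpa using le_of_lt ht
  · simpa [hj] using hy1 j

theorem fermat_smooth (hd : d ≠ 0) (x : Vec N) (hx : x ≠ 0) :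
    ¬ IsSingularAt (∑ i, X i ^ d : MvPolynomial (Fin (N + 1)) ℂ) x := by
  intro h
  refine hx (funext fun j => ?_)
  have := isSingularAt_iff_dirDeriv.1 h (Pi.single j 1)
  rw [dirDeriv_sum] at this
  simp only [dirDeriv_pow, dirDeriv_X, eval_X] at this
  rw [Finset.sum_eq_single j (fun i _ hi => by simp [hi]) (by simp)] at this
  simpa [hd] using eq_zero_of_pow_eq_zero (n := d - 1) (by simpa [hd] using this)

/-- The polynomials in the coefficients that vanish on all forms with a singular point outside the
hyperplane `x₀ = 0`. -/
noncomputable def singularIdeal (N d : ℕ) : Ideal (MvPolynomial (degMonomials (Fin (N + 1)) d) ℂ)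
    where
  carrier := {G | ∀ p : Form N d, (∃ u : Vec N, u 0 = 1 ∧ IsSingularAt p.1 u) →
    eval (fun s => coeff s.1 p.1) G = 0}
  zero_mem' p _ := by simp
  add_mem' hF hG p hp := by simp [hF p hp, hG p hp]
  smul_mem' F G hG p hp := by simp [hG p hp]

theorem mem_singularIdeal_iff_makeSingular (hd : d ≠ 0)
    (G : MvPolynomial (degMonomials (Fin (N + 1)) d) ℂ) : G ∈ singularIdeal N d ↔
      ∀ z : Form N d × Vec N,
        eval (fun s => coeff s.1 (makeSingular z.1.1 d (Function.update z.2 0 1))) G = 0 := by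
  refine ⟨fun h z => ?_, fun h p ⟨u, hu0, hu⟩ => ?_⟩
  · exact h ⟨_, makeSingular_isHomogeneous z.1.2 hd _⟩
      ⟨_, by simp, isSingularAt_makeSingular z.1.2 (by simp)⟩
  · have := h (p, u)
    rwa [show Function.update u 0 1 = u by rw [← hu0]; simp,
      makeSingular_eq_self p.2 hd hu] at this

theorem coeffIn_makeSingular : CoeffIn (polyFun (Form N d × Vec N)) fun z =>
    makeSingular z.1.1 d (Function.update z.2 0 1) := by
  have hp : CoeffIn (polyFun (Form N d × Vec N)) fun z => z.1.1 :=
    (MapIn.linearMap (LinearMap.fst ℂ (Form N d) (Vec N))).coeffIn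
  have hdp : ∀ i, CoeffIn (polyFun (Form N d × Vec N)) fun z => pderiv i z.1.1 := fun i s =>
    linear_mem_polyFun ((lcoeff ℂ s).comp ((pderiv i).toLinearMap.comp
      ((Submodule.subtype _).comp (LinearMap.fst ℂ (Form N d) (Vec N)))))
  have hu : ∀ i, (fun z : Form N d × Vec N => Function.update z.2 0 1 i) ∈
      polyFun (Form N d × Vec N) := by
    intro i
    by_cases hi : i = 0
    · subst hi
      simpa using const_mem_subalgebra _ 1
    · simpa [hi] using linear_mem_polyFun
        ((LinearMap.proj i).comp (LinearMap.snd ℂ (Form N d) (Vec N)))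
  refine (hp.sub ((CoeffIn.const _).mul (CoeffIn.sum _ fun i _ => (CoeffIn.scalar
    ((hdp i).eval (fun z => isHomogeneous_pderiv z.1.2 i) hu)).mul ((CoeffIn.const _).sub
      ((CoeffIn.scalar (hu i)).mul (CoeffIn.const _)))))).sub
    ((CoeffIn.scalar (hp.eval (fun z => z.1.2) hu)).mul (CoeffIn.const _))

theorem eval_coeff_mem {M : Type*} [AddCommGroup M] [Module ℂ M] {O : Subalgebra ℂ (M → ℂ)}
    {σ ι : Type*} {F : M → MvPolynomial σ ℂ} (hF : CoeffIn O F) (c : ι → σ →₀ ℕ)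
    (G : MvPolynomial ι ℂ) : (fun D => eval (fun s => coeff (c s) (F D)) G) ∈ O := by
  simp only [eval_eq]
  exact sum_mem_subalgebra _ fun s _ => O.mul_mem (const_mem_subalgebra O _)
    (prod_mem_subalgebra _ fun i _ => O.pow_mem (hF _) _)

/-- The ideal of the image of an affine space under a polynomial map is prime, because polynomial
functions on affine space form a domain. -/
theorem singularIdeal_isPrime (hd : d ≠ 0) : (singularIdeal N d).IsPrime := by
  refine Ideal.isPrime_iff.2 ⟨fun h => ?_, fun {F G} h => ?_⟩
  · have h1 : (1 : MvPolynomial (degMonomials (Fin (N + 1)) d) ℂ) ∈ singularIdeal N d := by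
      rw [h]; trivial
    simpa using h1 0 ⟨Pi.single 0 1, by simp, fun i => by simp⟩
  · simp only [mem_singularIdeal_iff_makeSingular hd] at h ⊢
    refine polyFun_mul_eq_zero (eval_coeff_mem coeffIn_makeSingular _ F)
      (eval_coeff_mem coeffIn_makeSingular _ G) fun z => ?_
    rw [← map_mul]
    exact h z

/-- Smoothness is an open condition by elimination; the polynomial describing a neighbourhood of
`p₀` vanishes on all singular forms. -/
theorem exists_mem_singularIdeal (p₀ : Form N d) (h₀ : ∀ x, x ≠ 0 → ¬ IsSingularAt p₀.1 x) :
    ∃ G ∈ singularIdeal N d, eval (fun s => coeff s.1 p₀.1) G ≠ 0 := by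
  obtain ⟨g, hg, hg0, H⟩ := exists_neighbourhood_smooth p₀ h₀
  have key : ∀ p : Form N d, eval (fun s : degMonomials (Fin (N + 1)) d => coeff s.1 p.1)
      ((polyFunEquiv (formBasis (Fin (N + 1)) d)).symm ⟨g, hg⟩) = g p := by
    intro p
    have := polyFunEquiv_apply (formBasis (Fin (N + 1)) d)
      ((polyFunEquiv (formBasis (Fin (N + 1)) d)).symm ⟨g, hg⟩) p
    rw [AlgEquiv.apply_symm_apply] at this
    exact this.symm
  refine ⟨_, fun p ⟨u, hu0, hu⟩ => ?_, by rwa [key]⟩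
  rw [key]
  by_contra hp
  exact H p hp u (fun h => by simp [h] at hu0) hu

theorem singularIdeal_ne_bot (hd : d ≠ 0) : singularIdeal N d ≠ ⊥ := by
  obtain ⟨G, hG, hG0⟩ := exists_mem_singularIdeal (N := N)
    (⟨∑ i, X i ^ d, IsHomogeneous.sum _ _ _ fun i _ => isHomogeneous_X_pow i d⟩ : Form N d)
    (fermat_smooth hd)
  intro h
  rw [h, Ideal.mem_bot] at hG
  simp [hG] at hG0

/-- The singular locus dominates the space of all coefficients other than that of x₀^d, which is
what makes it a hypersurface. For real coefficients near those of `-B` there is a critical point in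
the chart x₀ = 1, by maximization; the coefficient of x₀^d is then free to make the form vanish
there. -/
theorem singularIdeal_elimination (hd : 2 ≤ d) (s₀ : degMonomials (Fin (N + 1)) d)
    (hs₀ : s₀.1 = Finsupp.single 0 d) (b : MvPolynomial {s // s ≠ s₀} ℂ)
    (hb : rename Subtype.val b ∈ singularIdeal N d) : b = 0 := by
  classical
  set B : MvPolynomial (Fin (N + 1)) ℝ := ∑ i : Fin N, X 0 ^ (d - 2) * X i.succ ^ 2 with hB
  have hBhom : B.IsHomogeneous d := IsHomogeneous.sum _ _ _ fun i _ => by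
    have := (isHomogeneous_X_pow (R := ℝ) (0 : Fin (N + 1)) (d - 2)).mul
      (isHomogeneous_X_pow (R := ℝ) i.succ 2)
    rwa [Nat.sub_add_cancel hd] at this
  obtain ⟨ε, hε, hεS⟩ : ∃ ε : ℝ, 0 < ε ∧
      Fintype.card {s : degMonomials (Fin (N + 1)) d // s ≠ s₀} * ε < 1 / 2 := by
    refine ⟨1 / (2 * (Fintype.card {s : degMonomials (Fin (N + 1)) d // s ≠ s₀} + 1)),
      by positivity, ?_⟩
    rw [mul_one_div, div_lt_div_iff₀ (by positivity) (by norm_num)]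
    linarith
  -- A polynomial vanishing on a product of infinite sets is zero. The bound on `ε` keeps the
  -- perturbation of `-B` below 1/2 on the cube.
  refine funext_set (fun s => (fun t : ℝ => ((t - coeff s.1.1 B : ℝ) : ℂ)) '' Set.Ioo (-ε) ε)
    (fun s => (Set.Ioo_infinite (by linarith)).image fun t _ t' _ h => by
      simpa using h) fun x hx => ?_
  have hx' : ∀ s, ∃ t : ℝ, |t| ≤ ε ∧ x s = ((t - coeff s.1.1 B : ℝ) : ℂ) := by
    intro s
    obtain ⟨t, ht, h⟩ := hx s trivial
    exact ⟨t, abs_le.2 ⟨ht.1.le, ht.2.le⟩, h.symm⟩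
  choose t ht hxt using hx'
  set q : MvPolynomial (Fin (N + 1)) ℝ := ∑ s, monomial s.1.1 (t s) with hq
  have hqhom : q.IsHomogeneous d := IsHomogeneous.sum _ _ _ fun s _ =>
    isHomogeneous_monomial _ (mem_degMonomials.1 s.1.2)
  obtain ⟨y, hy⟩ := exists_critical_point (d - 2) q (fun y hy => by
    refine lt_of_le_of_lt ?_ hεS
    rw [hq, map_sum]
    refine (Finset.abs_sum_le_sum_abs _ _).trans ?_
    rw [← nsmul_eq_mul, ← Finset.card_univ]
    refine Finset.sum_le_card_nsmul _ _ _ fun s _ => ?_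
    rw [eval_monomial, abs_mul, Finsupp.prod_fintype _ _ (fun i => pow_zero _), Finset.abs_prod]
    refine (mul_le_of_le_one_right (abs_nonneg _) (Finset.prod_le_one (fun i _ => abs_nonneg _)
      fun i _ => ?_)).trans (ht s)
    rw [abs_pow]
    refine pow_le_one₀ (abs_nonneg _) ?_
    refine Fin.cases (by simp) (fun j => by simpa using hy j) i)
  rw [← hB] at hy
  set u : Fin (N + 1) → ℝ := Fin.cons 1 y with hu
  -- This makes the form vanish at `u`. The added term only changes the derivative along x₀, which
  -- Euler's formula then forces to be zero.
  let z : ℝ := -eval u (q - B)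
  let pR : MvPolynomial (Fin (N + 1)) ℝ := q - B + C z * X 0 ^ d
  have hpR : pR.IsHomogeneous d := (hqhom.sub hBhom).add (isHomogeneous_C_mul_X_pow _ _ _)
  let p : Form N d := ⟨map Complex.ofRealHom pR, hpR.map _⟩
  have hsing : IsSingularAt p.1 (fun i => (u i : ℂ)) := by
    have h1 : ∀ i : Fin N, eval (fun i => (u i : ℂ)) (pderiv i.succ p.1) = 0 := by
      intro i
      change eval (fun i => (u i : ℂ)) (pderiv i.succ (map Complex.ofRealHom pR)) = 0
      rw [pderiv_map, eval_map_ofReal]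
      simp only [pR, map_add, hy i, pderiv_C_mul]
      simp [pderiv_X_of_ne (Fin.succ_ne_zero i).symm, Derivation.leibniz_pow]
    have h2 : eval (fun i => (u i : ℂ)) p.1 = 0 := by
      change eval (fun i => (u i : ℂ)) (map Complex.ofRealHom pR) = 0
      rw [eval_map_ofReal]
      simp [pR, z, hu]
    have h3 := dirDeriv_self p.2 (fun i => (u i : ℂ))
    rw [dirDeriv, Fin.sum_univ_succ, h2] at h3
    simp only [h1, mul_zero, Finset.sum_const_zero, add_zero] at h3
    intro i
    refine Fin.cases ?_ (fun j => h1 j) i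
    simpa [hu] using h3
  have h4 := hb p ⟨_, by simp [hu], hsing⟩
  rw [eval_rename] at h4
  rw [map_zero, ← h4]
  congr 2
  ext s
  have hs : s.1.1 ≠ Finsupp.single 0 d := fun h => s.2 (Subtype.ext (h.trans hs₀.symm))
  have e1 : coeff s.1.1 q = t s := by
    rw [hq, coeff_sum, Finset.sum_eq_single s]
    · simp
    · intro s' _ hs'
      rw [coeff_monomial, if_neg fun h => hs' (Subtype.ext (Subtype.ext h))]
    · simp
  have e2 : coeff s.1.1 pR = t s - coeff s.1.1 B := by
    simp only [pR, coeff_add, coeff_sub, e1, coeff_C_mul, coeff_X_pow, if_neg hs.symm, mul_zero,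
      add_zero]
  simp only [Function.comp_apply, p, coeff_map, e2, hxt]
  rfl

/-- The discriminant: a polynomial in the coefficients of a form that vanishes exactly on the
singular forms. -/
theorem exists_discriminant (N : ℕ) (hd : 2 ≤ d) : ∃ R ∈ polyFun (Form N d), ∀ p : Form N d,
    R p ≠ 0 ↔ ∀ x, x ≠ 0 → ¬ IsSingularAt p.1 x := by
  have hd0 : d ≠ 0 := by omega
  have := singularIdeal_isPrime (N := N) hd0
  let s₀ : degMonomials (Fin (N + 1)) d := ⟨Finsupp.single 0 d, mem_degMonomials.2 (by simp)⟩
  obtain ⟨R, hR, hdvd⟩ := exists_generator_of_isPrime_mvPolynomial s₀ (singularIdeal N d)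
    (singularIdeal_ne_bot hd0) (singularIdeal_elimination hd s₀ rfl)
  have hmem : (fun p : Form N d => eval (fun s => coeff s.1 p.1) R) ∈ polyFun (Form N d) :=
    eval_coeff_mem (MapIn.id.coeffIn) _ R
  refine ⟨_, hmem, fun p => ⟨fun h x hx hsing => h ?_, fun h => ?_⟩⟩
  · have hchart : ∀ (p : Form N d) (x : Vec N), x 0 ≠ 0 → IsSingularAt p.1 x →
        eval (fun s => coeff s.1 p.1) R = 0 := fun p x hx0 hx =>
      hR p ⟨(x 0)⁻¹ • x, by simp [hx0], hx.smul p.2 _⟩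
    by_cases hx0 : x 0 = 0
    swap
    · exact hchart p x hx0 hsing
    obtain ⟨i, hi⟩ : ∃ i, x i ≠ 0 := by
      by_contra! h
      exact hx (funext h)
    have hi0 : i ≠ 0 := fun h => hi (h ▸ hx0)
    -- A singular point at x₀ = 0 is moved into the chart: `T t` sends `x + t e₀` to `x`, so `p ∘ T
    -- t` is singular at a point with zeroth coordinate `t`. Hence `R` vanishes on it for `t ≠ 0`,
    -- and by polynomiality also for `t = 0`.
    let T : ℂ → Vec N →ₗ[ℂ] Vec N := fun t => LinearMap.id -
      t • ((LinearMap.proj i : Vec N →ₗ[ℂ] ℂ).smulRight ((x i)⁻¹ • (Pi.single 0 1 : Vec N)))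
    have hT : ∀ t (v : Vec N), T t v = v - t • (v i • (x i)⁻¹ • (Pi.single 0 1 : Vec N)) :=
      fun t v => rfl
    have hfam : CoeffIn (polyFun ℂ) fun t => compLin (T t) p.1 := by
      refine CoeffIn.compLin (fun v j => ?_) (CoeffIn.const _) fun _ => p.2
      simp only [hT]
      exact sub_mem (const_mem_subalgebra _ _)
        (mul_mem (linear_mem_polyFun LinearMap.id) (const_mem_subalgebra _ _))
    have hprod := polyFun_mul_eq_zero (linear_mem_polyFun (LinearMap.id : ℂ →ₗ[ℂ] ℂ))
      (eval_coeff_mem hfam (fun s : degMonomials (Fin (N + 1)) d => s.1) R) fun t => ?_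
    · rcases hprod with h | h
      · exact absurd (h 1) one_ne_zero
      · have h1 := h 0
        have : compLin (T 0) p.1 = p.1 := by
          refine MvPolynomial.funext fun v => ?_
          rw [eval_compLin, hT, zero_smul, sub_zero]
        rwa [this] at h1
    · by_cases ht : t = 0
      · simp [ht]
      refine mul_eq_zero_of_right _ (hchart ⟨_, compLin_isHomogeneous (T t) p.2⟩
        (x + t • Pi.single 0 1) (by simpa [hx0] using ht) ?_)
      rw [isSingularAt_iff_dirDeriv]
      intro v
      have hTx : T t (x + t • Pi.single 0 1) = x := by
        rw [hT]
        simp [hi0, smul_smul, hi]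
      rw [dirDeriv_compLin, hTx]
      exact isSingularAt_iff_dirDeriv.1 hsing _
  · obtain ⟨G, hG, hG0⟩ := exists_mem_singularIdeal p h
    obtain ⟨c, rfl⟩ := hdvd G hG
    rw [map_mul] at hG0
    exact left_ne_zero_of_mul hG0

end Discriminant


/-! ### Division by linear forms along a direction -/

section Division

variable {N : ℕ}

/-- The linear map `x ↦ x - l(x) v`. -/
noncomputable def shear (l : Module.Dual ℂ (Vec N)) (v : Vec N) : Vec N →ₗ[ℂ] Vec N :=
  LinearMap.id - l.smulRight v

theorem shear_apply (l : Module.Dual ℂ (Vec N)) (v x : Vec N) : shear l v x = x - l x • v := rfl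

theorem compLin_linForm (T : Vec N →ₗ[ℂ] Vec N) (m : Module.Dual ℂ (Vec N)) :
    compLin T (linForm m) = linForm (m.comp T) :=
  MvPolynomial.funext fun x => by simp

theorem linForm_dvd_sub_compLin (l : Module.Dual ℂ (Vec N)) (v : Vec N)
    (F : MvPolynomial (Fin (N + 1)) ℂ) : linForm l ∣ F - compLin (shear l v) F := by
  induction F using MvPolynomial.induction_on with
  | C a => simp [compLin]
  | add p q hp hq =>
    rw [map_add, show p + q - (compLin (shear l v) p + compLin (shear l v) q) =
      (p - compLin (shear l v) p) + (q - compLin (shear l v) q) by ring]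
    exact dvd_add hp hq
  | mul_X p i hp =>
    have hX : X i - compLin (shear l v) (X i) = linForm l * C (v i) :=
      MvPolynomial.funext fun x => by simp [shear_apply]
    rw [map_mul, show p * X i - compLin (shear l v) p * compLin (shear l v) (X i) =
      (p - compLin (shear l v) p) * X i +
        compLin (shear l v) p * (X i - compLin (shear l v) (X i)) by ring, hX]
    exact dvd_add (hp.mul_right _) (Dvd.intro _ rfl |>.mul_left _)

theorem linForm_dvd_of_vanishes {l : Module.Dual ℂ (Vec N)} (hl : l ≠ 0)
    {F : MvPolynomial (Fin (N + 1)) ℂ} (hF : ∀ x, l x = 0 → eval x F = 0) : linForm l ∣ F := by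
  obtain ⟨w, hw⟩ : ∃ w, l w ≠ 0 := by
    by_contra! h
    exact hl (LinearMap.ext h)
  have h := linForm_dvd_sub_compLin l ((l w)⁻¹ • w) F
  have h0 : compLin (shear l ((l w)⁻¹ • w)) F = 0 := by
    refine MvPolynomial.funext fun x => ?_
    rw [eval_compLin, map_zero]
    exact hF _ (by simp [shear_apply, hw])
  rwa [h0, sub_zero] at h

open Classical in
/-- The quotient of `F - F ∘ shear l v` by `l`. -/
noncomputable def divDir (l : Module.Dual ℂ (Vec N)) (v : Vec N)
    (F : MvPolynomial (Fin (N + 1)) ℂ) : MvPolynomial (Fin (N + 1)) ℂ :=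
  if l = 0 then 0 else Classical.choose (linForm_dvd_sub_compLin l v F)

theorem divDir_spec {l : Module.Dual ℂ (Vec N)} (hl : l ≠ 0) (v : Vec N)
    (F : MvPolynomial (Fin (N + 1)) ℂ) :
    F - compLin (shear l v) F = linForm l * divDir l v F := by
  rw [divDir, if_neg hl]
  exact Classical.choose_spec (linForm_dvd_sub_compLin l v F)

theorem divDir_eq {l : Module.Dual ℂ (Vec N)} (hl : l ≠ 0) {v : Vec N}
    {F Q : MvPolynomial (Fin (N + 1)) ℂ} (h : F - compLin (shear l v) F = linForm l * Q) :
    divDir l v F = Q :=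
  mul_left_cancel₀ (linForm_ne_zero hl) ((divDir_spec hl v F).symm.trans h)

theorem divDir_isHomogeneous (l : Module.Dual ℂ (Vec N)) (v : Vec N)
    {F : MvPolynomial (Fin (N + 1)) ℂ} {n : ℕ} (hF : F.IsHomogeneous n) :
    (divDir l v F).IsHomogeneous (n - 1) := by
  by_cases hl : l = 0
  · rw [divDir, if_pos hl]
    exact isHomogeneous_zero _ _ _
  · exact isHomogeneous_right_of_mul (linForm_isHomogeneous l) (linForm_ne_zero hl)
      (divDir_spec hl v F ▸ hF.sub (compLin_isHomogeneous _ hF))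

theorem divDir_eq_zero (l : Module.Dual ℂ (Vec N)) (v : Vec N)
    {F : MvPolynomial (Fin (N + 1)) ℂ} (hF : F.IsHomogeneous 0) : divDir l v F = 0 := by
  by_cases hl : l = 0
  · rw [divDir, if_pos hl]
  · exact eq_zero_of_mul_isHomogeneous (linForm_isHomogeneous l) (linForm_ne_zero hl)
      (divDir_spec hl v F ▸ hF.sub (compLin_isHomogeneous _ hF)) one_pos

theorem divDir_add (l : Module.Dual ℂ (Vec N)) (v : Vec N) (F G : MvPolynomial (Fin (N + 1)) ℂ) :
    divDir l v (F + G) = divDir l v F + divDir l v G := by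
  by_cases hl : l = 0
  · simp [divDir, hl]
  · refine divDir_eq hl ?_
    rw [mul_add, ← divDir_spec hl, ← divDir_spec hl, map_add]
    ring

theorem divDir_C_mul (l : Module.Dual ℂ (Vec N)) (v : Vec N) (c : ℂ)
    (F : MvPolynomial (Fin (N + 1)) ℂ) : divDir l v (C c * F) = C c * divDir l v F := by
  by_cases hl : l = 0
  · simp [divDir, hl]
  · refine divDir_eq hl ?_
    rw [mul_left_comm, ← divDir_spec hl, map_mul,
      show compLin (shear l v) (C c) = C c by simp [compLin]]
    ring

theorem divDir_linForm_mul {l : Module.Dual ℂ (Vec N)} {v : Vec N} (hv : l v = 1)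
    (G : MvPolynomial (Fin (N + 1)) ℂ) : divDir l v (linForm l * G) = G := by
  refine divDir_eq (fun h => by simp [h] at hv) ?_
  have : l.comp (shear l v) = 0 := LinearMap.ext fun x => by simp [shear_apply, hv]
  rw [map_mul, compLin_linForm, this, map_zero, zero_mul, sub_zero]

/-- The reason for dividing along the vertex: if `v` lies in the hyperplane `m = 0`, the division
commutes with multiplication by `m`, so its result on that hyperplane depends only on the
restriction of the form. -/
theorem divDir_linForm_mul_of_zero (l : Module.Dual ℂ (Vec N)) {v : Vec N}
    {m : Module.Dual ℂ (Vec N)} (hm : m v = 0) (G : MvPolynomial (Fin (N + 1)) ℂ) :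
    divDir l v (linForm m * G) = linForm m * divDir l v G := by
  by_cases hl : l = 0
  · simp [divDir, hl]
  · refine divDir_eq hl ?_
    have : m.comp (shear l v) = m := LinearMap.ext fun x => by simp [shear_apply, hm]
    rw [map_mul, compLin_linForm, this, mul_left_comm, ← divDir_spec hl, mul_sub]

theorem divDir_scale (l : Module.Dual ℂ (Vec N)) (v : Vec N) {c : ℂ} (hc : c ≠ 0)
    (F : MvPolynomial (Fin (N + 1)) ℂ) :
    divDir (c • l) (c⁻¹ • v) F = C c⁻¹ * divDir l v F := by
  by_cases hl : l = 0
  · simp [divDir, hl]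
  · refine divDir_eq (smul_ne_zero hc hl) ?_
    have : shear (c • l) (c⁻¹ • v) = shear l v :=
      LinearMap.ext fun x => by
        simp only [shear_apply, LinearMap.smul_apply, smul_eq_mul, smul_smul]
        rw [mul_right_comm, mul_inv_cancel₀ hc, one_mul]
    rw [this, divDir_spec hl, map_smul, smul_eq_C_mul]
    rw [show C c * linForm l * (C c⁻¹ * divDir l v F) =
      C (c * c⁻¹) * (linForm l * divDir l v F) by rw [C_mul]; ring, mul_inv_cancel₀ hc, C_1, one_mul]

variable {M : Type*} [AddCommGroup M] [Module ℂ M]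

theorem CoeffIn.congr_ratAt {σ : Type*} {D₀ : M} {F F' : M → MvPolynomial σ ℂ}
    (hF : CoeffIn (ratAt D₀) F) {k : M → ℂ} (hk : k ∈ ratAt D₀) (hk0 : k D₀ ≠ 0)
    (h : ∀ D, k D ≠ 0 → F' D = F D) : CoeffIn (ratAt D₀) F' :=
  fun s => ratAt_congr (hF s) hk hk0 fun D hD => by rw [h D hD]

/-- `divDir` is defined by choice. A recursion on `p` gives a quotient with coefficients polynomial
in `l` and `v`; uniqueness of division identifies the two wherever `l ≠ 0`. -/
theorem exists_coeffIn_quotient {O : Subalgebra ℂ (M → ℂ)} {l : M → Module.Dual ℂ (Vec N)}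
    (hl : ∀ x, (fun D => l D x) ∈ O) {v : M → Vec N} (hv : ∀ i, (fun D => v D i) ∈ O)
    (p : MvPolynomial (Fin (N + 1)) ℂ) :
    ∃ Q : M → MvPolynomial (Fin (N + 1)) ℂ, CoeffIn O Q ∧
      ∀ D, p - StarPoints.compLin (shear (l D) (v D)) p = linForm (l D) * Q D := by
  induction p using MvPolynomial.induction_on with
  | C a => exact ⟨fun _ => 0, CoeffIn.const 0, fun D => by simp [StarPoints.compLin]⟩
  | add p q hp hq =>
    obtain ⟨P, hP, hP'⟩ := hp
    obtain ⟨Q, hQ, hQ'⟩ := hq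
    refine ⟨fun D => P D + Q D, hP.add hQ, fun D => ?_⟩
    rw [map_add, mul_add, ← hP', ← hQ']
    ring
  | mul_X p i hp =>
    obtain ⟨P, hP, hP'⟩ := hp
    have hX : ∀ D, X i - StarPoints.compLin (shear (l D) (v D)) (X i) = linForm (l D) * C (v D i) :=
      fun D => MvPolynomial.funext fun x => by simp [shear_apply]
    refine ⟨fun D => P D * X i + (p - linForm (l D) * P D) * C (v D i),
      (hP.mul (CoeffIn.const _)).add (((CoeffIn.const p).sub ((coeffIn_linForm hl).mul hP)).mul
        (CoeffIn.scalar (hv i))), fun D => ?_⟩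
    rw [map_mul]
    linear_combination (X i - linForm (l D) * C (v D i)) * hP' D +
      StarPoints.compLin (shear (l D) (v D)) p * hX D

theorem CoeffIn.divDir {D₀ : M} {l : M → Module.Dual ℂ (Vec N)}
    (hl : ∀ x, (fun D => l D x) ∈ ratAt D₀) (hl0 : l D₀ ≠ 0) {v : M → Vec N}
    (hv : ∀ i, (fun D => v D i) ∈ ratAt D₀) {F : M → MvPolynomial (Fin (N + 1)) ℂ}
    (hF : CoeffIn (ratAt D₀) F) {n : ℕ} (hn : ∀ D, (F D).IsHomogeneous n) :
    CoeffIn (ratAt D₀) fun D => StarPoints.divDir (l D) (v D) (F D) := by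
  choose Q hQ hQ' using fun s : Fin (N + 1) →₀ ℕ => exists_coeffIn_quotient hl hv (monomial s 1)
  obtain ⟨w, hw⟩ : ∃ w, l D₀ w ≠ 0 := by
    by_contra! h
    exact hl0 (LinearMap.ext h)
  have hsum : CoeffIn (ratAt D₀) fun D => ∑ s ∈ degMonomials (Fin (N + 1)) n,
      C (coeff s (F D)) * Q s D :=
    CoeffIn.sum _ fun s _ => (CoeffIn.scalar (hF s)).mul (hQ s)
  refine hsum.congr_ratAt (hl w) hw fun D hD => divDir_eq (fun h => by simp [h] at hD) ?_
  have hexp : F D = ∑ s ∈ degMonomials (Fin (N + 1)) n, C (coeff s (F D)) * monomial s 1 := by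
    conv_lhs => rw [sum_degMonomials (hn D)]
    simp [C_mul_monomial]
  rw [Finset.mul_sum]
  conv_lhs => rw [hexp]
  rw [map_sum, ← Finset.sum_sub_distrib]
  refine Finset.sum_congr rfl fun s _ => ?_
  rw [map_mul, mul_left_comm, ← hQ', show StarPoints.compLin (shear (l D) (v D))
    (C (coeff s (F D))) = C (coeff s (F D)) by simp [StarPoints.compLin]]
  ring

/-- The product of the first `k` linear forms. -/
noncomputable def prodForms (l : ℕ → Module.Dual ℂ (Vec N)) (k : ℕ) :
    MvPolynomial (Fin (N + 1)) ℂ :=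
  ∏ j ∈ Finset.range k, linForm (l j)

theorem prodForms_succ (l : ℕ → Module.Dual ℂ (Vec N)) (k : ℕ) :
    prodForms l (k + 1) = prodForms l k * linForm (l k) :=
  Finset.prod_range_succ _ _

theorem prodForms_isHomogeneous (l : ℕ → Module.Dual ℂ (Vec N)) (k : ℕ) :
    (prodForms l k).IsHomogeneous k := by
  simpa [prodForms] using IsHomogeneous.prod (Finset.range k) _ (fun _ => 1)
    fun j _ => linForm_isHomogeneous (l j)

theorem eval_prodForms (l : ℕ → Module.Dual ℂ (Vec N)) (k : ℕ) (x : Vec N) :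
    eval x (prodForms l k) = ∏ j ∈ Finset.range k, l j x := by
  simp [prodForms, map_prod]

theorem linForm_dvd_prodForms (l : ℕ → Module.Dual ℂ (Vec N)) {j k : ℕ} (h : j < k) :
    linForm (l j) ∣ prodForms l k :=
  Finset.dvd_prod_of_mem _ (Finset.mem_range.2 h)

/-- Successive division by the first `k` linear forms along the direction `P`. -/
noncomputable def divSeq (l : ℕ → Module.Dual ℂ (Vec N)) (P : Vec N) :
    ℕ → MvPolynomial (Fin (N + 1)) ℂ → MvPolynomial (Fin (N + 1)) ℂ
  | 0, F => F
  | k + 1, F => divDir (l k) ((l k P)⁻¹ • P) (divSeq l P k F)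

section

variable (l : ℕ → Module.Dual ℂ (Vec N)) (P : Vec N) (k : ℕ)

theorem divSeq_add (F G : MvPolynomial (Fin (N + 1)) ℂ) :
    divSeq l P k (F + G) = divSeq l P k F + divSeq l P k G := by
  induction k with
  | zero => rfl
  | succ k ih => rw [divSeq, ih, divDir_add]; rfl

theorem divSeq_C_mul (c : ℂ) (F : MvPolynomial (Fin (N + 1)) ℂ) :
    divSeq l P k (C c * F) = C c * divSeq l P k F := by
  induction k with
  | zero => rfl
  | succ k ih => rw [divSeq, ih, divDir_C_mul]; rfl

theorem divSeq_linForm_mul {m : Module.Dual ℂ (Vec N)} (hm : m P = 0)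
    (G : MvPolynomial (Fin (N + 1)) ℂ) :
    divSeq l P k (linForm m * G) = linForm m * divSeq l P k G := by
  induction k with
  | zero => rfl
  | succ k ih => rw [divSeq, ih, divDir_linForm_mul_of_zero _ (by simp [hm])]; rfl

theorem divSeq_isHomogeneous {F : MvPolynomial (Fin (N + 1)) ℂ} {n : ℕ} (hF : F.IsHomogeneous n) :
    (divSeq l P k F).IsHomogeneous (n - k) := by
  induction k with
  | zero => exact hF
  | succ k ih =>
    rw [← Nat.sub_sub]
    exact divDir_isHomogeneous _ _ ih

/-- Removes the Newton terms beyond the degree, in accordance with the vanishing of the fixed part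
for these indices. -/
theorem divSeq_eq_zero {F : MvPolynomial (Fin (N + 1)) ℂ} {n : ℕ} (hF : F.IsHomogeneous n)
    (hk : n < k) : divSeq l P k F = 0 := by
  obtain ⟨k, rfl⟩ : ∃ k', k = k' + 1 := ⟨k - 1, by omega⟩
  refine divDir_eq_zero _ _ ?_
  have := divSeq_isHomogeneous l P k hF
  rwa [Nat.sub_eq_zero_of_le (by omega)] at this

end

theorem divSeq_prodForms_mul {l : ℕ → Module.Dual ℂ (Vec N)} {P : Vec N} {k : ℕ}
    (hl : ∀ j < k, l j P ≠ 0) (G : MvPolynomial (Fin (N + 1)) ℂ) :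
    divSeq l P k (prodForms l k * G) = G := by
  induction k generalizing G with
  | zero => simp [divSeq, prodForms]
  | succ k ih =>
    rw [divSeq, prodForms_succ, mul_assoc, ih fun j hj => hl j (by omega),
      divDir_linForm_mul (by simp [hl k (by omega)])]

theorem divSeq_scale {l : ℕ → Module.Dual ℂ (Vec N)} {P : Vec N} {k : ℕ}
    {c : ℕ → ℂ} (hc : ∀ j < k, c j ≠ 0) {t : ℂ} (ht : t ≠ 0) (F : MvPolynomial (Fin (N + 1)) ℂ) :
    divSeq (fun j => c j • l j) (t • P) k F =
      C (∏ j ∈ Finset.range k, (c j)⁻¹) * divSeq l P k F := by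
  induction k with
  | zero => simp [divSeq]
  | succ k ih =>
    rw [divSeq, ih fun j hj => hc j (by omega), divDir_C_mul, Finset.prod_range_succ, C_mul,
      mul_assoc]
    congr 1
    have hck := hc k (by omega)
    have : ((c k • l k) (t • P))⁻¹ • t • P = (c k)⁻¹ • (l k P)⁻¹ • P := by
      simp only [LinearMap.smul_apply, map_smul, smul_eq_mul, smul_smul, mul_inv]
      congr 1
      field_simp
    rw [this, divDir_scale _ _ hck]
    rfl

theorem CoeffIn.divSeq {D₀ : M} {l : ℕ → M → Module.Dual ℂ (Vec N)} {k : ℕ}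
    (hl : ∀ j < k, ∀ x, (fun D => l j D x) ∈ ratAt D₀) {P : M → Vec N}
    (hP : ∀ i, (fun D => P D i) ∈ ratAt D₀)
    (hlP : ∀ j < k, (fun D => l j D (P D)) ∈ ratAt D₀) (hl0 : ∀ j < k, l j D₀ (P D₀) ≠ 0)
    {F : M → MvPolynomial (Fin (N + 1)) ℂ}
    (hF : CoeffIn (ratAt D₀) F) {n : ℕ} (hn : ∀ D, (F D).IsHomogeneous n) :
    CoeffIn (ratAt D₀) fun D => StarPoints.divSeq (fun j => l j D) (P D) k (F D) := by
  induction k with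
  | zero => exact hF
  | succ k ih =>
    have h := hl0 k (by omega)
    refine CoeffIn.divDir (n := n - k) (hl k (by omega)) (fun h' => by simp [h'] at h)
      (fun i => ?_) (ih (fun j hj => hl j (by omega)) (fun j hj => hlP j (by omega))
        fun j hj => hl0 j (by omega)) fun D => divSeq_isHomogeneous _ _ _ (hn D)
    exact mul_mem (inv_mem_ratAt (hlP k (by omega)) h) (hP i)

theorem coeffIn_prodForms {O : Subalgebra ℂ (M → ℂ)} {l : ℕ → M → Module.Dual ℂ (Vec N)} {k : ℕ}
    (hl : ∀ j < k, ∀ x, (fun D => l j D x) ∈ O) :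
    CoeffIn O fun D => prodForms (fun j => l j D) k :=
  CoeffIn.prod _ fun j hj => coeffIn_linForm (hl j (Finset.mem_range.1 hj))

/-! ### Newton interpolation -/

/-- Newton interpolation of the forms `c k` on the hyperplanes `l k = 0`, where the division on the
hyperplane `l k = 0` is along the direction `P k`. -/
noncomputable def newton (l : ℕ → Module.Dual ℂ (Vec N)) (P : ℕ → Vec N)
    (c : ℕ → MvPolynomial (Fin (N + 1)) ℂ) : ℕ → MvPolynomial (Fin (N + 1)) ℂ
  | 0 => c 0
  | k + 1 => newton l P c k +
      prodForms l (k + 1) * divSeq l (P (k + 1)) (k + 1) (c (k + 1) - newton l P c k)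

variable {l : ℕ → Module.Dual ℂ (Vec N)} {P : ℕ → Vec N} {c : ℕ → MvPolynomial (Fin (N + 1)) ℂ}

theorem newton_isHomogeneous {d : ℕ} (hc : ∀ k, (c k).IsHomogeneous d) (k : ℕ) :
    (newton l P c k).IsHomogeneous d := by
  induction k with
  | zero => exact hc 0
  | succ k ih =>
    refine ih.add ?_
    have h := (hc (k + 1)).sub ih
    by_cases hk : k + 1 ≤ d
    · have := (prodForms_isHomogeneous l (k + 1)).mul
        (divSeq_isHomogeneous l (P (k + 1)) (k + 1) h)
      rwa [Nat.add_sub_cancel' hk] at this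
    · rw [divSeq_eq_zero _ _ _ h (by omega), mul_zero]
      exact isHomogeneous_zero _ _ _

theorem linForm_dvd_newton_sub (k : ℕ) : linForm (l 0) ∣ newton l P c k - c 0 := by
  induction k with
  | zero => simp [newton]
  | succ k ih =>
    rw [newton, add_sub_right_comm]
    exact dvd_add ih ((linForm_dvd_prodForms l (Nat.succ_pos k)).mul_right _)

/-- Interpolation is exact for a form that restricts to the given forms on the hyperplanes. -/
theorem prodForms_dvd_sub_newton {e : ℕ} (hlP : ∀ j < e, ∀ k < e, j ≠ k → l j (P k) ≠ 0)
    (hPP : ∀ k < e, l k (P k) = 0) {F : MvPolynomial (Fin (N + 1)) ℂ}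
    (hF : ∀ k < e, linForm (l k) ∣ F - c k) {k : ℕ} (hk : k < e) :
    prodForms l (k + 1) ∣ F - newton l P c k := by
  induction k with
  | zero => simpa [prodForms, newton] using hF 0 hk
  | succ k ih =>
    obtain ⟨G, hG⟩ := ih (by omega)
    obtain ⟨H, hH⟩ := hF (k + 1) hk
    -- With M the product of the first `k + 1` equations, the remainder is M G minus a multiple of
    -- l_{k+1}. Dividing it by M along P_{k+1} returns G modulo l_{k+1}, so the Newton step raises
    -- the order of agreement by one hyperplane.
    have h1 : c (k + 1) - newton l P c k =
        prodForms l (k + 1) * G + C (-1) * (linForm (l (k + 1)) * H) := by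
      rw [← hG, ← hH, C_neg, C_1]
      ring
    refine ⟨divSeq l (P (k + 1)) (k + 1) H, ?_⟩
    rw [newton, h1, divSeq_add, divSeq_C_mul, divSeq_linForm_mul _ _ _ (hPP _ hk),
      divSeq_prodForms_mul fun j hj => hlP j (by omega) _ hk (by omega), prodForms_succ _ (k + 1),
      C_neg, C_1]
    linear_combination hG

/-- The interpolation depends only on the restrictions to the hyperplanes, up to scaling and up to
multiples of the product of the equations of the hyperplanes. -/
theorem prodForms_dvd_newton_sub {e : ℕ} (hlP : ∀ j < e, ∀ k < e, j ≠ k → l j (P k) ≠ 0)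
    (hPP : ∀ k < e, l k (P k) = 0) {s t : ℕ → ℂ} (hs : ∀ k < e, s k ≠ 0) (ht : ∀ k < e, t k ≠ 0)
    {u : ℂ} {c' : ℕ → MvPolynomial (Fin (N + 1)) ℂ}
    (hc : ∀ k < e, linForm (l k) ∣ c' k - C u * c k) {k : ℕ} (hk : k < e) :
    prodForms l (k + 1) ∣
      newton (fun j => s j • l j) (fun j => t j • P j) c' k - C u * newton l P c k := by
  induction k with
  | zero => simpa [prodForms, newton] using hc 0 hk
  | succ k ih =>
    obtain ⟨G, hG⟩ := ih (by omega)
    obtain ⟨H, hH⟩ := hc (k + 1) hk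
    have h1 : c' (k + 1) - newton (fun j => s j • l j) (fun j => t j • P j) c' k =
        C u * (c (k + 1) - newton l P c k) + (linForm (l (k + 1)) * H +
          C (-1) * (prodForms l (k + 1) * G)) := by
      rw [← hG, ← hH, C_neg, C_1]
      ring
    have hprod : prodForms (fun j => s j • l j) (k + 1) =
        C (∏ j ∈ Finset.range (k + 1), s j) * prodForms l (k + 1) := by
      simp only [prodForms, map_smul, smul_eq_C_mul, Finset.prod_mul_distrib, map_prod]
    -- Rescaling the equations multiplies M by this product and the successive quotient by its
    -- inverse, so a Newton term does not change.
    have hcancel : C (∏ j ∈ Finset.range (k + 1), s j) *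
        C (∏ j ∈ Finset.range (k + 1), (s j)⁻¹) = (1 : MvPolynomial (Fin (N + 1)) ℂ) := by
      rw [← C_mul, ← Finset.prod_mul_distrib, Finset.prod_eq_one, C_1]
      intro j hj
      exact mul_inv_cancel₀ (hs j (by have := Finset.mem_range.1 hj; omega))
    refine ⟨divSeq l (P (k + 1)) (k + 1) H, ?_⟩
    rw [newton, newton, divSeq_scale (fun j hj => hs j (by omega)) (ht _ hk), hprod, h1,
      divSeq_add, divSeq_add, divSeq_C_mul, divSeq_C_mul, divSeq_linForm_mul _ _ _ (hPP _ hk),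
      divSeq_prodForms_mul fun j hj => hlP j (by omega) _ hk (by omega), prodForms_succ _ (k + 1),
      C_neg, C_1]
    linear_combination hG + (prodForms l (k + 1) * (C u * divSeq l (P (k + 1)) (k + 1)
      (c (k + 1) - newton l P c k) + linForm (l (k + 1)) * divSeq l (P (k + 1)) (k + 1) H - G)) *
        hcancel

/-- If the forms `c k` are compatible, then the interpolating form restricts to each of them. -/
theorem linForm_dvd_newton_sub_of_compatible {e : ℕ}
    (hlP : ∀ j < e, ∀ k < e, j ≠ k → l j (P k) ≠ 0) (hPP : ∀ k < e, l k (P k) = 0)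
    (hc : ∀ k, k + 1 < e → ∃ G, linForm (l (k + 1)) ∣
      c (k + 1) - newton l P c k - prodForms l (k + 1) * G)
    {k : ℕ} (hk : k < e) {j : ℕ} (hj : j ≤ k) : linForm (l j) ∣ newton l P c k - c j := by
  induction k with
  | zero =>
    obtain rfl : j = 0 := by omega
    simp [newton]
  | succ k ih =>
    rcases hj.eq_or_lt with rfl | hj
    · obtain ⟨G, H, hH⟩ := hc k hk
      have h1 : c (k + 1) - newton l P c k = prodForms l (k + 1) * G + linForm (l (k + 1)) * H := by
        rw [← hH]; ring
      refine ⟨prodForms l (k + 1) * divSeq l (P (k + 1)) (k + 1) H - H, ?_⟩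
      rw [newton, h1, divSeq_add, divSeq_linForm_mul _ _ _ (hPP _ hk),
        divSeq_prodForms_mul fun j hj => hlP j (by omega) _ hk (by omega)]
      linear_combination -h1
    · rw [newton, add_sub_right_comm]
      exact dvd_add (ih (by omega) (by omega)) ((linForm_dvd_prodForms l hj).mul_right _)

theorem coeffIn_newton {D₀ : M} {l : ℕ → M → Module.Dual ℂ (Vec N)} {e : ℕ}
    (hl : ∀ j x, (fun D => l j D x) ∈ ratAt D₀) {P : ℕ → M → Vec N}
    (hP : ∀ k i, (fun D => P k D i) ∈ ratAt D₀)
    (hlP : ∀ j k, (fun D => l j D (P k D)) ∈ ratAt D₀)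
    (hl0 : ∀ j < e, ∀ k < e, j ≠ k → l j D₀ (P k D₀) ≠ 0)
    {c : ℕ → M → MvPolynomial (Fin (N + 1)) ℂ} {d : ℕ}
    (hc : ∀ k < e, CoeffIn (ratAt D₀) (c k)) (hd : ∀ k D, (c k D).IsHomogeneous d)
    {k : ℕ} (hk : k < e) :
    CoeffIn (ratAt D₀) fun D => newton (fun j => l j D) (fun j => P j D) (fun j => c j D) k := by
  induction k with
  | zero => exact hc 0 hk
  | succ k ih =>
    refine (ih (by omega)).add ((coeffIn_prodForms fun j _ => hl j).mul ?_)
    exact CoeffIn.divSeq (n := d) (fun j _ => hl j) (hP (k + 1)) (fun j _ => hlP j (k + 1))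
      (fun j hj => hl0 j (by omega) _ hk (by omega)) ((hc _ hk).sub (ih (by omega)))
      fun D => (hd _ D).sub (newton_isHomogeneous (fun k => hd k D) k)

end Division


/-! ### Cones -/

section Cones

variable {N : ℕ}

/-- A multiple of the projection to `ker l ⊓ ker m` along `P` and `w`. -/
noncomputable def conePr (l : Module.Dual ℂ (Vec N)) (P : Vec N) (m : Module.Dual ℂ (Vec N))
    (w : Vec N) : Vec N →ₗ[ℂ] Vec N :=
  (m P * l w) • LinearMap.id - m P • l.smulRight w - l w • m.smulRight P

/-- The factor `m P * l w` clears the denominators of the projection, so the map is polynomial in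
all four arguments. -/
theorem conePr_apply (l : Module.Dual ℂ (Vec N)) (P : Vec N) (m : Module.Dual ℂ (Vec N))
    (w x : Vec N) :
    conePr l P m w x = (m P * l w) • x - m P • l x • w - l w • m x • P := rfl

/-- The restriction of `f` to the hyperplane `l = 0` is invariant under translation by `P`. -/
def ConeInv (l : Module.Dual ℂ (Vec N)) (P : Vec N) (f : MvPolynomial (Fin (N + 1)) ℂ) : Prop :=
  ∀ x, l x = 0 → ∀ t : ℂ, eval (x + t • P) f = eval x f

/-- The hypersurface `f = 0` of the hyperplane `l = 0` is smooth outside `P`. -/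
def ConeSmooth (l : Module.Dual ℂ (Vec N)) (P : Vec N) (f : MvPolynomial (Fin (N + 1)) ℂ) : Prop :=
  ∀ x, l x = 0 → x ∉ Submodule.span ℂ {P} → eval x f = 0 → ∃ v, l v = 0 ∧ dirDeriv f x v ≠ 0

theorem dirDeriv_smul_left {σ : Type*} [Fintype σ] {f : MvPolynomial σ ℂ} {d : ℕ}
    (hf : f.IsHomogeneous d) (c : ℂ) (x v : σ → ℂ) :
    dirDeriv f (c • x) v = c ^ (d - 1) * dirDeriv f x v := by
  simp only [dirDeriv, eval_smul_of_isHomogeneous hf.pderiv, Finset.mul_sum]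
  exact Finset.sum_congr rfl fun i _ => by ring

section

variable {l m : Module.Dual ℂ (Vec N)} {P w : Vec N} {f : MvPolynomial (Fin (N + 1)) ℂ} {d : ℕ}

theorem ConeInv.dirDeriv_eq (hf : ConeInv l P f) {x v : Vec N} (hx : l x = 0)
    (hv : l v = 0) (t : ℂ) : dirDeriv f (x + t • P) v = dirDeriv f x v := by
  have h1 := hasDerivAt_eval f (x + t • P) v
  have h2 : (fun s : ℂ => eval (x + t • P + s • v) f) = fun s : ℂ => eval (x + s • v) f := by
    ext s
    rw [add_right_comm, hf _ (by simp [hx, hv])]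
  rw [h2] at h1
  exact h1.unique (hasDerivAt_eval f x v)

theorem ConeInv.dirDeriv_vertex (hf : ConeInv l P f) {x : Vec N} (hx : l x = 0) :
    dirDeriv f x P = 0 := by
  have h1 := hasDerivAt_eval f x P
  simp only [hf x hx] at h1
  exact h1.unique (hasDerivAt_const _ _)

/-- The sum of multiples of `f ∘ conePr l P m w`, `l ^ d` and `m ^ d`. -/
noncomputable def coneSum (l : Module.Dual ℂ (Vec N)) (P : Vec N) (m : Module.Dual ℂ (Vec N))
    (w : Vec N) (f : MvPolynomial (Fin (N + 1)) ℂ) (d : ℕ) (a b c : ℂ) :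
    MvPolynomial (Fin (N + 1)) ℂ :=
  C a * compLin (conePr l P m w) f + C b * linForm l ^ d + C c * linForm m ^ d

theorem coneSum_isHomogeneous (hf : f.IsHomogeneous d) (a b c : ℂ) :
    (coneSum l P m w f d a b c).IsHomogeneous d := by
  refine (((compLin_isHomogeneous _ hf).C_mul a).add (IsHomogeneous.C_mul ?_ b)).add
    (IsHomogeneous.C_mul ?_ c)
  · simpa using (linForm_isHomogeneous l).pow d
  · simpa using (linForm_isHomogeneous m).pow d

theorem dirDeriv_coneSum (a b c : ℂ) (x v : Vec N) : dirDeriv (coneSum l P m w f d a b c) x v =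
    a * dirDeriv f (conePr l P m w x) (conePr l P m w v) + b * (d * l x ^ (d - 1) * l v) +
      c * (d * m x ^ (d - 1) * m v) := by
  simp only [coneSum, dirDeriv_add, dirDeriv_C_mul, dirDeriv_compLin, dirDeriv_linForm_pow]

/-- The space splits into the lines through `w` and `P` and the subspace l = m = 0. Differentiating
along `w` and `P` only sees the pure powers and forces l x = m x = 0; what remains is the
singularity of `f` on the subspace. The nonzero weights play no role. -/
theorem isSingularAt_coneSum_iff (hd : 2 ≤ d) (hf : f.IsHomogeneous d) (hlP : l P = 0)
    (hmw : m w = 0) (hlw : l w ≠ 0) (hmP : m P ≠ 0) {a b c : ℂ} (ha : a ≠ 0) (hb : b ≠ 0)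
    (hc : c ≠ 0) {x : Vec N} : IsSingularAt (coneSum l P m w f d a b c) x ↔
      l x = 0 ∧ m x = 0 ∧ ∀ v, l v = 0 → m v = 0 → dirDeriv f x v = 0 := by
  have hd0 : (d : ℂ) ≠ 0 := by exact_mod_cast (by omega : d ≠ 0)
  have hd1 : d - 1 ≠ 0 := by omega
  have hκ : m P * l w ≠ 0 := mul_ne_zero hmP hlw
  rw [isSingularAt_iff_dirDeriv]
  simp only [dirDeriv_coneSum]
  have hpr : ∀ y, l y = 0 → m y = 0 → conePr l P m w y = (m P * l w) • y := by
    intro y h1 h2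
    simp [conePr_apply, h1, h2]
  have hzero : ∀ v, dirDeriv f v 0 = 0 := fun v => by simp [dirDeriv]
  constructor
  · intro h
    have h1 : l x = 0 := by
      have hw := h w
      have : conePr l P m w w = 0 := by
        simp [conePr_apply, hmw, smul_smul]
      rw [this, hzero, hmw] at hw
      simpa [hb, hd0, hlw, hd1] using hw
    have h2 : m x = 0 := by
      have hP := h P
      have : conePr l P m w P = 0 := by
        simp [conePr_apply, hlP, smul_smul, mul_comm]
      rw [this, hzero, hlP] at hP
      simpa [hc, hd0, hmP, hd1] using hP
    refine ⟨h1, h2, fun v hv1 hv2 => ?_⟩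
    have hv := h v
    rw [hpr x h1 h2, hpr v hv1 hv2, dirDeriv_smul_left hf, dirDeriv_smul_right, hv1, hv2] at hv
    simpa [ha, hmP, hlw] using hv
  · rintro ⟨h1, h2, h3⟩ v
    rw [hpr x h1 h2, dirDeriv_smul_left hf, h3, h1, h2]
    · simp [hd1]
    · simp only [conePr_apply, map_sub, map_smul, smul_eq_mul, hlP]; ring
    · simp only [conePr_apply, map_sub, map_smul, smul_eq_mul, hmw]; ring

/-- The sum `f ∘ conePr + l ^ d + m ^ d` is smooth if and only if `f` defines in the hyperplane
`l = 0` a cone which is smooth outside its vertex `P`. -/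
theorem coneSum_smooth_iff (hd : 2 ≤ d) (hf : f.IsHomogeneous d) (hlP : l P = 0)
    (hmw : m w = 0) (hlw : l w ≠ 0) (hmP : m P ≠ 0) (hinv : ConeInv l P f) {a b c : ℂ} (ha : a ≠ 0)
    (hb : b ≠ 0) (hc : c ≠ 0) :
    (∀ x, x ≠ 0 → ¬ IsSingularAt (coneSum l P m w f d a b c) x) ↔ ConeSmooth l P f := by
  simp only [isSingularAt_coneSum_iff hd hf hlP hmw hlw hmP ha hb hc]
  -- A multiple of `P` moves any vector of the hyperplane into m = 0, and the cone property makes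
  -- such translations invisible to `f`.
  have hsplit : ∀ v : Vec N, l v = 0 → l (v + (-(m v / m P)) • P) = 0 ∧
      m (v + (-(m v / m P)) • P) = 0 := by
    intro v hv
    refine ⟨by simp [hv, hlP], ?_⟩
    simp [hmP]
  constructor
  · intro h x hx hxP _
    by_contra! hv
    obtain ⟨h1, h2⟩ := hsplit x hx
    refine h _ (fun h0 => hxP ?_) ⟨h1, h2, fun v hv1 _ => ?_⟩
    · rw [Submodule.mem_span_singleton]
      refine ⟨m x / m P, ?_⟩
      rw [neg_smul, add_neg_eq_zero] at h0
      exact h0.symm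
    · rw [hinv.dirDeriv_eq hx hv1]
      exact hv v hv1
  · rintro h x hx0 ⟨h1, h2, h3⟩
    have hall : ∀ v, l v = 0 → dirDeriv f x v = 0 := by
      intro v hv
      obtain ⟨hv1, hv2⟩ := hsplit v hv
      have := h3 _ hv1 hv2
      rwa [dirDeriv_add_right, dirDeriv_smul_right, hinv.dirDeriv_vertex h1, mul_zero,
        add_zero] at this
    have hval : eval x f = 0 := by
      have := dirDeriv_self hf x
      rw [hall x h1] at this
      have hd0 : (d : ℂ) ≠ 0 := by exact_mod_cast (by omega : d ≠ 0)
      simpa [hd0] using this.symm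
    have hxP : x ∉ Submodule.span ℂ {P} := fun hxP => by
      obtain ⟨t, rfl⟩ := Submodule.mem_span_singleton.1 hxP
      have : t = 0 := by simpa [hmP] using h2
      exact hx0 (by simp [this])
    obtain ⟨v, hv, hne⟩ := h x h1 hxP hval
    exact hne (hall v hv)

end

end Cones

/-! ### Polynomial functions without zeros on a torus -/

section Torus

theorem exists_polynomial_of_polyFun {G : ℂ × ℂ → ℂ} (hG : G ∈ polyFun (ℂ × ℂ)) :
    ∃ g : Polynomial (Polynomial ℂ), ∀ z : ℂ × ℂ,
      G z = (g.map (Polynomial.evalRingHom z.1)).eval z.2 := by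
  induction hG using Algebra.adjoin_induction with
  | mem x hx =>
    obtain ⟨l, rfl⟩ := hx
    refine ⟨Polynomial.C (Polynomial.C (l (1, 0)) * Polynomial.X) +
      Polynomial.C (Polynomial.C (l (0, 1))) * Polynomial.X, fun z => ?_⟩
    have h : l z = z.1 * l (1, 0) + z.2 * l (0, 1) := by
      rw [← smul_eq_mul, ← smul_eq_mul, ← map_smul, ← map_smul, ← map_add]
      simp
    change l z = _
    rw [h]
    simp only [Polynomial.map_mul, Polynomial.map_C, Polynomial.map_add, Polynomial.map_X,
      Polynomial.eval_mul, Polynomial.eval_C, Polynomial.eval_add, Polynomial.eval_X, map_mul,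
      Polynomial.coe_evalRingHom]
    ring
  | algebraMap r => exact ⟨Polynomial.C (Polynomial.C r), fun z => by simp⟩
  | add x y _ _ hx hy =>
    obtain ⟨p, hp⟩ := hx
    obtain ⟨q, hq⟩ := hy
    exact ⟨p + q, fun z => by simp [hp, hq]⟩
  | mul x y _ _ hx hy =>
    obtain ⟨p, hp⟩ := hx
    obtain ⟨q, hq⟩ := hy
    exact ⟨p * q, fun z => by simp [hp, hq]⟩

theorem eq_C_mul_X_pow_of_no_roots {p : Polynomial ℂ} (hp : ∀ s, s ≠ 0 → p.eval s ≠ 0) :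
    p = Polynomial.C p.leadingCoeff * Polynomial.X ^ p.natDegree := by
  have hp0 : p ≠ 0 := fun h => hp 1 one_ne_zero (by simp [h])
  have hs := IsAlgClosed.splits p
  have hr : p.roots = Multiset.replicate p.natDegree 0 := by
    rw [Multiset.eq_replicate]
    refine ⟨hs.natDegree_eq_card_roots.symm, fun b hb => ?_⟩
    by_contra hb0
    exact hp b hb0 (Polynomial.isRoot_of_mem_roots hb)
  conv_lhs => rw [hs.eq_prod_roots, hr]
  simp

/-- As a polynomial in s, `G (ε, ·)` has no root other than 0 for generic ε and is therefore a
monomial. Products of two different coefficients then vanish for generic ε, hence identically, so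
only one power of s occurs and it does not depend on ε. -/
theorem eq_pow_mul_of_no_zeros {G : ℂ × ℂ → ℂ} (hG : G ∈ polyFun (ℂ × ℂ)) (h0 : G (0, 1) ≠ 0)
    (H : ∀ ε, G (ε, 1) ≠ 0 → ∀ s, s ≠ 0 → G (ε, s) ≠ 0) :
    ∃ α : ℕ, ∀ ε s, G (ε, s) = s ^ α * G (ε, 1) := by
  obtain ⟨g, hg⟩ := exists_polynomial_of_polyFun hG
  have hev : ∀ ε, (g.eval 1).eval ε = G (ε, 1) := by
    intro ε
    rw [hg, Polynomial.eval_map, ← Polynomial.coe_evalRingHom ε, Polynomial.eval,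
      Polynomial.hom_eval₂]
    simp
  have hprod : ∀ i j, i ≠ j → g.coeff i * g.coeff j = 0 := by
    intro i j hij
    have key : g.coeff i * g.coeff j * g.eval 1 = 0 := by
      refine Polynomial.funext fun ε => ?_
      rw [Polynomial.eval_mul, Polynomial.eval_mul, Polynomial.eval_zero, hev]
      by_cases hε : G (ε, 1) = 0
      · rw [hε, mul_zero]
      obtain ⟨a, n, hmon⟩ : ∃ a n, g.map (Polynomial.evalRingHom ε) =
          Polynomial.C a * Polynomial.X ^ n :=
        ⟨_, _, eq_C_mul_X_pow_of_no_roots fun s hs => by rw [← hg (ε, s)]; exact H ε hε s hs⟩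
      have hc : ∀ k, (g.coeff k).eval ε = if k = n then a else 0 := fun k => by
        rw [← Polynomial.coeff_C_mul_X_pow, ← hmon]; simp
      rw [hc i, hc j]
      by_cases hi : i = n
      · rw [if_neg (fun hj : j = n => hij (hi.trans hj.symm)), mul_zero, zero_mul]
      · rw [if_neg hi, zero_mul, zero_mul]
    refine (mul_eq_zero.1 key).resolve_right fun h => h0 ?_
    rw [← hev, h, Polynomial.eval_zero]
  have hg0 : g ≠ 0 := fun h => h0 (by simp [hg, h])
  obtain ⟨α, hα⟩ : ∃ α, g.coeff α ≠ 0 := by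
    by_contra! h
    exact hg0 (Polynomial.ext h)
  obtain ⟨b, hb⟩ : ∃ b, g = Polynomial.C b * Polynomial.X ^ α := by
    refine ⟨g.coeff α, ?_⟩
    ext1 k
    rw [Polynomial.coeff_C_mul_X_pow]
    split_ifs with hk
    · rw [hk]
    · exact (mul_eq_zero.1 (hprod k α hk)).resolve_right hα
  refine ⟨α, fun ε s => ?_⟩
  rw [hg, hg, hb]
  simp only [Polynomial.map_mul, Polynomial.map_C, Polynomial.map_pow, Polynomial.map_X,
    Polynomial.eval_mul, Polynomial.eval_C, Polynomial.eval_pow, Polynomial.eval_X, one_pow,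
    mul_one]
  exact mul_comm _ _

theorem exists_deriv_polyFun {M : Type*} [AddCommGroup M] [Module ℂ M] {R : M → ℂ}
    (hR : R ∈ polyFun M) : ∃ R' ∈ polyFun (M × M), ∀ z : M × M,
      HasDerivAt (fun ε : ℂ => R (z.1 + ε • z.2)) (R' z) 0 := by
  induction hR using Algebra.adjoin_induction with
  | mem x hx =>
    obtain ⟨l, rfl⟩ := hx
    refine ⟨_, linear_mem_polyFun (l.comp (LinearMap.snd ℂ M M)), fun z => ?_⟩
    simpa using ((hasDerivAt_id (0 : ℂ)).mul_const (l z.2)).const_add (l z.1)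
  | algebraMap r => exact ⟨0, zero_mem _, fun z => hasDerivAt_const _ _⟩
  | add x y _ _ hx hy =>
    obtain ⟨p, hp, hp'⟩ := hx
    obtain ⟨q, hq, hq'⟩ := hy
    exact ⟨p + q, add_mem hp hq, fun z => (hp' z).add (hq' z)⟩
  | mul x y hx' hy' hx hy =>
    obtain ⟨p, hp, hp'⟩ := hx
    obtain ⟨q, hq, hq'⟩ := hy
    have hfst : MapIn (polyFun (M × M)) fun z => z.1 := MapIn.linearMap (LinearMap.fst ℂ M M)
    refine ⟨_, add_mem (mul_mem hp (polyFun_comp hfst hy')) (mul_mem (polyFun_comp hfst hx') hq),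
      fun z => ?_⟩
    have := (hp' z).mul (hq' z)
    simp only [zero_smul, add_zero] at this
    exact this

end Torus


/-! ### Comparing equations of cones by means of the discriminant -/

section Ratio

variable {N d : ℕ}

/-- The discriminant of forms of degree `d`. -/
noncomputable def disc (N d : ℕ) : Form N d → ℂ :=
  Classical.epsilon fun R => R ∈ polyFun (Form N d) ∧
    ∀ p, R p ≠ 0 ↔ ∀ x, x ≠ 0 → ¬ IsSingularAt p.1 x

theorem disc_mem (hd : 2 ≤ d) : disc N d ∈ polyFun (Form N d) :=
  (Classical.epsilon_spec (exists_discriminant N hd)).1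

theorem disc_ne_zero_iff (hd : 2 ≤ d) (p : Form N d) :
    disc N d p ≠ 0 ↔ ∀ x, x ≠ 0 → ¬ IsSingularAt p.1 x :=
  (Classical.epsilon_spec (exists_discriminant N hd)).2 p

/-- The derivative of the discriminant at `z.1` in the direction `z.2`. -/
noncomputable def discDeriv (z : Form N d × Form N d) : ℂ :=
  deriv (fun ε : ℂ => disc N d (z.1 + ε • z.2)) 0

theorem hasDerivAt_disc (hd : 2 ≤ d) (B A : Form N d) :
    HasDerivAt (fun ε : ℂ => disc N d (B + ε • A)) (discDeriv (B, A)) 0 := by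
  obtain ⟨R', -, h⟩ := exists_deriv_polyFun (disc_mem (N := N) hd)
  exact (h (B, A)).differentiableAt.hasDerivAt

theorem discDeriv_mem (hd : 2 ≤ d) : discDeriv ∈ polyFun (Form N d × Form N d) := by
  obtain ⟨R', hR', h⟩ := exists_deriv_polyFun (disc_mem (N := N) hd)
  have : discDeriv = R' := funext fun z => (h z).deriv
  rwa [this]

theorem discDeriv_smul (hd : 2 ≤ d) (B A : Form N d) (c : ℂ) :
    discDeriv (B, c • A) = c * discDeriv (B, A) := by
  have h1 : HasDerivAt (fun ε : ℂ => disc N d (B + ε • A)) (discDeriv (B, A)) (id (0 : ℂ) * c) := by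
    simpa using hasDerivAt_disc hd B A
  have h2 := h1.comp (0 : ℂ) ((hasDerivAt_id (0 : ℂ)).mul_const c)
  have h3 : (fun ε : ℂ => disc N d (B + ε • A)) ∘ (fun y => id y * c) =
      fun ε : ℂ => disc N d (B + ε • c • A) := by
    ext ε
    simp [smul_smul]
  rw [h3] at h2
  rw [(hasDerivAt_disc hd B (c • A)).unique h2]
  ring

/-- `coneSum` as a form. -/
noncomputable def coneForm (l : Module.Dual ℂ (Vec N)) (P : Vec N) (m : Module.Dual ℂ (Vec N))
    (w : Vec N) (f : Form N d) (a b c : ℂ) : Form N d :=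
  ⟨coneSum l P m w f.1 d a b c, coneSum_isHomogeneous f.2 a b c⟩

/-- `f ∘ conePr` as a form. -/
noncomputable def coneBase (l : Module.Dual ℂ (Vec N)) (P : Vec N) (m : Module.Dual ℂ (Vec N))
    (w : Vec N) (f : Form N d) : Form N d :=
  ⟨compLin (conePr l P m w) f.1, compLin_isHomogeneous _ f.2⟩

variable {l m : Module.Dual ℂ (Vec N)} {P w : Vec N}

theorem coneBase_add_smul (f g : Form N d) (ε : ℂ) :
    coneBase l P m w (f + ε • g) = coneBase l P m w f + ε • coneBase l P m w g :=
  Subtype.ext <| by simp [coneBase]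

theorem coneForm_eq (f : Form N d) (a b c : ℂ) : coneForm l P m w f a b c =
    a • coneBase l P m w f + b • ⟨linForm l ^ d, by
      simpa using (linForm_isHomogeneous l).pow d⟩ +
      c • ⟨linForm m ^ d, by simpa using (linForm_isHomogeneous m).pow d⟩ :=
  Subtype.ext <| by simp [coneForm, coneBase, coneSum, smul_eq_C_mul]

theorem coneForm_add_smul (f g : Form N d) (ε a b c : ℂ) :
    coneForm l P m w (f + ε • g) a b c =
      coneForm l P m w f a b c + ε • (a • coneBase l P m w g) := by
  rw [coneForm_eq, coneForm_eq, coneBase_add_smul]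
  module

section

variable (hd : 2 ≤ d) (hlP : l P = 0) (hmw : m w = 0) (hlw : l w ≠ 0) (hmP : m P ≠ 0)
include hd hlP hmw hlw hmP

theorem disc_coneForm_ne_zero_iff (f : Form N d) {a b c a' b' c' : ℂ} (ha : a ≠ 0) (hb : b ≠ 0)
    (hc : c ≠ 0) (ha' : a' ≠ 0) (hb' : b' ≠ 0) (hc' : c' ≠ 0) :
    disc N d (coneForm l P m w f a b c) ≠ 0 ↔ disc N d (coneForm l P m w f a' b' c') ≠ 0 := by
  rw [disc_ne_zero_iff hd, disc_ne_zero_iff hd]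
  have h := fun x => (isSingularAt_coneSum_iff (x := x) hd f.2 hlP hmw hlw hmP ha hb hc).trans
    (isSingularAt_coneSum_iff hd f.2 hlP hmw hlw hmP ha' hb' hc').symm
  simp only [coneForm, h]

/-- Smoothness does not depend on the nonzero weights, so the discriminant has no zeros in s ≠ 0 and
must be a power of s, uniformly along the pencil `f + ε • g`. -/
theorem exists_disc_coneForm_eq_pow (f g : Form N d) {a b c : ℂ → ℂ}
    (ha : a ∈ polyFun ℂ) (hb : b ∈ polyFun ℂ) (hc : c ∈ polyFun ℂ) (ha0 : ∀ s, s ≠ 0 → a s ≠ 0)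
    (hb0 : ∀ s, s ≠ 0 → b s ≠ 0) (hc0 : ∀ s, s ≠ 0 → c s ≠ 0)
    (h0 : disc N d (coneForm l P m w f (a 1) (b 1) (c 1)) ≠ 0) :
    ∃ α : ℕ, ∀ ε s : ℂ, disc N d (coneForm l P m w (f + ε • g) (a s) (b s) (c s)) =
      s ^ α * disc N d (coneForm l P m w (f + ε • g) (a 1) (b 1) (c 1)) := by
  have hfst : (fun z : ℂ × ℂ => z.1) ∈ polyFun (ℂ × ℂ) :=
    linear_mem_polyFun (LinearMap.fst ℂ ℂ ℂ)
  have hsnd : MapIn (polyFun (ℂ × ℂ)) fun z : ℂ × ℂ => z.2 :=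
    MapIn.linearMap (LinearMap.snd ℂ ℂ ℂ)
  have hmap : MapIn (polyFun (ℂ × ℂ)) fun z : ℂ × ℂ =>
      coneForm l P m w (f + z.1 • g) (a z.2) (b z.2) (c z.2) := by
    simp only [coneForm_eq, coneBase_add_smul]
    exact ((MapIn.smul (polyFun_comp hsnd ha) ((MapIn.const _ _).add (MapIn.smul hfst
      (MapIn.const _ _)))).add (MapIn.smul (polyFun_comp hsnd hb) (MapIn.const _ _))).add
      (MapIn.smul (polyFun_comp hsnd hc) (MapIn.const _ _))
  refine eq_pow_mul_of_no_zeros (polyFun_comp hmap (disc_mem hd)) (by simpa using h0) ?_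
  intro ε hε s hs
  exact (disc_coneForm_ne_zero_iff hd hlP hmw hlw hmP _ (ha0 1 one_ne_zero) (hb0 1 one_ne_zero)
    (hc0 1 one_ne_zero) (ha0 s hs) (hb0 s hs) (hc0 s hs)).1 hε

theorem exists_disc_coneForm_eq_mul (f g : Form N d) {a b : ℂ} (ha : a ≠ 0) (hb : b ≠ 0)
    (c : ℂ) (h0 : disc N d (coneForm l P m w f 1 1 1) ≠ 0) :
    ∃ χ : ℂ, ∀ ε : ℂ, disc N d (coneForm l P m w (f + ε • g) a b c) =
      χ * disc N d (coneForm l P m w (f + ε • g) 1 1 1) := by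
  have hid : (fun s : ℂ => s) ∈ polyFun ℂ := linear_mem_polyFun LinearMap.id
  have hconst : ∀ x : ℂ, (fun _ : ℂ => x) ∈ polyFun ℂ := const_mem_subalgebra _
  obtain ⟨α, h1⟩ := exists_disc_coneForm_eq_pow hd hlP hmw hlw hmP f g hid (hconst 1) (hconst 1)
    (fun s hs => hs) (fun _ _ => one_ne_zero) (fun _ _ => one_ne_zero) h0
  obtain ⟨β, h2⟩ := exists_disc_coneForm_eq_pow hd hlP hmw hlw hmP f g (hconst a) hid (hconst 1)
    (fun _ _ => ha) (fun s hs => hs) (fun _ _ => one_ne_zero)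
    ((disc_coneForm_ne_zero_iff hd hlP hmw hlw hmP f one_ne_zero one_ne_zero one_ne_zero ha
      one_ne_zero one_ne_zero).1 h0)
  obtain ⟨γ, h3⟩ := exists_disc_coneForm_eq_pow hd hlP hmw hlw hmP f g (hconst a) (hconst b) hid
    (fun _ _ => ha) (fun _ _ => hb) (fun s hs => hs)
    ((disc_coneForm_ne_zero_iff hd hlP hmw hlw hmP f one_ne_zero one_ne_zero one_ne_zero ha
      hb one_ne_zero).1 h0)
  refine ⟨c ^ γ * b ^ β * a ^ α, fun ε => ?_⟩
  rw [h3 ε c, h2 ε b, h1 ε a]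
  ring

/-- Obtained by differentiating the proportionality along pencils at ε = 0. The factor is the same
for all directions `g`, so quotients of derivatives do not depend on the weights. -/
theorem discDeriv_coneForm_eq_mul (f : Form N d) {a b c : ℂ} (ha : a ≠ 0) (hb : b ≠ 0)
    (hc : c ≠ 0) (h0 : disc N d (coneForm l P m w f 1 1 1) ≠ 0) :
    ∃ χ : ℂ, χ ≠ 0 ∧ ∀ g, discDeriv (coneForm l P m w f a b c, coneBase l P m w g) =
      χ * discDeriv (coneForm l P m w f 1 1 1, coneBase l P m w g) := by
  have hne : disc N d (coneForm l P m w f a b c) ≠ 0 :=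
    (disc_coneForm_ne_zero_iff hd hlP hmw hlw hmP f one_ne_zero one_ne_zero one_ne_zero ha hb
      hc).1 h0
  -- The factor `a⁻¹` appears because with weight `a` the pencil moves in the direction `a •
  -- coneBase g`. The pencil factor is read off at ε = 0, where it does not involve `g`.
  refine ⟨a⁻¹ * (disc N d (coneForm l P m w f a b c) / disc N d (coneForm l P m w f 1 1 1)),
    mul_ne_zero (inv_ne_zero ha) (div_ne_zero hne h0), fun g => ?_⟩
  obtain ⟨χ, hχ⟩ := exists_disc_coneForm_eq_mul hd hlP hmw hlw hmP f g ha hb c h0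
  have hχ0 : disc N d (coneForm l P m w f a b c) / disc N d (coneForm l P m w f 1 1 1) = χ := by
    have := hχ 0
    simp only [zero_smul, add_zero] at this
    rw [this, mul_div_assoc, div_self h0, mul_one]
  rw [hχ0]
  simp only [coneForm_add_smul, one_smul] at hχ
  have h1 := hasDerivAt_disc hd (coneForm l P m w f a b c) (a • coneBase l P m w g)
  have h2 := (hasDerivAt_disc hd (coneForm l P m w f 1 1 1) (coneBase l P m w g)).const_mul χ
  simp only [hχ] at h1
  have h3 := h1.unique h2
  rw [discDeriv_smul hd] at h3
  rw [mul_assoc, ← h3, ← mul_assoc, inv_mul_cancel₀ ha, one_mul]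

/-- Euler's formula: scaling the part coming from `f` by s multiplies the discriminant by s^α. The
exponent is positive, since for s = 0 only l^d + m^d is left, which is singular along l = m = 0, and
this subspace is nonzero for N ≥ 2. -/
theorem discDeriv_coneForm_self_ne_zero (hN : 2 ≤ N) (f : Form N d)
    (h0 : disc N d (coneForm l P m w f 1 1 1) ≠ 0) :
    discDeriv (coneForm l P m w f 1 1 1, coneBase l P m w f) ≠ 0 := by
  have hid : (fun s : ℂ => s) ∈ polyFun ℂ := linear_mem_polyFun LinearMap.id
  have hconst : ∀ x : ℂ, (fun _ : ℂ => x) ∈ polyFun ℂ := const_mem_subalgebra _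
  obtain ⟨α, h1⟩ := exists_disc_coneForm_eq_pow hd hlP hmw hlw hmP f 0 hid (hconst 1) (hconst 1)
    (fun s hs => hs) (fun _ _ => one_ne_zero) (fun _ _ => one_ne_zero) h0
  simp only [smul_zero, add_zero] at h1
  replace h1 := h1 0
  have hα : α ≠ 0 := by
    rintro rfl
    have h2 := h1 0
    rw [pow_zero, one_mul] at h2
    rw [← h2] at h0
    obtain ⟨x, hx, hx0⟩ := Submodule.exists_mem_ne_zero_of_ne_bot (p := LinearMap.ker (l.prod m)) (by
      intro hbot
      have := LinearMap.finrank_le_finrank_of_injective (LinearMap.ker_eq_bot.1 hbot)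
      simp at this
      omega)
    replace hx : l x = 0 ∧ m x = 0 := by simpa using hx
    refine (disc_ne_zero_iff hd _).1 h0 x hx0 ?_
    rw [isSingularAt_iff_dirDeriv]
    intro v
    have hd1 : d - 1 ≠ 0 := by omega
    simp [coneForm, dirDeriv_coneSum, hx.1, hx.2, hd1]
  have h2 := hasDerivAt_disc hd (coneForm l P m w f 1 1 1) (coneBase l P m w f)
  have h3 : (fun ε : ℂ => disc N d (coneForm l P m w f 1 1 1 + ε • coneBase l P m w f)) =
      fun ε : ℂ => (1 + ε) ^ α * disc N d (coneForm l P m w f 1 1 1) := by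
    ext ε
    have hsum : coneForm l P m w f 1 1 1 + ε • coneBase l P m w f =
        coneForm l P m w f (1 + ε) 1 1 := by
      rw [coneForm_eq, coneForm_eq]
      generalize coneBase l P m w f = q
      simp only [one_smul, add_smul]
      abel
    rw [hsum, h1 (1 + ε)]
  rw [h3] at h2
  have h4 := (((hasDerivAt_id (0 : ℂ)).const_add 1).pow α).mul_const
    (disc N d (coneForm l P m w f 1 1 1))
  have h5 := h2.unique h4
  rw [h5]
  simp [hα, h0]

end

/-- The factor by which `f` has to be multiplied in order to agree with `g` on the intersection of
the hyperplanes `l = 0` and `m = 0`, if there is one. -/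
noncomputable def coneRatio (l : Module.Dual ℂ (Vec N)) (P : Vec N) (m : Module.Dual ℂ (Vec N))
    (w : Vec N) (g f : Form N d) : ℂ :=
  discDeriv (coneForm l P m w f 1 1 1, coneBase l P m w g) /
    discDeriv (coneForm l P m w f 1 1 1, coneBase l P m w f)

theorem conePr_mem (hlP : l P = 0) (hmw : m w = 0) (x : Vec N) :
    l (conePr l P m w x) = 0 ∧ m (conePr l P m w x) = 0 := by
  constructor
  · simp only [conePr_apply, map_sub, map_smul, smul_eq_mul, hlP]; ring
  · simp only [conePr_apply, map_sub, map_smul, smul_eq_mul, hmw]; ring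

theorem disc_coneForm_ne_zero (hd : 2 ≤ d) (hlP : l P = 0) (hmw : m w = 0) (hlw : l w ≠ 0)
    (hmP : m P ≠ 0) {f : Form N d} (hinv : ConeInv l P f.1) (hsm : ConeSmooth l P f.1) :
    disc N d (coneForm l P m w f 1 1 1) ≠ 0 :=
  (disc_ne_zero_iff hd _).2 ((coneSum_smooth_iff hd f.2 hlP hmw hlw hmP hinv one_ne_zero
    one_ne_zero one_ne_zero).2 hsm)

theorem coneRatio_eq (hN : 2 ≤ N) (hd : 2 ≤ d) (hlP : l P = 0) (hmw : m w = 0) (hlw : l w ≠ 0)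
    (hmP : m P ≠ 0) {g f : Form N d} (h0 : disc N d (coneForm l P m w f 1 1 1) ≠ 0) {μ : ℂ}
    (h : ∀ x, l x = 0 → m x = 0 → eval x g.1 = μ * eval x f.1) :
    coneRatio l P m w g f = μ := by
  have : coneBase l P m w g = μ • coneBase l P m w f := by
    refine Subtype.ext (MvPolynomial.funext fun x => ?_)
    have := conePr_mem hlP hmw x
    simp [coneBase, eval_compLin, smul_eval, h _ this.1 this.2]
  rw [coneRatio, this, discDeriv_smul hd, mul_div_assoc, div_self
    (discDeriv_coneForm_self_ne_zero hd hlP hmw hlw hmP hN f h0), mul_one]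

/-- New coordinates rescale the projection by ρ and the three summands of the form by nonzero
weights, all of which cancel in the quotient. Thus the rescaled equation of the second cone changes
only by `u'`, the factor coming from the first cone. -/
theorem coneRatio_scale (hd : 2 ≤ d) (hlP : l P = 0) (hmw : m w = 0)
    (hlw : l w ≠ 0) (hmP : m P ≠ 0) {g f g' f' : Form N d}
    (h0 : disc N d (coneForm l P m w f 1 1 1) ≠ 0) {s s' t t' u u' : ℂ} (hs : s ≠ 0) (hs' : s' ≠ 0)
    (ht : t ≠ 0) (ht' : t' ≠ 0) (hu : u ≠ 0)
    (hf : ∀ x, l x = 0 → eval x f'.1 = u * eval x f.1)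
    (hg : ∀ x, m x = 0 → eval x g'.1 = u' * eval x g.1) :
    coneRatio (s • l) (t • P) (s' • m) (t' • w) g' f' * u = u' * coneRatio l P m w g f := by
  set ρ := s * s' * t * t' with hρ
  have hρ0 : ρ ≠ 0 := by simp [hρ, hs, hs', ht, ht']
  have hpr : ∀ x, conePr (s • l) (t • P) (s' • m) (t' • w) x = ρ • conePr l P m w x := by
    intro x
    simp only [conePr_apply, map_smul, LinearMap.smul_apply, smul_eq_mul, hρ]
    module
  have hbase : ∀ (p p' : Form N d) (v : ℂ), (∀ x, l x = 0 → m x = 0 → eval x p'.1 = v * eval x p.1) →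
      coneBase (s • l) (t • P) (s' • m) (t' • w) p' = (ρ ^ d * v) • coneBase l P m w p := by
    intro p p' v hp
    refine Subtype.ext (MvPolynomial.funext fun x => ?_)
    have hx := conePr_mem hlP hmw x
    simp only [coneBase, eval_compLin, hpr, Submodule.coe_smul, smul_eval]
    rw [eval_smul_of_isHomogeneous p'.2, hp _ hx.1 hx.2]
    ring
  have hform : coneForm (s • l) (t • P) (s' • m) (t' • w) f' 1 1 1 =
      coneForm l P m w f (ρ ^ d * u) (s ^ d) (s' ^ d) := by
    rw [coneForm_eq, coneForm_eq, hbase f f' u fun x h1 _ => hf x h1]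
    refine Subtype.ext ?_
    simp only [map_smul, smul_pow, one_smul, Submodule.coe_add, Submodule.coe_smul]
  obtain ⟨χ, hχ0, hχ⟩ := discDeriv_coneForm_eq_mul hd hlP hmw hlw hmP f
    (mul_ne_zero (pow_ne_zero d hρ0) hu) (pow_ne_zero d hs) (pow_ne_zero d hs') h0
  rw [coneRatio, coneRatio, hform, hbase f f' u fun x h1 _ => hf x h1,
    hbase g g' u' fun x _ h2 => hg x h2, discDeriv_smul hd, discDeriv_smul hd, hχ, hχ]
  -- If the denominator vanishes, both ratios are zero by convention, so no bound on `N` is needed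
  -- here.
  by_cases h : discDeriv (coneForm l P m w f 1 1 1, coneBase l P m w f) = 0
  · simp [h]
  · have := pow_ne_zero d hρ0
    field_simp

section

variable {M : Type*} [AddCommGroup M] [Module ℂ M]

theorem MapIn.dual_apply {O : Subalgebra ℂ (M → ℂ)} {l : M → Module.Dual ℂ (Vec N)} {P : M → Vec N}
    (hl : MapIn O l) (hP : MapIn O P) : (fun D => l D (P D)) ∈ O := by
  have : (fun D => l D (P D)) = fun D => ∑ i, P D i * l D (Pi.single i 1) := by
    ext D
    conv_lhs => rw [pi_eq_sum_univ' (P D)]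
    simp
  rw [this]
  exact sum_mem_subalgebra _ fun i _ => mul_mem (hP (LinearMap.proj i))
    (hl (Module.Dual.eval ℂ (Vec N) (Pi.single i 1)))

omit [AddCommGroup M] [Module ℂ M] in
theorem MapIn.dual_apply_const {O : Subalgebra ℂ (M → ℂ)} {l : M → Module.Dual ℂ (Vec N)}
    (hl : MapIn O l) (v : Vec N) : (fun D => l D v) ∈ O :=
  hl (Module.Dual.eval ℂ (Vec N) v)

theorem MapIn.conePr_apply_mem {O : Subalgebra ℂ (M → ℂ)} {l m : M → Module.Dual ℂ (Vec N)}
    {P w : M → Vec N} (hl : MapIn O l) (hm : MapIn O m) (hP : MapIn O P) (hw : MapIn O w)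
    (v : Vec N) (i : Fin (N + 1)) : (fun D => conePr (l D) (P D) (m D) (w D) v i) ∈ O := by
  have hPi : (fun D => P D i) ∈ O := hP (LinearMap.proj i)
  have hwi : (fun D => w D i) ∈ O := hw (LinearMap.proj i)
  exact sub_mem (sub_mem (mul_mem (mul_mem (hm.dual_apply hP) (hl.dual_apply hw))
    (const_mem_subalgebra _ (v i))) (mul_mem (hm.dual_apply hP) (mul_mem
      (hl.dual_apply_const v) hwi)))
    (mul_mem (hl.dual_apply hw) (mul_mem (hm.dual_apply_const v) hPi))

theorem MapIn.coneForm {O : Subalgebra ℂ (M → ℂ)} {l m : M → Module.Dual ℂ (Vec N)}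
    {P w : M → Vec N} {f : M → Form N d} (hl : MapIn O l) (hm : MapIn O m) (hP : MapIn O P)
    (hw : MapIn O w) (hf : MapIn O f) :
    MapIn O fun D => coneForm (l D) (P D) (m D) (w D) (f D) 1 1 1 := by
  refine CoeffIn.mapIn ?_
  exact (((CoeffIn.const _).mul (CoeffIn.compLin (hl.conePr_apply_mem hm hP hw) hf.coeffIn
    fun D => (f D).2)).add
    ((CoeffIn.const _).mul ((coeffIn_linForm hl.dual_apply_const).pow d))).add
    ((CoeffIn.const _).mul ((coeffIn_linForm hm.dual_apply_const).pow d))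

theorem coneRatio_mem_ratAt (hd : 2 ≤ d) {D₀ : M} {l m : M → Module.Dual ℂ (Vec N)} {P w : M → Vec N}
    {g f : M → Form N d} (hl : MapIn (ratAt D₀) l) (hm : MapIn (ratAt D₀) m)
    (hP : MapIn (ratAt D₀) P) (hw : MapIn (ratAt D₀) w) (hg : MapIn (ratAt D₀) g)
    (hf : MapIn (ratAt D₀) f)
    (h0 : discDeriv (coneForm (l D₀) (P D₀) (m D₀) (w D₀) (f D₀) 1 1 1,
      coneBase (l D₀) (P D₀) (m D₀) (w D₀) (f D₀)) ≠ 0) :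
    (fun D => coneRatio (l D) (P D) (m D) (w D) (g D) (f D)) ∈ ratAt D₀ := by
  have hbase : ∀ {f : M → Form N d}, MapIn (ratAt D₀) f →
      MapIn (ratAt D₀) fun D => coneBase (l D) (P D) (m D) (w D) (f D) :=
    fun {f} hf => CoeffIn.mapIn (CoeffIn.compLin (hl.conePr_apply_mem hm hP hw) hf.coeffIn
      fun D => (f D).2)
  have h1 := fun {g : M → Form N d} (hg : MapIn (ratAt D₀) g) =>
    polyFun_comp ((hl.coneForm hm hP hw hf).prodMk (hbase hg)) (discDeriv_mem hd)
  simp only [coneRatio, div_eq_mul_inv]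
  exact mul_mem (h1 hg) (inv_mem_ratAt (h1 hf) h0)

end

end Ratio


/-! ### Coordinates of configurations -/

section Coordinates

variable {N d e : ℕ}

/-- The conditions on coordinates to define a configuration. -/
structure GoodCoord (D : ConfigCoord N d e) : Prop where
  lin_ne : ∀ i, (D i).1 ≠ 0
  vtx_ne : ∀ i, (D i).2.1 ≠ 0
  lin_vtx : ∀ i, (D i).1 (D i).2.1 = 0
  lin_vtx_ne : ∀ i j, i ≠ j → (D i).1 (D j).2.1 ≠ 0
  inv : ∀ i, ConeInv (D i).1 (D i).2.1 (D i).2.2.1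
  smooth : ∀ i, ConeSmooth (D i).1 (D i).2.1 (D i).2.2.1

theorem lineDeriv_restr (H : Submodule ℂ (Vec N)) (f : MvPolynomial (Fin (N + 1)) ℂ) (x v : H) :
    lineDeriv ℂ (restr H f) x v = dirDeriv f x v := by
  have := (hasDerivAt_eval f (x : Vec N) v).deriv
  rw [← this]
  rfl

theorem restr_eq_zero_iff {H : Submodule ℂ (Vec N)} {l : Module.Dual ℂ (Vec N)}
    (hH : H = LinearMap.ker l) (hl : l ≠ 0) {F : MvPolynomial (Fin (N + 1)) ℂ} :
    restr H F = 0 ↔ linForm l ∣ F := by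
  subst hH
  constructor
  · intro h
    refine linForm_dvd_of_vanishes hl fun x hx => ?_
    exact congrFun h ⟨x, hx⟩
  · rintro ⟨G, rfl⟩
    ext x
    have hx : l x.1 = 0 := x.2
    simp [restr, eval_linForm, hx]

theorem restr_eq_iff {H : Submodule ℂ (Vec N)} {l : Module.Dual ℂ (Vec N)}
    (hH : H = LinearMap.ker l) (hl : l ≠ 0) {F G : MvPolynomial (Fin (N + 1)) ℂ} :
    restr H F = restr H G ↔ linForm l ∣ F - G := by
  rw [← sub_eq_zero, ← map_sub, restr_eq_zero_iff hH hl]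

/-- If `f` vanished on the whole hyperplane, so would its derivatives inside it, contradicting
smoothness at a point outside the line of `P`. -/
theorem ConeSmooth.exists_eval_ne_zero (hN : 2 ≤ N) {l : Module.Dual ℂ (Vec N)} {P : Vec N}
    {f : MvPolynomial (Fin (N + 1)) ℂ} (h : ConeSmooth l P f) : ∃ x, l x = 0 ∧ eval x f ≠ 0 := by
  by_contra! h0
  have hlt : ¬ LinearMap.ker l ≤ Submodule.span ℂ {P} := by
    intro hle
    have h1 := Submodule.finrank_mono hle
    have h2 := finrank_span_le_card (R := ℂ) ({P} : Set (Vec N))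
    have h3 := LinearMap.finrank_range_add_finrank_ker l
    have h4 := Submodule.finrank_le (LinearMap.range l)
    simp at h2 h3 h4
    omega
  obtain ⟨x, hx, hxP⟩ := SetLike.not_le_iff_exists.1 hlt
  obtain ⟨v, hv, hne⟩ := h x hx hxP (h0 x hx)
  refine hne ?_
  have h1 := hasDerivAt_eval f x v
  have h2 : (fun s : ℂ => eval (x + s • v) f) = fun _ => 0 := by
    ext s
    exact h0 _ (by simp [hv, show l x = 0 from hx])
  rw [h2] at h1
  exact h1.unique (hasDerivAt_const _ _)

theorem ConfigRel.good {D : ConfigCoord N d e} {L : Config N d e} (h : ConfigRel D L) :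
    GoodCoord D := by
  have hpt : ∀ i j, (D i).1 (D j).2.1 = 0 ↔ (L.1 j).pt.submodule ≤ (L.1 i).hyp := by
    intro i j
    rw [(h i).1, (h j).2.1, Submodule.span_singleton_le_iff_mem, LinearMap.mem_ker]
  have hmem : ∀ i, restr (L.1 i).hyp (D i).2.2.1 ∈ (L.1 i).cone := by
    intro i
    rw [(h i).2.2]
    exact Submodule.mem_span_singleton_self _
  have hle : ∀ i x, (D i).1 x = 0 → x ∈ (L.1 i).hyp := by
    intro i x hx
    rw [(h i).1]
    exact hx
  have hl : ∀ i, (D i).1 ≠ 0 := by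
    intro i hi
    have h1 := (L.1 i).hyp_rank
    rw [(h i).1, hi, LinearMap.ker_zero, finrank_top] at h1
    simp at h1
  constructor
  · exact hl
  · intro i hi
    have h1 := (L.1 i).pt.finrank_submodule
    rw [(h i).2.1, hi, Submodule.span_zero_singleton, finrank_bot] at h1
    omega
  · exact fun i => (hpt i i).2 (L.1 i).pt_le
  · exact fun i j hij hz => L.2 j i (Ne.symm hij) ((hpt i j).1 hz)
  · intro i x hx t
    have hP : t • (D i).2.1 ∈ (L.1 i).pt.submodule := by
      rw [(h i).2.1]
      exact Submodule.smul_mem _ _ (Submodule.mem_span_singleton_self _)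
    exact (L.1 i).cone_vertex _ (hmem i) ⟨x, hle i x hx⟩ ⟨_, (L.1 i).pt_le hP⟩ hP
  · intro i x hx hxP hx0
    have hne : restr (L.1 i).hyp (D i).2.2.1 ≠ 0 := by
      intro h0
      have h1 := (L.1 i).cone_rank
      rw [(h i).2.2, h0, Submodule.span_zero_singleton, finrank_bot] at h1
      omega
    obtain ⟨v, hv⟩ := (L.1 i).cone_smooth _ (hmem i) hne ⟨x, hle i x hx⟩
      (by rw [(h i).2.1]; exact hxP) hx0
    rw [lineDeriv_restr] at hv
    exact ⟨v, (h i).1.le v.2, hv⟩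

theorem finrank_ker_dual {l : Module.Dual ℂ (Vec N)} (hl : l ≠ 0) :
    Module.finrank ℂ (LinearMap.ker l) = N := by
  have h1 := LinearMap.finrank_range_add_finrank_ker l
  rw [LinearMap.range_eq_top.2 (LinearMap.surjective hl)] at h1
  simp at h1
  omega

theorem GoodCoord.exists_rel (hN : 2 ≤ N) {D : ConfigCoord N d e} (h : GoodCoord D) :
    ∃ L, ConfigRel D L := by
  let T : Fin e → Triple N d := fun i =>
    { hyp := LinearMap.ker (D i).1
      hyp_rank := finrank_ker_dual (h.lin_ne i)
      pt := Projectivization.mk ℂ (D i).2.1 (h.vtx_ne i)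
      pt_le := by
        rw [Projectivization.submodule_mk, Submodule.span_singleton_le_iff_mem]
        exact h.lin_vtx i
      cone := Submodule.span ℂ {restr (LinearMap.ker (D i).1) (D i).2.2}
      cone_le := by
        rw [Submodule.span_singleton_le_iff_mem]
        exact ⟨_, (D i).2.2.2, rfl⟩
      cone_rank := by
        obtain ⟨x, hx, hne⟩ := (h.smooth i).exists_eval_ne_zero hN
        exact finrank_span_singleton fun h0 => hne (congrFun h0 ⟨x, hx⟩)
      cone_vertex := by
        intro c hc x v hv
        rw [Projectivization.submodule_mk] at hv
        obtain ⟨a, rfl⟩ := Submodule.mem_span_singleton.1 hc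
        obtain ⟨t, ht⟩ := Submodule.mem_span_singleton.1 hv
        have := h.inv i x x.2 t
        rw [ht] at this
        exact congrArg (a • ·) this
      cone_smooth := by
        intro c hc hc0 x hx hx0
        rw [Projectivization.submodule_mk] at hx
        obtain ⟨a, rfl⟩ := Submodule.mem_span_singleton.1 hc
        have ha : a ≠ 0 := by
          rintro rfl
          simp at hc0
        have hx1 : eval (x : Vec N) (D i).2.2.1 = 0 := by
          have : a * eval (x : Vec N) (D i).2.2.1 = 0 := hx0
          exact (mul_eq_zero.1 this).resolve_left ha
        obtain ⟨v, hv, hne⟩ := h.smooth i x x.2 hx hx1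
        refine ⟨⟨v, hv⟩, ?_⟩
        rw [← map_smul, lineDeriv_restr, smul_eq_C_mul, dirDeriv_C_mul]
        exact mul_ne_zero ha hne }
  refine ⟨⟨T, fun i j hij hle => ?_⟩, fun i => ⟨rfl, Projectivization.submodule_mk _ _, rfl⟩⟩
  change (Projectivization.mk ℂ (D i).2.1 (h.vtx_ne i)).submodule ≤ LinearMap.ker (D j).1 at hle
  rw [Projectivization.submodule_mk, Submodule.span_singleton_le_iff_mem] at hle
  exact h.lin_vtx_ne j i (Ne.symm hij) hle

theorem exists_configRel (L : Config N d e) : ∃ D, ConfigRel D L := by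
  have h : ∀ i, ∃ D : Module.Dual ℂ (Vec N) × Vec N × Form N d, (L.1 i).hyp = LinearMap.ker D.1 ∧
      (L.1 i).pt.submodule = Submodule.span ℂ {D.2.1} ∧
      (L.1 i).cone = Submodule.span ℂ {restr (L.1 i).hyp D.2.2} := by
    intro i
    obtain ⟨l, hl⟩ : ∃ l : Module.Dual ℂ (Vec N), (L.1 i).hyp = LinearMap.ker l := by
      have hlt : (L.1 i).hyp < ⊤ := by
        rw [lt_top_iff_ne_top]
        intro htop
        have := (L.1 i).hyp_rank
        rw [htop, finrank_top] at this
        simp at this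
      obtain ⟨l, hl0, hl⟩ := Submodule.exists_le_ker_of_lt_top _ hlt
      exact ⟨l, Submodule.eq_of_le_of_finrank_eq hl
        ((L.1 i).hyp_rank.trans (finrank_ker_dual hl0).symm)⟩
    obtain ⟨c, hc0, hc⟩ := finrank_eq_one_iff'.1 (L.1 i).cone_rank
    obtain ⟨f, hf, hfc⟩ := (L.1 i).cone_le c.2
    refine ⟨⟨l, (L.1 i).pt.rep, ⟨f, hf⟩⟩, hl, (L.1 i).pt.submodule_eq, ?_⟩
    change _ = Submodule.span ℂ {restr (L.1 i).hyp f}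
    rw [hfc]
    refine le_antisymm (fun x hx => ?_) ?_
    · obtain ⟨a, ha⟩ := hc ⟨x, hx⟩
      exact Submodule.mem_span_singleton.2 ⟨a, congrArg Subtype.val ha⟩
    · rw [Submodule.span_singleton_le_iff_mem]
      exact c.2
  choose D hD using h
  exact ⟨D, hD⟩

/-- Two systems of coordinates of the same configuration differ by scalings. -/
theorem ConfigRel.exists_scale {D D' : ConfigCoord N d e} {L : Config N d e} (h : ConfigRel D L)
    (h' : ConfigRel D' L) (i : Fin e) : ∃ s t u : ℂ, s ≠ 0 ∧ t ≠ 0 ∧ u ≠ 0 ∧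
      (D' i).1 = s • (D i).1 ∧ (D' i).2.1 = t • (D i).2.1 ∧
      linForm (D i).1 ∣ (D' i).2.2.1 - C u * (D i).2.2.1 := by
  obtain ⟨s, hs⟩ : ∃ s : ℂ, s • (D i).1 = (D' i).1 := by
    have hle : LinearMap.ker (D i).1 ≤ LinearMap.ker (D' i).1 := by
      rw [← (h i).1, (h' i).1]
    have := (mem_span_of_iInf_ker_le_ker (ι := Unit) (L := fun _ => (D i).1) (K := (D' i).1)
      (by simpa using hle))
    simpa [Submodule.mem_span_singleton] using this
  obtain ⟨t, ht⟩ : ∃ t : ℂ, t • (D i).2.1 = (D' i).2.1 := by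
    rw [← Submodule.mem_span_singleton, ← (h i).2.1, (h' i).2.1]
    exact Submodule.mem_span_singleton_self _
  obtain ⟨u, hu⟩ : ∃ u : ℂ, u • restr (L.1 i).hyp (D i).2.2 = restr (L.1 i).hyp (D' i).2.2 := by
    rw [← Submodule.mem_span_singleton, ← (h i).2.2, (h' i).2.2]
    exact Submodule.mem_span_singleton_self _
  refine ⟨s, t, u, ?_, ?_, ?_, hs.symm, ht.symm, ?_⟩
  · rintro rfl
    exact h'.good.lin_ne i (by rw [← hs, zero_smul])
  · rintro rfl
    exact h'.good.vtx_ne i (by rw [← ht, zero_smul])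
  · rintro rfl
    have h1 := (L.1 i).cone_rank
    rw [(h' i).2.2, ← hu, zero_smul, Submodule.span_zero_singleton, finrank_bot] at h1
    omega
  · rw [← restr_eq_iff (h i).1 (h.good.lin_ne i), ← hu, ← map_smul, smul_eq_C_mul]

theorem ConfigRel.of_scale {D D' : ConfigCoord N d e} {L : Config N d e} (h : ConfigRel D L)
    (H : ∀ i, ∃ s t u : ℂ, s ≠ 0 ∧ t ≠ 0 ∧ u ≠ 0 ∧
      (D' i).1 = s • (D i).1 ∧ (D' i).2.1 = t • (D i).2.1 ∧
      linForm (D i).1 ∣ (D' i).2.2.1 - C u * (D i).2.2.1) : ConfigRel D' L := by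
  intro i
  obtain ⟨s, t, u, hs, ht, hu, h1, h2, h3⟩ := H i
  refine ⟨?_, ?_, ?_⟩
  · rw [h1, LinearMap.ker_smul _ _ hs]
    exact (h i).1
  · rw [h2, Submodule.span_singleton_smul_eq (IsUnit.mk0 t ht)]
    exact (h i).2.1
  · rw [← restr_eq_iff (h i).1 (h.good.lin_ne i), ← smul_eq_C_mul, map_smul] at h3
    rw [h3, Submodule.span_singleton_smul_eq (IsUnit.mk0 u hu)]
    exact (h i).2.2

end Coordinates


/-! ### Forms on hyperplanes -/

section HyperplaneForms

/-- Substitution of a linear map into polynomials. -/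
noncomputable def linSubst {σ τ : Type*} [Fintype τ] [DecidableEq τ]
    (T : (τ → ℂ) →ₗ[ℂ] (σ → ℂ)) : MvPolynomial σ ℂ →ₐ[ℂ] MvPolynomial τ ℂ :=
  aeval fun i => ∑ j, C (T (Pi.single j 1) i) * X j

theorem eval_linSubst {σ τ : Type*} [Fintype τ] [DecidableEq τ] (T : (τ → ℂ) →ₗ[ℂ] (σ → ℂ))
    (F : MvPolynomial σ ℂ) (x : τ → ℂ) : eval x (linSubst T F) = eval (T x) F := by
  rw [linSubst, ← coe_aeval_eq_eval, ← coe_aeval_eq_eval, RingHom.coe_coe, RingHom.coe_coe,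
    ← AlgHom.comp_apply, comp_aeval]
  congr 2
  ext i
  conv_rhs => rw [pi_eq_sum_univ' x]
  simp [mul_comm]

theorem linSubst_isHomogeneous {σ τ : Type*} [Fintype τ] [DecidableEq τ]
    (T : (τ → ℂ) →ₗ[ℂ] (σ → ℂ)) {F : MvPolynomial σ ℂ} {n : ℕ} (hF : F.IsHomogeneous n) :
    (linSubst T F).IsHomogeneous n := by
  have := hF.aeval (fun i => ∑ j, C (T (Pi.single j 1) i) * X j) (n := 1) fun i =>
    IsHomogeneous.sum _ _ _ fun j _ => (isHomogeneous_X ℂ j).C_mul _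
  rwa [one_mul] at this

variable {N : ℕ}

theorem finrank_homogeneousSubmodule (hN : 1 ≤ N) (n : ℕ) :
    Module.finrank ℂ (homogeneousSubmodule (Fin N) ℂ n) = (N + n - 1).choose (N - 1) := by
  rw [Module.finrank_eq_card_basis (formBasis (Fin N) n), Fintype.card_coe]
  have : degMonomials (Fin N) n = Finset.finsuppAntidiag Finset.univ n := by
    ext s
    rw [mem_degMonomials, Finset.mem_finsuppAntidiag]
    simp [Finsupp.degree_eq_sum]
  rw [this, Finset.card_finsuppAntidiag_nat_eq_choose, Finset.card_univ, Fintype.card_fin,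
    show N + n - 1 = n + (N - 1) by omega, Nat.choose_symm_add]

/-- A projection whose kernel is spanned by a vector outside the hyperplane `l = 0`. -/
theorem exists_projection {w : Vec N} (hw : w ≠ 0) : ∃ ρ : Vec N →ₗ[ℂ] (Fin N → ℂ),
    ∀ l : Module.Dual ℂ (Vec N), l w ≠ 0 → ∀ x, l x = 0 → ρ x = 0 → x = 0 := by
  have hrank : Module.finrank ℂ (Vec N ⧸ Submodule.span ℂ {w}) = Module.finrank ℂ (Fin N → ℂ) := by
    have h1 := Submodule.finrank_quotient_add_finrank (Submodule.span ℂ {w})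
    rw [finrank_span_singleton hw] at h1
    simp at h1 ⊢
    exact h1
  let E := LinearEquiv.ofFinrankEq _ _ hrank
  refine ⟨E.toLinearMap ∘ₗ (Submodule.span ℂ {w}).mkQ, fun l hl x hx h0 => ?_⟩
  have h1 : x ∈ Submodule.span ℂ {w} := by simpa using h0
  obtain ⟨t, rfl⟩ := Submodule.mem_span_singleton.1 h1
  have : t = 0 := by simpa [hl] using hx
  simp [this]

section

variable {l : Module.Dual ℂ (Vec N)} (hl : l ≠ 0) {ρ : Vec N →ₗ[ℂ] (Fin N → ℂ)}
  (hρ : ∀ x, l x = 0 → ρ x = 0 → x = 0)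
include hl hρ

theorem exists_section_of_projection : ∃ T : (Fin N → ℂ) →ₗ[ℂ] Vec N,
    (∀ y, l (T y) = 0) ∧ (∀ y, ρ (T y) = y) ∧ ∀ x, l x = 0 → T (ρ x) = x := by
  let g : LinearMap.ker l →ₗ[ℂ] (Fin N → ℂ) := ρ ∘ₗ (LinearMap.ker l).subtype
  have hinj : Function.Injective g := by
    rw [injective_iff_map_eq_zero]
    exact fun x hx => Subtype.ext (hρ x x.2 hx)
  let E := LinearEquiv.ofInjectiveOfFinrankEq g hinj (by rw [finrank_ker_dual hl]; simp)
  have hE : ∀ x, E x = g x := fun x => rfl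
  refine ⟨(LinearMap.ker l).subtype ∘ₗ E.symm.toLinearMap, fun y => (E.symm y).2, fun y => ?_,
    fun x hx => ?_⟩
  · exact E.apply_symm_apply y
  · have := E.symm_apply_apply ⟨x, hx⟩
    exact congrArg Subtype.val this

theorem eq_zero_of_restr_linSubst {p : MvPolynomial (Fin N) ℂ}
    (h : ∀ x, l x = 0 → eval x (linSubst ρ p) = 0) : p = 0 := by
  obtain ⟨T, hT1, hT2, -⟩ := exists_section_of_projection hl hρ
  refine MvPolynomial.funext fun y => ?_
  have := h (T y) (hT1 y)
  rwa [eval_linSubst, hT2] at this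

theorem exists_linSubst_eq {n : ℕ} {F : MvPolynomial (Fin (N + 1)) ℂ} (hF : F.IsHomogeneous n) :
    ∃ p : MvPolynomial (Fin N) ℂ, p.IsHomogeneous n ∧
      ∀ x, l x = 0 → eval x (linSubst ρ p) = eval x F := by
  obtain ⟨T, -, -, hT⟩ := exists_section_of_projection hl hρ
  refine ⟨linSubst T F, linSubst_isHomogeneous T hF, fun x hx => ?_⟩
  rw [eval_linSubst, eval_linSubst, hT x hx]

end

/-- Multiplication of the pullback of a form along `ρ` by a polynomial, restricted to `H`. -/
noncomputable def restrMul (H : Submodule ℂ (Vec N)) (ρ : Vec N →ₗ[ℂ] (Fin N → ℂ)) (n : ℕ)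
    (A : MvPolynomial (Fin (N + 1)) ℂ) : homogeneousSubmodule (Fin N) ℂ n →ₗ[ℂ] (H → ℂ) :=
  restr H ∘ₗ LinearMap.mulLeft ℂ A ∘ₗ (linSubst ρ).toLinearMap ∘ₗ Submodule.subtype _

theorem restrMul_apply (H : Submodule ℂ (Vec N)) (ρ : Vec N →ₗ[ℂ] (Fin N → ℂ)) (n : ℕ)
    (A : MvPolynomial (Fin (N + 1)) ℂ) (p : homogeneousSubmodule (Fin N) ℂ n) :
    restrMul H ρ n A p = restr H (A * linSubst ρ p.1) := rfl

theorem finrank_formsOn (hN : 1 ≤ N) {H : Submodule ℂ (Vec N)} {l : Module.Dual ℂ (Vec N)}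
    (hH : H = LinearMap.ker l) (hl : l ≠ 0) (n : ℕ) :
    Module.finrank ℂ (formsOn H n) = (N + n - 1).choose (N - 1) := by
  obtain ⟨w, hw⟩ : ∃ w, l w ≠ 0 := by
    by_contra! h
    exact hl (LinearMap.ext h)
  obtain ⟨ρ, hρ⟩ := exists_projection (w := w) (by rintro rfl; simp at hw)
  have hρ' := hρ l hw
  have hinj : Function.Injective (restrMul H ρ n 1) := by
    rw [injective_iff_map_eq_zero]
    intro p hp
    refine Subtype.ext (eq_zero_of_restr_linSubst hl hρ' fun x hx => ?_)
    rw [restrMul_apply, one_mul] at hp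
    exact congrFun hp ⟨x, hH ▸ hx⟩
  have hrange : LinearMap.range (restrMul H ρ n 1) = formsOn H n := by
    refine le_antisymm ?_ ?_
    · rintro _ ⟨p, rfl⟩
      exact ⟨_, linSubst_isHomogeneous ρ p.2, by rw [restrMul_apply, one_mul]⟩
    · rintro _ ⟨F, hF, rfl⟩
      obtain ⟨p, hp, hpF⟩ := exists_linSubst_eq hl hρ' hF
      refine ⟨⟨p, hp⟩, ?_⟩
      rw [restrMul_apply, one_mul]
      ext x
      exact hpF x (hH.le x.2)
  rw [← hrange, LinearMap.finrank_range_of_inj hinj, finrank_homogeneousSubmodule hN]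

instance {N : ℕ} (H : Submodule ℂ (Vec N)) (n : ℕ) : Module.Finite ℂ (formsOn H n) :=
  inferInstanceAs (Module.Finite ℂ (Submodule.map (restr H) (homogeneousSubmodule _ ℂ n)))

end HyperplaneForms

/-! ### The fixed parts of the linear systems -/

section FixedPart

variable {N d e : ℕ}

/-- The equation of the hyperplane with number `j`. -/
noncomputable def lin (D : ConfigCoord N d e) (j : ℕ) : Module.Dual ℂ (Vec N) :=
  if h : j < e then (D ⟨j, h⟩).1 else 0

/-- The vertex with number `j`. -/
noncomputable def vtx (D : ConfigCoord N d e) (j : ℕ) : Vec N :=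
  if h : j < e then (D ⟨j, h⟩).2.1 else 0

/-- The equation of the cone with number `j`. -/
noncomputable def eqn (D : ConfigCoord N d e) (j : ℕ) : Form N d :=
  if h : j < e then (D ⟨j, h⟩).2.2 else 0

theorem lin_coe (D : ConfigCoord N d e) (k : Fin e) : lin D k = (D k).1 := dif_pos k.2
theorem vtx_coe (D : ConfigCoord N d e) (k : Fin e) : vtx D k = (D k).2.1 := dif_pos k.2
theorem eqn_coe (D : ConfigCoord N d e) (k : Fin e) : eqn D k = (D k).2.2 := dif_pos k.2

section

variable {D : ConfigCoord N d e} (h : GoodCoord D)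
include h

theorem GoodCoord.lin_ne' {j : ℕ} (hj : j < e) : lin D j ≠ 0 := by
  have := h.lin_ne ⟨j, hj⟩; rwa [← lin_coe] at this

theorem GoodCoord.lin_vtx' {j : ℕ} (hj : j < e) : lin D j (vtx D j) = 0 := by
  have := h.lin_vtx ⟨j, hj⟩; rwa [← lin_coe, ← vtx_coe] at this

theorem GoodCoord.lin_vtx_ne' {j k : ℕ} (hj : j < e) (hk : k < e) (hjk : j ≠ k) :
    lin D j (vtx D k) ≠ 0 := by
  have := h.lin_vtx_ne ⟨j, hj⟩ ⟨k, hk⟩ (by simpa using hjk)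
  rwa [← lin_coe, ← vtx_coe] at this

theorem GoodCoord.inv' {j : ℕ} (hj : j < e) : ConeInv (lin D j) (vtx D j) (eqn D j).1 := by
  have := h.inv ⟨j, hj⟩; rwa [← lin_coe, ← vtx_coe, ← eqn_coe] at this

theorem GoodCoord.smooth' {j : ℕ} (hj : j < e) : ConeSmooth (lin D j) (vtx D j) (eqn D j).1 := by
  have := h.smooth ⟨j, hj⟩; rwa [← lin_coe, ← vtx_coe, ← eqn_coe] at this

theorem GoodCoord.prodForms_ne_zero {k : ℕ} (hk : k ≤ e) : prodForms (lin D) k ≠ 0 :=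
  Finset.prod_ne_zero_iff.2 fun j hj =>
    linForm_ne_zero (h.lin_ne' (by have := Finset.mem_range.1 hj; omega))

/-- The product of the equations of the other hyperplanes is a nonzerodivisor on a hyperplane. -/
theorem GoodCoord.linForm_dvd_of_dvd_prodForms_mul {k : ℕ} (hk : k < e)
    {G : MvPolynomial (Fin (N + 1)) ℂ} (hG : linForm (lin D k) ∣ prodForms (lin D) k * G) :
    linForm (lin D k) ∣ G := by
  obtain ⟨Q, hQ⟩ := hG
  refine ⟨divSeq (lin D) (vtx D k) k Q, ?_⟩
  rw [← divSeq_linForm_mul _ _ _ (h.lin_vtx' hk), ← hQ,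
    divSeq_prodForms_mul fun j hj => h.lin_vtx_ne' (by omega) hk (by omega)]

end

theorem eval_prodForms_lin (D : ConfigCoord N d e) (k : Fin e) (x : Vec N) :
    eval x (prodForms (lin D) k) = ∏ j ∈ Finset.univ.filter (· < k), (D j).1 x := by
  rw [eval_prodForms, ← Nat.Iio_eq_range, ← Fin.map_valEmbedding_Iio, Finset.prod_map]
  have : Finset.univ.filter (· < k) = Finset.Iio k := by ext; simp
  rw [this]
  exact Finset.prod_congr rfl fun j _ => by rw [Fin.valEmbedding_apply, lin_coe]

/-- The equation of a hyperplane is unique up to a scalar, so one choice of equations suffices.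
Requiring the product rather than `G` to be homogeneous of degree `d` also covers `k > d`, where it
forces `G = 0`. -/
theorem ConfigRel.mem_fixedSys_iff {D : ConfigCoord N d e} {L : Config N d e} (h : ConfigRel D L)
    (k : Fin e) {φ : (L.1 k).hyp → ℂ} : φ ∈ fixedSys L k ↔
      ∃ G, (prodForms (lin D) k * G).IsHomogeneous d ∧
        φ = restr (L.1 k).hyp (prodForms (lin D) k * G) := by
  have hM := prodForms_isHomogeneous (lin D) k
  have hM0 := h.good.prodForms_ne_zero k.2.le
  by_cases hk : k.1 ≤ d
  · rw [fixedSys, if_pos hk]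
    constructor
    · intro hφ
      induction hφ using Submodule.span_induction with
      | mem φ hφ =>
        obtain ⟨l, hl, _, ⟨G, hG, rfl⟩, rfl⟩ := hφ
        have : ∀ j, ∃ a : ℂ, a • (D j).1 = l j := by
          intro j
          have hle : LinearMap.ker (D j).1 ≤ LinearMap.ker (l j) := by
            rw [← (h j).1]
            exact hl j
          have := (mem_span_of_iInf_ker_le_ker (ι := Unit) (L := fun _ => (D j).1) (K := l j)
            (by simpa using hle))
          simpa [Submodule.mem_span_singleton] using this
        choose a ha using this
        refine ⟨C (∏ j ∈ Finset.univ.filter (· < k), a j) * G, ?_, ?_⟩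
        · have := hM.mul (IsHomogeneous.C_mul hG (∏ j ∈ Finset.univ.filter (· < k), a j))
          rwa [Nat.add_sub_cancel' hk] at this
        · ext x
          simp only [restr, LinearMap.coe_mk, AddHom.coe_mk, map_mul, eval_prodForms_lin, eval_C,
            ← ha, LinearMap.smul_apply, smul_eq_mul, Finset.prod_mul_distrib]
          ring
      | zero => exact ⟨0, by simpa using isHomogeneous_zero _ _ _, by simp⟩
      | add φ ψ _ _ hφ hψ =>
        obtain ⟨G, hG, rfl⟩ := hφ
        obtain ⟨G', hG', rfl⟩ := hψ
        exact ⟨G + G', by rw [mul_add]; exact hG.add hG', by rw [mul_add, map_add]⟩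
      | smul a φ _ hφ =>
        obtain ⟨G, hG, rfl⟩ := hφ
        have : prodForms (lin D) k * C a * G = C a * (prodForms (lin D) k * G) := by ring
        refine ⟨C a * G, ?_, ?_⟩
        · rw [← mul_assoc, this]
          exact hG.C_mul a
        · rw [← map_smul, ← mul_assoc, this, smul_eq_C_mul]
    · rintro ⟨G, hG, rfl⟩
      refine Submodule.subset_span ⟨fun j => (D j).1, fun j => (h j).1.le, _,
        ⟨G, isHomogeneous_right_of_mul hM hM0 hG, rfl⟩, ?_⟩
      ext x
      simp [restr, eval_prodForms_lin]
  · rw [fixedSys, if_neg hk, Submodule.mem_bot]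
    constructor
    · rintro rfl
      exact ⟨0, by simpa using isHomogeneous_zero _ _ _, by simp⟩
    · rintro ⟨G, hG, rfl⟩
      rw [eq_zero_of_mul_isHomogeneous hM hM0 hG (not_le.1 hk)]
      simp

theorem finrank_eq_sysDim (hN : 1 ≤ N) {k : ℕ} (hk : k ≤ d) :
    Module.finrank ℂ (homogeneousSubmodule (Fin N) ℂ (d - k)) = sysDim N d (k + 1) := by
  rw [finrank_homogeneousSubmodule hN, sysDim, if_pos (by omega)]
  congr 1
  omega

/-- Forms that restrict to a basis of the fixed part of the linear system with number `k`, if the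
kernel of `ρ` is not contained in the hyperplane with this number. -/
noncomputable def fixedForm (hN : 1 ≤ N) (l : ℕ → Module.Dual ℂ (Vec N))
    (ρ : Vec N →ₗ[ℂ] (Fin N → ℂ)) (k : ℕ) (m : Fin (sysDim N d (k + 1))) : Form N d :=
  if hk : k ≤ d then
    ⟨prodForms l k * linSubst ρ (Module.finBasisOfFinrankEq ℂ _ (finrank_eq_sysDim hN hk) m).1, by
      have := (prodForms_isHomogeneous l k).mul (linSubst_isHomogeneous ρ
        (Module.finBasisOfFinrankEq ℂ _ (finrank_eq_sysDim hN hk) m).2)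
      rwa [Nat.add_sub_cancel' hk] at this⟩
  else 0

/-- The map `ρ` identifies Π_k with ℂ^N, and multiplication by the product of the previous equations
is injective on Π_k. So a fixed basis of forms on ℂ^N yields a basis of the fixed part. -/
theorem ConfigRel.linearIndependent_fixedForm (hN : 1 ≤ N) {D : ConfigCoord N d e}
    {L : Config N d e} (h : ConfigRel D L) (k : Fin e) {ρ : Vec N →ₗ[ℂ] (Fin N → ℂ)}
    (hρ : ∀ x, lin D k x = 0 → ρ x = 0 → x = 0) :
    LinearIndependent ℂ (fun m => restr (L.1 k).hyp (fixedForm (d := d) hN (lin D) ρ k m)) ∧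
    Submodule.span ℂ (Set.range fun m =>
      restr (L.1 k).hyp (fixedForm (d := d) hN (lin D) ρ k m)) = fixedSys L k := by
  have hl := h.good.lin_ne' k.2
  have hH : (L.1 k).hyp = LinearMap.ker (lin D k) := by rw [lin_coe]; exact (h k).1
  by_cases hk : k.1 ≤ d
  · have heq : (fun m => restr (L.1 k).hyp (fixedForm (d := d) hN (lin D) ρ k m)) =
        restrMul (L.1 k).hyp ρ (d - k) (prodForms (lin D) k) ∘
          Module.finBasisOfFinrankEq ℂ _ (finrank_eq_sysDim hN hk) := by
      ext1 m
      rw [fixedForm, dif_pos hk]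
      rfl
    rw [heq]
    constructor
    · refine LinearIndependent.map' (Module.Basis.linearIndependent _) _
        (LinearMap.ker_eq_bot'.2 fun p hp => ?_)
      rw [restrMul_apply, restr_eq_zero_iff hH hl] at hp
      obtain ⟨Q, hQ⟩ := h.good.linForm_dvd_of_dvd_prodForms_mul k.2 hp
      refine Subtype.ext (eq_zero_of_restr_linSubst hl hρ fun x hx => ?_)
      rw [hQ, map_mul, eval_linForm, hx, zero_mul]
    · rw [Set.range_comp, Submodule.span_image, Module.Basis.span_eq, Submodule.map_top]
      ext φ
      rw [h.mem_fixedSys_iff k, LinearMap.mem_range]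
      constructor
      · rintro ⟨p, rfl⟩
        refine ⟨_, ?_, restrMul_apply _ _ _ _ _⟩
        have := (prodForms_isHomogeneous (lin D) k).mul (linSubst_isHomogeneous ρ p.2)
        rwa [Nat.add_sub_cancel' hk] at this
      · rintro ⟨G, hG, rfl⟩
        obtain ⟨p, hp, hpG⟩ := exists_linSubst_eq hl hρ (isHomogeneous_right_of_mul
          (prodForms_isHomogeneous (lin D) k) (h.good.prodForms_ne_zero k.2.le) hG)
        refine ⟨⟨p, hp⟩, ?_⟩
        ext x
        simp only [restrMul_apply, restr, LinearMap.coe_mk, AddHom.coe_mk, map_mul,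
          hpG x (hH.le x.2)]
  · have h0 : sysDim N d (k + 1) = 0 := if_neg (by omega)
    have : IsEmpty (Fin (sysDim N d (k + 1))) := by rw [h0]; infer_instance
    refine ⟨linearIndependent_empty_type, ?_⟩
    rw [Set.range_eq_empty, Submodule.span_empty, fixedSys, if_neg hk]

/-- `ρ` and `w` are chosen at `D` but serve all coordinates near it; this makes the basis of the
fixed part vary algebraically. -/
theorem exists_projection_lin {D : ConfigCoord N d e} (h : GoodCoord D) (k : Fin e) :
    ∃ (ρ : Vec N →ₗ[ℂ] (Fin N → ℂ)) (w : Vec N), lin D k w ≠ 0 ∧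
      ∀ D' : ConfigCoord N d e, lin D' k w ≠ 0 → ∀ x, lin D' k x = 0 → ρ x = 0 → x = 0 := by
  obtain ⟨w, hw⟩ : ∃ w, lin D k w ≠ 0 := by
    by_contra! h0
    exact h.lin_ne' k.2 (LinearMap.ext h0)
  obtain ⟨ρ, hρ⟩ := exists_projection (w := w) (by rintro rfl; simp at hw)
  exact ⟨ρ, w, hw, fun D' => hρ (lin D' k)⟩

theorem finrank_fixedSys (hN : 1 ≤ N) (L : Config N d e) (k : Fin e) :
    Module.finrank ℂ (fixedSys L k) = sysDim N d (k + 1) := by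
  obtain ⟨D, h⟩ := exists_configRel L
  obtain ⟨ρ, w, hw, hρ⟩ := exists_projection_lin h.good k
  obtain ⟨h1, h2⟩ := h.linearIndependent_fixedForm hN k (hρ D hw)
  rw [← h2, finrank_span_eq_card h1, Fintype.card_fin]

theorem fixedSys_le_formsOn (L : Config N d e) (k : Fin e) :
    fixedSys L k ≤ formsOn (L.1 k).hyp d := by
  obtain ⟨D, h⟩ := exists_configRel L
  intro φ hφ
  obtain ⟨G, hG, rfl⟩ := (h.mem_fixedSys_iff k).1 hφ
  exact ⟨_, hG, rfl⟩

instance (L : Config N d e) (k : Fin e) : Module.Finite ℂ (fixedSys L k) :=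
  Submodule.finiteDimensional_of_le (fixedSys_le_formsOn L k)

end FixedPart


/-! ### Sections of `τ` -/

section Sections

variable {N d e : ℕ}

/-- The coordinates with number `i`, as a linear map. -/
noncomputable def coordProj (i : Fin e) : ConfigCoord N d e →ₗ[ℂ] Module.Dual ℂ (Vec N) × Vec N × Form N d :=
  LinearMap.proj i

theorem mapIn_lin (j : ℕ) : MapIn (polyFun (ConfigCoord N d e)) fun D => lin D j := by
  by_cases hj : j < e
  · simp only [lin, dif_pos hj]
    exact MapIn.linearMap (LinearMap.fst ℂ _ _ ∘ₗ coordProj ⟨j, hj⟩)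
  · simp only [lin, dif_neg hj]
    exact MapIn.const _ _

theorem mapIn_vtx (j : ℕ) : MapIn (polyFun (ConfigCoord N d e)) fun D => vtx D j := by
  by_cases hj : j < e
  · simp only [vtx, dif_pos hj]
    exact MapIn.linearMap (LinearMap.fst ℂ _ _ ∘ₗ LinearMap.snd ℂ _ _ ∘ₗ coordProj ⟨j, hj⟩)
  · simp only [vtx, dif_neg hj]
    exact MapIn.const _ _

theorem mapIn_eqn (j : ℕ) : MapIn (polyFun (ConfigCoord N d e)) fun D => eqn D j := by
  by_cases hj : j < e
  · simp only [eqn, dif_pos hj]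
    exact MapIn.linearMap (LinearMap.snd ℂ _ _ ∘ₗ LinearMap.snd ℂ _ _ ∘ₗ coordProj ⟨j, hj⟩)
  · simp only [eqn, dif_neg hj]
    exact MapIn.const _ _

theorem lin_apply_mem (j : ℕ) (x : Vec N) :
    (fun D : ConfigCoord N d e => lin D j x) ∈ polyFun (ConfigCoord N d e) :=
  mapIn_lin j (Module.Dual.eval ℂ (Vec N) x)

theorem mapIn_fixedForm (hN : 1 ≤ N) (ρ : Vec N →ₗ[ℂ] (Fin N → ℂ)) (k : ℕ)
    (m : Fin (sysDim N d (k + 1))) :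
    MapIn (polyFun (ConfigCoord N d e)) fun D => fixedForm (d := d) hN (lin D) ρ k m := by
  by_cases hk : k ≤ d
  · simp only [fixedForm, dif_pos hk]
    exact CoeffIn.mapIn ((coeffIn_prodForms fun j _ => lin_apply_mem j).mul (CoeffIn.const _))
  · simp only [fixedForm, dif_neg hk]
    exact MapIn.const _ _

/-- The point of `𝒢^e` over `L` whose linear systems are spanned by the fixed parts and one further
form each. -/
noncomputable def mkG (hN : 1 ≤ N) (L : Config N d e) (g : ∀ k : Idx e, (L.1 k.1).hyp → ℂ)
    (hg : ∀ k, g k ∈ formsOn (L.1 k.1).hyp d) (hg' : ∀ k, g k ∉ fixedSys L k.1) : GSpace N d e where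
  conf := L
  sys k := Submodule.span ℂ {g k} ⊔ fixedSys L k.1
  sys_le k := sup_le ((Submodule.span_singleton_le_iff_mem _ _).2 (hg k)) (fixedSys_le_formsOn L k.1)
  sys_rank k := by
    have h0 : g k ≠ 0 := fun h => hg' k (h ▸ zero_mem _)
    have hdisj : Submodule.span ℂ {g k} ⊓ fixedSys L k.1 = ⊥ :=
      disjoint_iff.1 ((Submodule.disjoint_span_singleton' h0).2 (hg' k)).symm
    have h1 := Submodule.finrank_sup_add_finrank_inf_eq (Submodule.span ℂ {g k}) (fixedSys L k.1)
    rw [hdisj, finrank_bot, finrank_span_singleton h0, finrank_fixedSys hN] at h1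
    omega
  fixedSys_le k := le_sup_right

theorem mem_sys_mkG {hN : 1 ≤ N} {L : Config N d e} {g : ∀ k : Idx e, (L.1 k.1).hyp → ℂ} {h₁ h₂}
    (k : Idx e) : g k ∈ (mkG hN L g h₁ h₂).sys k :=
  Submodule.mem_sup_left (S := Submodule.span ℂ {g k}) (Submodule.mem_span_singleton_self (g k))

theorem mkG_eq_iff {hN : 1 ≤ N} {L : Config N d e} {g g' : ∀ k : Idx e, (L.1 k.1).hyp → ℂ} {h₁ h₂}
    {h₁' h₂'} : mkG hN L g h₁ h₂ = mkG hN L g' h₁' h₂' ↔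
      ∀ k, Submodule.span ℂ {g k} ⊔ fixedSys L k.1 = Submodule.span ℂ {g' k} ⊔ fixedSys L k.1 := by
  rw [mkG, mkG, GSpace.mk.injEq, heq_eq_eq, funext_iff]
  simp

theorem gRel_mkG (hN : 1 ≤ N) {D : ConfigCoord N d e} {L : Config N d e} (hD : ConfigRel D L)
    {g : ∀ k : Idx e, (L.1 k.1).hyp → ℂ} {h₁ h₂} {G : Idx e → Form N d}
    (hG : ∀ k, Submodule.span ℂ {g k} ⊔ fixedSys L k.1 =
      Submodule.span ℂ {restr (L.1 k.1).hyp (G k)} ⊔ fixedSys L k.1)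
    {ρ : Idx e → Vec N →ₗ[ℂ] (Fin N → ℂ)}
    (hρ : ∀ (k : Idx e) x, lin D k.1 x = 0 → ρ k x = 0 → x = 0) :
    GRel (D, fun k => Fin.cons (G k) (fixedForm (d := d) hN (lin D) (ρ k) k.1))
      (mkG hN L g h₁ h₂) := by
  refine ⟨hD, fun k => ?_⟩
  have h1 := (hD.linearIndependent_fixedForm hN k.1 (hρ k)).2
  have h2 : (fun m => restr (L.1 k.1).hyp ((Fin.cons (G k)
      (fixedForm (d := d) hN (lin D) (ρ k) k.1) : Fin _ → Form N d) m).1) =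
      Fin.cons (restr (L.1 k.1).hyp (G k))
        (fun m => restr (L.1 k.1).hyp (fixedForm (d := d) hN (lin D) (ρ k) k.1 m)) := by
    ext1 m
    induction m using Fin.cases with
    | zero => rfl
    | succ m => rfl
  change Submodule.span ℂ {g k} ⊔ fixedSys L k.1 = Submodule.span ℂ (Set.range
    fun m => restr (L.1 k.1).hyp ((Fin.cons (G k)
      (fixedForm (d := d) hN (lin D) (ρ k) k.1) : Fin _ → Form N d) m).1)
  rw [h2, Fin.range_cons, Submodule.span_insert, h1]
  exact hG k

theorem isSection_mkG (hN : 1 ≤ N) {g : ∀ (L : Config N d e) (k : Idx e), (L.1 k.1).hyp → ℂ}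
    {h₁ : ∀ L k, g L k ∈ formsOn (L.1 k.1).hyp d} {h₂ : ∀ L k, g L k ∉ fixedSys L k.1}
    (H : ∀ D₀ L₀, ConfigRel D₀ L₀ → ∃ G : Idx e → ConfigCoord N d e → Form N d,
      (∀ k, MapIn (ratAt D₀) (G k)) ∧ ∀ D L, ConfigRel D L → ∀ k,
        Submodule.span ℂ {g L k} ⊔ fixedSys L k.1 =
          Submodule.span ℂ {restr (L.1 k.1).hyp (G k D)} ⊔ fixedSys L k.1) :
    IsSection fun L => mkG hN L (g L) (h₁ L) (h₂ L) := by
  refine ⟨isRegularOn_of_mapIn fun D₀ L₀ _ h => ?_, fun L => rfl⟩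
  obtain ⟨G, hG, hspan⟩ := H D₀ L₀ h
  choose ρ w hw hρ using fun k : Idx e => exists_projection_lin h.good k.1
  refine ⟨fun D => (D, fun k => Fin.cons (G k D) (fixedForm (d := d) hN (lin D) (ρ k) k.1)), ?_,
    fun D => ∏ k : Idx e, lin D k.1 (w k), prod_mem_subalgebra _ fun k _ => lin_apply_mem _ _,
    Finset.prod_ne_zero_iff.2 fun k _ => hw k, fun D L _ hD hne => gRel_mkG hN hD (hspan D L hD)
      fun k => hρ k D (Finset.prod_ne_zero_iff.1 hne k (Finset.mem_univ k))⟩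
  refine (MapIn.id.mono (polyFun_le_ratAt _)).prodMk (MapIn.pi fun k => MapIn.pi fun m => ?_)
  induction m using Fin.cases with
  | zero => exact hG k
  | succ m => exact (mapIn_fixedForm hN (ρ k) k.1 m).mono (polyFun_le_ratAt _)

/-- The factor which makes the equation of the cone with number `j` compatible with that of the
first cone, if this is possible. -/
noncomputable def ratio (D : ConfigCoord N d e) (j : ℕ) : ℂ :=
  if j = 0 then 1 else
    coneRatio (lin D j) (vtx D j) (lin D 0) (vtx D 0) (eqn D 0) (eqn D j)

/-- The interpolating form of the first `k + 1` cones. -/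
noncomputable def interp (D : ConfigCoord N d e) (k : ℕ) : Form N d :=
  ⟨newton (lin D) (vtx D) (fun j => C (ratio D j) * (eqn D j).1) k,
    newton_isHomogeneous (fun j => IsHomogeneous.C_mul (eqn D j).2 _) k⟩

section

variable {D : ConfigCoord N d e} (h : GoodCoord D)
include h

/-- A point of Π_j where f_j does not vanish is translated along P_j into Π_i, without changing the
value of f_j. -/
theorem GoodCoord.exists_eval_eqn_ne_zero (hN : 2 ≤ N) {i j : ℕ} (hi : i < e) (hj : j < e)
    (hij : i ≠ j) : ∃ x, lin D i x = 0 ∧ lin D j x = 0 ∧ eval x (eqn D j).1 ≠ 0 := by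
  obtain ⟨y, hy, hy0⟩ := (h.smooth' hj).exists_eval_ne_zero hN
  have hP := h.lin_vtx_ne' hi hj hij
  refine ⟨y + (-(lin D i y / lin D i (vtx D j))) • vtx D j, ?_, ?_, ?_⟩
  · simp [hP]
  · simp [hy, h.lin_vtx' hj]
  · rwa [h.inv' hj y hy]

theorem GoodCoord.disc_ne_zero (hd : 2 ≤ d) {j : ℕ} (hj : j < e) (hj0 : j ≠ 0) :
    disc N d (coneForm (lin D j) (vtx D j) (lin D 0) (vtx D 0) (eqn D j) 1 1 1) ≠ 0 :=
  disc_coneForm_ne_zero hd (h.lin_vtx' hj) (h.lin_vtx' (by omega))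
    (h.lin_vtx_ne' hj (by omega) hj0) (h.lin_vtx_ne' (by omega) hj hj0.symm) (h.inv' hj)
    (h.smooth' hj)

theorem GoodCoord.ratio_eq (hN : 2 ≤ N) (hd : 2 ≤ d) {j : ℕ} (hj : j < e) (hj0 : j ≠ 0) {μ : ℂ}
    (hμ : ∀ x, lin D j x = 0 → lin D 0 x = 0 → eval x (eqn D 0).1 = μ * eval x (eqn D j).1) :
    ratio D j = μ := by
  rw [ratio, if_neg hj0]
  exact coneRatio_eq hN hd (h.lin_vtx' hj) (h.lin_vtx' (by omega))
    (h.lin_vtx_ne' hj (by omega) hj0) (h.lin_vtx_ne' (by omega) hj hj0.symm)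
    (h.disc_ne_zero hd hj hj0) hμ

theorem GoodCoord.mapIn_interp (hN : 2 ≤ N) (hd : 2 ≤ d) {k : ℕ} (hk : k < e) :
    MapIn (ratAt D) fun D' => interp D' k := by
  have hl := fun j => (mapIn_lin (N := N) (d := d) (e := e) j).mono (polyFun_le_ratAt D)
  have hP := fun j => (mapIn_vtx (N := N) (d := d) (e := e) j).mono (polyFun_le_ratAt D)
  have hf := fun j => (mapIn_eqn (N := N) (d := d) (e := e) j).mono (polyFun_le_ratAt D)
  refine CoeffIn.mapIn (coeffIn_newton (e := e) (d := d)
    (l := fun j D' => lin D' j) (P := fun j D' => vtx D' j)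
    (c := fun j D' => C (ratio D' j) * (eqn D' j).1)
    (fun j x => polyFun_le_ratAt D (lin_apply_mem j x)) (fun k i => hP k (LinearMap.proj i))
    (fun j k => (hl j).dual_apply (hP k)) (fun j hj k hk hjk => h.lin_vtx_ne' hj hk hjk)
    (fun j hj => (CoeffIn.scalar ?_).mul (hf j).coeffIn)
    (fun j D' => IsHomogeneous.C_mul (eqn D' j).2 _) hk)
  by_cases hj0 : j = 0
  · simp only [ratio, if_pos hj0]
    exact const_mem_subalgebra _ 1
  · simp only [ratio, if_neg hj0]
    exact coneRatio_mem_ratAt hd (hl j) (hl 0) (hP j) (hP 0) (hf 0) (hf j)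
      (discDeriv_coneForm_self_ne_zero hd (h.lin_vtx' hj) (h.lin_vtx' (by omega))
        (h.lin_vtx_ne' hj (by omega) hj0) (h.lin_vtx_ne' (by omega) hj (Ne.symm hj0)) hN _
        (h.disc_ne_zero hd hj hj0))

end

theorem eval_interp (D : ConfigCoord N d e) (k : ℕ) {x : Vec N} (hx : lin D 0 x = 0) :
    eval x (interp D k).1 = eval x (eqn D 0).1 := by
  obtain ⟨G, hG⟩ := linForm_dvd_newton_sub (l := lin D) (P := vtx D)
    (c := fun j => C (ratio D j) * (eqn D j).1) k
  have := congrArg (eval x) hG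
  rw [map_mul, eval_linForm, hx, zero_mul, map_sub, sub_eq_zero] at this
  rw [interp, this]
  simp [ratio]

theorem ConfigRel.hyp_eq {D : ConfigCoord N d e} {L : Config N d e} (h : ConfigRel D L)
    (k : Fin e) : (L.1 k).hyp = LinearMap.ker (lin D k) := by
  rw [lin_coe]
  exact (h k).1

theorem ConfigRel.cone_eq {D : ConfigCoord N d e} {L : Config N d e} (h : ConfigRel D L)
    (k : Fin e) : (L.1 k).cone = Submodule.span ℂ {restr (L.1 k).hyp (eqn D k)} := by
  rw [eqn_coe]
  exact (h k).2.2

/-- A form that does not vanish on the intersection of the first hyperplane with another one does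
not belong to the fixed part of the linear system on the latter. -/
theorem ConfigRel.notMem_fixedSys {D : ConfigCoord N d e} {L : Config N d e} (h : ConfigRel D L)
    (k : Idx e) {F : MvPolynomial (Fin (N + 1)) ℂ} {x : Vec N} (hx : lin D 0 x = 0)
    (hxk : lin D k.1 x = 0) (hF : eval x F ≠ 0) : restr (L.1 k.1).hyp F ∉ fixedSys L k.1 := by
  intro hmem
  obtain ⟨G, -, hG⟩ := (h.mem_fixedSys_iff k.1).1 hmem
  have hx' : x ∈ (L.1 k.1).hyp := by
    rw [h.hyp_eq]
    exact hxk
  have := congrFun hG ⟨x, hx'⟩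
  obtain ⟨Q, hQ⟩ := linForm_dvd_prodForms (lin D) k.2
  refine hF (this.trans ?_)
  change eval x _ = 0
  rw [hQ, map_mul, map_mul, eval_linForm, hx, zero_mul, zero_mul]

theorem Idx.pos (k : Idx e) : 0 < e := (Nat.zero_le _).trans_lt k.1.2

theorem ConfigRel.eqn_notMem_fixedSys (hN : 2 ≤ N) {D : ConfigCoord N d e} {L : Config N d e}
    (h : ConfigRel D L) (k : Idx e) : restr (L.1 k.1).hyp (eqn D k.1) ∉ fixedSys L k.1 := by
  obtain ⟨x, hx0, hxk, hx⟩ := h.good.exists_eval_eqn_ne_zero hN k.pos k.1.2 k.2.ne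
  exact h.notMem_fixedSys k hx0 hxk hx

theorem ConfigRel.interp_notMem_fixedSys (hN : 2 ≤ N) {D : ConfigCoord N d e} {L : Config N d e}
    (h : ConfigRel D L) (k : Idx e) :
    restr (L.1 k.1).hyp (interp D (k.1 - 1)) ∉ fixedSys L k.1 := by
  obtain ⟨x, hxk, hx0, hx⟩ := h.good.exists_eval_eqn_ne_zero hN k.1.2 k.pos k.2.ne'
  refine h.notMem_fixedSys k hx0 hxk ?_
  rwa [eval_interp D _ hx0]

/-- The interpolating forms in two systems of coordinates of the same configuration. -/
theorem ConfigRel.exists_interp_sub (hd : 2 ≤ d) {D D' : ConfigCoord N d e}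
    {L : Config N d e} (h : ConfigRel D L) (h' : ConfigRel D' L) (he : 0 < e) :
    ∃ u : ℂ, u ≠ 0 ∧ ∀ k < e, prodForms (lin D) (k + 1) ∣
      (interp D' k).1 - C u * (interp D k).1 := by
  choose s t u hs ht hu hl hP hf using h.exists_scale h'
  -- Extended by 1, so that the scaling factors are nonzero for all indices.
  let ext : (Fin e → ℂ) → ℕ → ℂ := fun v j => if hj : j < e then v ⟨j, hj⟩ else 1
  have hext : ∀ {v : Fin e → ℂ}, (∀ i, v i ≠ 0) → ∀ j, ext v j ≠ 0 := by
    intro v hv j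
    simp only [ext]
    split_ifs
    · exact hv _
    · exact one_ne_zero
  have hl' : lin D' = fun j => ext s j • lin D j := by
    ext1 j
    by_cases hj : j < e <;> simp [lin, ext, hj, hl]
  have hP' : vtx D' = fun j => ext t j • vtx D j := by
    ext1 j
    by_cases hj : j < e <;> simp [vtx, ext, hj, hP]
  have hf' : ∀ j < e, linForm (lin D j) ∣ (eqn D' j).1 - C (ext u j) * (eqn D j).1 := by
    intro j hj
    have := hf ⟨j, hj⟩
    simpa [lin, eqn, ext, hj] using this
  have hfx : ∀ j < e, ∀ x, lin D j x = 0 →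
      eval x (eqn D' j).1 = ext u j * eval x (eqn D j).1 := by
    intro j hj x hx
    obtain ⟨G, hG⟩ := hf' j hj
    have := congrArg (eval x) hG
    rw [map_mul, eval_linForm, hx, zero_mul, map_sub, sub_eq_zero, map_mul, eval_C] at this
    exact this
  have hratio : ∀ j < e, ratio D' j * ext u j = ext u 0 * ratio D j := by
    intro j hj
    by_cases hj0 : j = 0
    · simp [ratio, hj0]
    · rw [ratio, ratio, if_neg hj0, if_neg hj0, hl', hP']
      exact coneRatio_scale hd (h.good.lin_vtx' hj) (h.good.lin_vtx' he)
        (h.good.lin_vtx_ne' hj he hj0) (h.good.lin_vtx_ne' he hj (Ne.symm hj0))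
        (h.good.disc_ne_zero hd hj hj0) (hext hs j) (hext hs 0) (hext ht j) (hext ht 0) (hext hu j)
        (hfx j hj) (hfx 0 he)
  refine ⟨ext u 0, hext hu 0, fun k hk => ?_⟩
  simp only [interp, hl', hP']
  refine prodForms_dvd_newton_sub (e := e) (fun j hj k hk => h.good.lin_vtx_ne' hj hk)
    (fun k hk => h.good.lin_vtx' hk) (fun k _ => hext hs k) (fun k _ => hext ht k)
    (fun j hj => ?_) hk
  have : C (ratio D' j) * (eqn D' j).1 - C (ext u 0) * (C (ratio D j) * (eqn D j).1) =
      C (ratio D' j) * ((eqn D' j).1 - C (ext u j) * (eqn D j).1) := by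
    rw [← mul_assoc, ← C_mul, ← hratio j hj, C_mul]
    ring
  rw [this]
  exact (hf' j hj).mul_left _

/-- This makes the second section well defined: in two systems of coordinates the interpolating
forms agree up to a scalar and a multiple of l_0⋯l_{k-1}, which lies in the fixed part. The index is
`k - 1` because `interp D (k - 1)` interpolates exactly the `k` cones before Π_k. -/
theorem ConfigRel.span_interp_eq (hd : 2 ≤ d) {D D' : ConfigCoord N d e} {L : Config N d e}
    (h : ConfigRel D L) (h' : ConfigRel D' L) (k : Idx e) :
    Submodule.span ℂ {restr (L.1 k.1).hyp (interp D' (k.1 - 1))} ⊔ fixedSys L k.1 =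
      Submodule.span ℂ {restr (L.1 k.1).hyp (interp D (k.1 - 1))} ⊔ fixedSys L k.1 := by
  have hle : ∀ {D D' : ConfigCoord N d e}, ConfigRel D L → ConfigRel D' L →
      Submodule.span ℂ {restr (L.1 k.1).hyp (interp D' (k.1 - 1))} ⊔ fixedSys L k.1 ≤
      Submodule.span ℂ {restr (L.1 k.1).hyp (interp D (k.1 - 1))} ⊔ fixedSys L k.1 := by
    intro D D' h h'
    refine sup_le ((Submodule.span_singleton_le_iff_mem _ _).2 ?_) le_sup_right
    obtain ⟨u, -, hu⟩ := h.exists_interp_sub hd h' k.pos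
    have hk := k.1.2
    have hk0 := k.2
    obtain ⟨G, hG⟩ := hu (k.1 - 1) (by omega)
    rw [Nat.sub_add_cancel hk0] at hG
    have hsub : restr (L.1 k.1).hyp (interp D' (k.1 - 1)) =
        u • restr (L.1 k.1).hyp (interp D (k.1 - 1)) +
          restr (L.1 k.1).hyp (prodForms (lin D) k.1 * G) := by
      rw [← hG, ← map_smul, ← map_add, smul_eq_C_mul]
      congr 1
      ring
    rw [hsub]
    refine Submodule.add_mem_sup (Submodule.smul_mem _ _ (Submodule.mem_span_singleton_self _))
      ((h.mem_fixedSys_iff k.1).2 ⟨G, ?_, rfl⟩)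
    rw [← hG]
    exact IsHomogeneous.sub (interp D' _).2 (IsHomogeneous.C_mul (interp D _).2 u)
  exact le_antisymm (hle h h') (hle h' h)

/-- A system of coordinates of a configuration. -/
noncomputable def coords (L : Config N d e) : ConfigCoord N d e := (exists_configRel L).choose

theorem configRel_coords (L : Config N d e) : ConfigRel (coords L) L :=
  (exists_configRel L).choose_spec

/-- The section whose linear systems are spanned by the fixed parts and the cones. -/
noncomputable def coneSection (hN : 2 ≤ N) (L : Config N d e) : GSpace N d e :=
  mkG (by omega) L (fun k => restr (L.1 k.1).hyp (eqn (coords L) k.1))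
    (fun k => ⟨_, (eqn (coords L) k.1).2, rfl⟩)
    (fun k => (configRel_coords L).eqn_notMem_fixedSys hN k)

/-- The section whose linear systems are spanned by the fixed parts and the interpolating forms. -/
noncomputable def interpSection (hN : 2 ≤ N) (L : Config N d e) : GSpace N d e :=
  mkG (by omega) L (fun k => restr (L.1 k.1).hyp (interp (coords L) (k.1 - 1)))
    (fun k => ⟨_, (interp (coords L) (k.1 - 1)).2, rfl⟩)
    (fun k => (configRel_coords L).interp_notMem_fixedSys hN k)

theorem isSection_coneSection (hN : 2 ≤ N) : IsSection (coneSection (d := d) (e := e) hN) := by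
  refine isSection_mkG _ fun D₀ L₀ h₀ => ⟨fun k D => eqn D k.1,
    fun k => (mapIn_eqn _).mono (polyFun_le_ratAt _), fun D L h k => ?_⟩
  rw [← (configRel_coords L).cone_eq, ← h.cone_eq]

theorem isSection_interpSection (hN : 2 ≤ N) (hd : 2 ≤ d) :
    IsSection (interpSection (d := d) (e := e) hN) := by
  refine isSection_mkG _ fun D₀ L₀ h₀ => ⟨fun k D => interp D (k.1 - 1),
    fun k => h₀.good.mapIn_interp hN hd (by have := k.1.2; omega), fun D L h k => ?_⟩
  exact h.span_interp_eq hd (configRel_coords L) k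

/-- If the two sections agree at a configuration, then the interpolating form cuts out its cones. -/
theorem ConfigRel.linForm_dvd_interp_sub (hN : 2 ≤ N) (hd : 2 ≤ d) {D : ConfigCoord N d e}
    {L : Config N d e} (h : ConfigRel D L) (hL : coneSection hN L = interpSection hN L) {j : ℕ}
    (hj : j < e) : ratio D j ≠ 0 ∧
      linForm (lin D j) ∣ (interp D (e - 1)).1 - C (ratio D j) * (eqn D j).1 := by
  have he : 0 < e := by omega
  have key : ∀ k : Idx e, ∃ G, linForm (lin D k.1) ∣
      C (ratio D k.1) * (eqn D k.1).1 - (interp D (k.1 - 1)).1 - prodForms (lin D) k.1 * G := by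
    intro k
    have hk := (mkG_eq_iff.1 hL) k
    rw [h.span_interp_eq hd (configRel_coords L) k, ← (configRel_coords L).cone_eq,
      h.cone_eq] at hk
    have hmem : restr (L.1 k.1).hyp (interp D (k.1 - 1)) ∈
        Submodule.span ℂ {restr (L.1 k.1).hyp (eqn D k.1)} ⊔ fixedSys L k.1 := by
      rw [hk]
      exact Submodule.mem_sup_left (Submodule.mem_span_singleton_self _)
    obtain ⟨_, hy, z, hz, hyz⟩ := Submodule.mem_sup.1 hmem
    obtain ⟨c, rfl⟩ := Submodule.mem_span_singleton.1 hy
    obtain ⟨G, -, rfl⟩ := (h.mem_fixedSys_iff k.1).1 hz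
    rw [← map_smul, ← map_add, restr_eq_iff (h.hyp_eq k.1) (h.good.lin_ne' k.1.2),
      smul_eq_C_mul] at hyz
    -- On Π_0 ∩ Π_k the fixed part vanishes and the interpolating form equals f_0, so `c` is the
    -- factor relating f_k to f_0.
    have hc : ratio D k.1 = c := by
      refine h.good.ratio_eq hN hd k.1.2 k.2.ne' fun x hxk hx0 => ?_
      obtain ⟨Q, hQ⟩ := hyz
      obtain ⟨Q', hQ'⟩ := linForm_dvd_prodForms (lin D) k.2
      have h1 := congrArg (eval x) hQ
      simp only [hQ', map_sub, map_add, map_mul, eval_linForm, hxk, hx0, zero_mul, add_zero,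
        eval_C, eval_interp D _ hx0] at h1
      exact (sub_eq_zero.1 h1).symm
    refine ⟨-G, ?_⟩
    rw [hc]
    convert hyz using 1
    ring
  have hall := linForm_dvd_newton_sub_of_compatible (l := lin D) (P := vtx D)
    (c := fun j => C (ratio D j) * (eqn D j).1) (e := e)
    (fun j hj k hk => h.good.lin_vtx_ne' hj hk) (fun k hk => h.good.lin_vtx' hk)
    (fun k hk => key ⟨⟨k + 1, hk⟩, Nat.succ_pos k⟩) (k := e - 1) (by omega) (j := j) (by omega)
  refine ⟨?_, hall⟩
  by_cases hj0 : j = 0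
  · simp [ratio, hj0]
  -- A zero ratio would make the interpolating form vanish on Π_j, but on Π_0 ∩ Π_j it equals f_0,
  -- which is not identically zero there.
  · intro hr
    obtain ⟨x, hxj, hx0, hx⟩ := h.good.exists_eval_eqn_ne_zero hN hj he hj0
    obtain ⟨Q, hQ⟩ := hall
    have h1 := congrArg (eval x) hQ
    rw [hr, C_0, zero_mul, sub_zero, map_mul, eval_linForm, hxj, zero_mul] at h1
    exact hx ((eval_interp D (e - 1) hx0).symm.trans h1)

theorem ConfigRel.cone_eq_span_iff {D : ConfigCoord N d e} {L : Config N d e} (h : ConfigRel D L)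
    (k : Fin e) {F : MvPolynomial (Fin (N + 1)) ℂ} :
    (L.1 k).cone = Submodule.span ℂ {restr (L.1 k).hyp F} ↔
      ∃ μ : ℂ, μ ≠ 0 ∧ linForm (lin D k) ∣ F - C μ * (eqn D k).1 := by
  constructor
  · intro hF
    have hmem : restr (L.1 k).hyp F ∈ (L.1 k).cone := by
      rw [hF]
      exact Submodule.mem_span_singleton_self _
    rw [h.cone_eq] at hmem
    obtain ⟨μ, hμ⟩ := Submodule.mem_span_singleton.1 hmem
    refine ⟨μ, ?_, ?_⟩
    · rintro rfl
      have := (L.1 k).cone_rank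
      rw [hF, ← hμ, zero_smul, Submodule.span_zero_singleton, finrank_bot] at this
      omega
    · rw [← restr_eq_iff (h.hyp_eq k) (h.good.lin_ne' k.2), ← hμ, ← smul_eq_C_mul, map_smul]
  · rintro ⟨μ, hμ, hF⟩
    rw [← restr_eq_iff (h.hyp_eq k) (h.good.lin_ne' k.2), ← smul_eq_C_mul, map_smul] at hF
    rw [hF, Submodule.span_singleton_smul_eq (IsUnit.mk0 μ hμ), h.cone_eq]

/-- A form which cuts out the cones agrees with the interpolating forms, up to a scalar. -/
theorem ConfigRel.exists_prodForms_dvd (hN : 2 ≤ N) (hd : 2 ≤ d) {D : ConfigCoord N d e}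
    {L : Config N d e} (h : ConfigRel D L) (he : 0 < e) {F : MvPolynomial (Fin (N + 1)) ℂ}
    (hF : ∀ i, (L.1 i).cone = Submodule.span ℂ {restr (L.1 i).hyp F}) :
    ∃ c : ℂ, c ≠ 0 ∧ ∀ k < e, ratio D k ≠ 0 ∧
      linForm (lin D k) ∣ C c * F - C (ratio D k) * (eqn D k).1 ∧
      prodForms (lin D) (k + 1) ∣ C c * F - (interp D k).1 := by
  choose μ hμ0 hμ using fun k => (h.cone_eq_span_iff k).1 (hF k)
  have hμx : ∀ (k : Fin e) x, lin D k x = 0 → eval x F = μ k * eval x (eqn D k).1 := by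
    intro k x hx
    obtain ⟨G, hG⟩ := hμ k
    have := congrArg (eval x) hG
    rw [map_mul, eval_linForm, hx, zero_mul, map_sub, sub_eq_zero, map_mul, eval_C] at this
    exact this
  have hratio : ∀ k : Fin e, ratio D k = (μ ⟨0, he⟩)⁻¹ * μ k := by
    intro k
    by_cases hk0 : k.1 = 0
    · have : k = ⟨0, he⟩ := Fin.ext hk0
      rw [ratio, if_pos hk0, this, inv_mul_cancel₀ (hμ0 _)]
    · refine h.good.ratio_eq hN hd k.2 hk0 fun x hxk hx0 => ?_
      have h1 := hμx k x hxk
      rw [hμx ⟨0, he⟩ x hx0] at h1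
      rw [mul_assoc, ← h1, ← mul_assoc, inv_mul_cancel₀ (hμ0 _), one_mul]
  have hdvd : ∀ k < e, linForm (lin D k) ∣
      C (μ ⟨0, he⟩)⁻¹ * F - C (ratio D k) * (eqn D k).1 := by
    intro k hk
    have h1 := hratio ⟨k, hk⟩
    simp only at h1
    rw [h1, C_mul, mul_assoc, ← mul_sub]
    exact (hμ ⟨k, hk⟩).mul_left _
  -- Normalizes `F` to equal f_0 on Π_0, in accordance with the convention `ratio D 0 = 1`.
  refine ⟨(μ ⟨0, he⟩)⁻¹, inv_ne_zero (hμ0 _), fun k hk => ⟨?_, hdvd k hk, ?_⟩⟩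
  · have h1 := hratio ⟨k, hk⟩
    simp only at h1
    rw [h1]
    exact mul_ne_zero (inv_ne_zero (hμ0 _)) (hμ0 _)
  · exact prodForms_dvd_sub_newton (fun j hj k hk => h.good.lin_vtx_ne' hj hk)
      (fun k hk => h.good.lin_vtx' hk) hdvd hk

/-- If `F` exists, interpolation is exact up to the product of the equations used, so on Π_k the
cone and the interpolating form differ by an element of the fixed part. Conversely, coincidence of
the sections is precisely the compatibility that makes the last interpolating form cut out every
cone. -/
theorem mem_suitedLocus_iff (hN : 2 ≤ N) (hd : 2 ≤ d) (he : 0 < e) {L : Config N d e} :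
    L ∈ suitedLocus N d e ↔ coneSection hN L = interpSection hN L := by
  obtain ⟨D, h⟩ := exists_configRel L
  constructor
  · rintro ⟨F, hFd, hF⟩
    refine mkG_eq_iff.2 fun k => ?_
    rw [h.span_interp_eq hd (configRel_coords L) k, ← (configRel_coords L).cone_eq, h.cone_eq]
    obtain ⟨c, hc0, hc⟩ := h.exists_prodForms_dvd hN hd he hF
    have hk := k.1.2
    have hk0 := k.2
    obtain ⟨hr0, hr, -⟩ := hc k.1 hk
    obtain ⟨-, -, G, hG⟩ := hc (k.1 - 1) (by omega)
    rw [Nat.sub_add_cancel hk0] at hG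
    have hfix : restr (L.1 k.1).hyp (C c * F) - restr (L.1 k.1).hyp (interp D (k.1 - 1)) ∈
        fixedSys L k.1 := by
      rw [← map_sub, hG]
      refine (h.mem_fixedSys_iff k.1).2 ⟨G, ?_, rfl⟩
      rw [← hG]
      exact IsHomogeneous.sub (hFd.C_mul c) (interp D _).2
    rw [← restr_eq_iff (h.hyp_eq k.1) (h.good.lin_ne' k.1.2)] at hr
    rw [hr, ← smul_eq_C_mul, map_smul] at hfix
    rw [← Submodule.span_singleton_smul_eq (IsUnit.mk0 _ hr0)]
    refine le_antisymm (sup_le ((Submodule.span_singleton_le_iff_mem _ _).2 ?_) le_sup_right)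
      (sup_le ((Submodule.span_singleton_le_iff_mem _ _).2 ?_) le_sup_right)
    · rw [← sub_add_cancel (ratio D k.1 • restr (L.1 k.1).hyp (eqn D k.1).1)
        (restr (L.1 k.1).hyp (interp D (k.1 - 1)).1)]
      exact add_mem (Submodule.mem_sup_right hfix)
        (Submodule.mem_sup_left (Submodule.mem_span_singleton_self _))
    · rw [← sub_sub_cancel (ratio D k.1 • restr (L.1 k.1).hyp (eqn D k.1).1)
        (restr (L.1 k.1).hyp (interp D (k.1 - 1)).1)]
      exact sub_mem (Submodule.mem_sup_left (Submodule.mem_span_singleton_self _))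
        (Submodule.mem_sup_right hfix)
  · intro hL
    refine ⟨(interp D (e - 1)).1, (interp D (e - 1)).2, fun k => (h.cone_eq_span_iff k).2
      ⟨ratio D k, h.linForm_dvd_interp_sub hN hd hL k.2⟩⟩

theorem image_tau_eq {S₁ S₂ : Config N d e → GSpace N d e} (h₁ : IsSection S₁) (h₂ : IsSection S₂) :
    tau '' (Set.range S₁ ∩ Set.range S₂) = {L | S₁ L = S₂ L} := by
  ext L
  constructor
  · rintro ⟨y, ⟨⟨L₁, rfl⟩, L₂, hL₂⟩, rfl⟩
    have h := congrArg tau hL₂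
    rw [h₂.2, h₁.2] at h
    subst h
    change S₁ (tau (S₁ _)) = S₂ (tau (S₁ _))
    rw [h₁.2]
    exact hL₂.symm
  · intro h
    exact ⟨S₁ L, ⟨⟨L, rfl⟩, L, h.symm⟩, h₁.2 L⟩

end Sections


/-! ### Irreducible hypersurfaces -/

section IrreducibleForms

/-- The polynomials that vanish when the first `k` variables are set to zero. -/
noncomputable def truncHom (n k : ℕ) : MvPolynomial (Fin n) ℂ →ₐ[ℂ] MvPolynomial (Fin n) ℂ :=
  aeval fun i => if i.1 < k then 0 else X i

theorem le_height_ker_truncHom {n k : ℕ} (hk : k ≤ n) :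
    (k : ℕ∞) ≤ (RingHom.ker (truncHom n k)).height := by
  induction k with
  | zero => simp
  | succ k ih =>
    have hp : ∀ k, (RingHom.ker (truncHom n k)).IsPrime := fun k => RingHom.ker_isPrime _
    have hlt : RingHom.ker (truncHom n k) < RingHom.ker (truncHom n (k + 1)) := by
      rw [SetLike.lt_iff_le_and_exists]
      constructor
      · have hcomp : (truncHom n (k + 1)).comp (truncHom n k) = truncHom n (k + 1) := by
          refine MvPolynomial.algHom_ext fun i => ?_
          simp only [AlgHom.comp_apply, truncHom, aeval_X]
          by_cases hi : i.1 < k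
          · simp [hi, show i.1 < k + 1 by omega]
          · simp [hi]
        intro F hF
        rw [RingHom.mem_ker] at hF ⊢
        rw [← hcomp, AlgHom.comp_apply, hF, map_zero]
      · refine ⟨X ⟨k, hk⟩, ?_, ?_⟩
        · rw [RingHom.mem_ker]
          simp [truncHom]
        · rw [RingHom.mem_ker]
          simp [truncHom]
    have := Ideal.height_add_one_le_of_lt_of_isPrime hlt
    exact le_trans (by push_cast; exact add_le_add_left (ih (by omega)) 1) this

theorem mem_ker_truncHom_iff {n : ℕ} {F : MvPolynomial (Fin n) ℂ} :
    F ∈ RingHom.ker (truncHom n n) ↔ eval 0 F = 0 := by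
  have : truncHom n n = (Algebra.ofId ℂ (MvPolynomial (Fin n) ℂ)).comp (aeval 0) := by
    refine MvPolynomial.algHom_ext fun i => ?_
    simp [truncHom]
  rw [RingHom.mem_ker, this]
  simp [Algebra.ofId_apply]

/-- Fewer than `n` polynomials in `n` variables that vanish at the origin have another common
zero. -/
theorem exists_common_zero {n : ℕ} (s : Finset (MvPolynomial (Fin n) ℂ)) (hs : s.card < n)
    (h0 : ∀ f ∈ s, eval 0 f = 0) : ∃ x, x ≠ 0 ∧ ∀ f ∈ s, eval x f = 0 := by
  by_contra! H
  have hp : (RingHom.ker (truncHom n n)).IsPrime := RingHom.ker_isPrime _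
  -- If the origin were the only common zero, its maximal ideal would be minimal over the given
  -- polynomials by the Nullstellensatz. Krull's theorem would then bound its height by their
  -- number, whereas a chain of coordinate subspaces shows that the height is at least `n`.
  have hmin : RingHom.ker (truncHom n n) ∈ (Ideal.span (s : Set (MvPolynomial (Fin n) ℂ))).minimalPrimes := by
    refine ⟨⟨hp, Ideal.span_le.2 fun f hf => mem_ker_truncHom_iff.2 (h0 f hf)⟩, ?_⟩
    rintro q ⟨hq, hsq⟩ - F hF
    rw [← IsPrime.vanishingIdeal_zeroLocus (K := ℂ) q]
    intro x hx
    have hx0 : x = 0 := by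
      by_contra hx0
      obtain ⟨f, hf, hne⟩ := H x hx0
      exact hne (hx f (hsq (Ideal.subset_span hf)))
    rw [hx0]
    exact mem_ker_truncHom_iff.1 hF
  have h1 := Ideal.height_le_card_of_mem_minimalPrimes_span_finset hmin
  have h2 := (le_height_ker_truncHom (le_refl n)).trans h1
  exact absurd (by exact_mod_cast h2) (not_le.2 hs)

theorem irreducible_of_isHomogeneous {σ : Type*} {F : MvPolynomial σ ℂ} {d : ℕ}
    (hF : F.IsHomogeneous d) (hd : d ≠ 0) (h0 : F ≠ 0)
    (H : ∀ A B a b, A.IsHomogeneous a → B.IsHomogeneous b → a ≠ 0 → b ≠ 0 → F = A * B → False) :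
    Irreducible F := by
  have hunit : ∀ {A : MvPolynomial σ ℂ}, A ≠ 0 → A.IsHomogeneous 0 → IsUnit A := by
    intro A hA0 hA
    rw [← totalDegree_zero_iff_isHomogeneous, totalDegree_eq_zero_iff_eq_C] at hA
    rw [hA]
    refine (IsUnit.mk0 _ fun hc => hA0 ?_).map C
    rw [hA, hc, C_0]
  refine ⟨fun hu => ?_, fun A B hAB => ?_⟩
  · have h1 : IsUnit (eval 0 F) := hu.map (eval (0 : σ → ℂ))
    rw [eval_zero_of_isHomogeneous hF hd] at h1
    exact not_isUnit_zero h1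
  · have hAB0 : A * B ≠ 0 := hAB ▸ h0
    obtain ⟨a, b, hA, hB, -⟩ := exists_isHomogeneous_of_mul (hAB ▸ hF) hAB0
    by_cases ha : a = 0
    · exact Or.inl (hunit (left_ne_zero_of_mul hAB0) (ha ▸ hA))
    · by_cases hb : b = 0
      · exact Or.inr (hunit (right_ne_zero_of_mul hAB0) (hb ▸ hB))
      · exact (H A B a b hA hB ha hb hAB).elim

/-- The restriction of a polynomial to the line through `x` in the direction `v`. -/
noncomputable def linePoly {σ : Type*} (x v : σ → ℂ) : MvPolynomial σ ℂ →ₐ[ℂ] Polynomial ℂ :=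
  aeval fun i => Polynomial.C (x i) + Polynomial.C (v i) * Polynomial.X

theorem eval_linePoly {σ : Type*} (x v : σ → ℂ) (F : MvPolynomial σ ℂ) (s : ℂ) :
    (linePoly x v F).eval s = eval (x + s • v) F := by
  rw [linePoly, ← Polynomial.coe_evalRingHom, ← coe_aeval_eq_eval, aeval_def, RingHom.coe_coe,
    aeval_def, hom_eval₂]
  congr 1
  · ext
    simp
  · ext i
    simp only [Polynomial.coe_evalRingHom, Polynomial.eval_add,
      Polynomial.eval_C, Polynomial.eval_mul, Polynomial.eval_X, Pi.add_apply, Pi.smul_apply,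
      smul_eq_mul]
    ring

/-- The factors of a cone vanish at its vertex. -/
theorem eval_vertex_eq_zero {σ : Type*} {A B : MvPolynomial σ ℂ} {a : ℕ} (hA : A.IsHomogeneous a)
    (ha : a ≠ 0) {x P : σ → ℂ} {c : ℂ} (hc : c ≠ 0) (h : ∀ t : ℂ, eval (x + t • P) (A * B) = c) :
    eval P A = 0 := by
  have h1 : linePoly x P A * linePoly x P B = Polynomial.C c := by
    rw [← map_mul]
    refine Polynomial.funext fun t => ?_
    rw [eval_linePoly, h, Polynomial.eval_C]
  -- Along the line the product is a nonzero constant, so `A` is constant there. By homogeneity A(P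
  -- + r x) is then a constant times r^a for r ≠ 0, hence for all r, and r = 0 gives the claim.
  obtain ⟨c', hc'⟩ : ∃ c', linePoly x P A = Polynomial.C c' := by
    have hu : IsUnit (linePoly x P A) := by
      refine isUnit_of_mul_isUnit_left (y := linePoly x P B) ?_
      rw [h1]
      exact (IsUnit.mk0 c hc).map Polynomial.C
    obtain ⟨r, -, hr⟩ := Polynomial.isUnit_iff.1 hu
    exact ⟨r, hr.symm⟩
  have h2 : ∀ t : ℂ, eval (x + t • P) A = c' := fun t => by
    rw [← eval_linePoly, hc', Polynomial.eval_C]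
  have h3 : linePoly P x A = Polynomial.C c' * Polynomial.X ^ a := by
    refine Polynomial.eq_of_infinite_eval_eq _ _ (Set.Infinite.mono (s := {0}ᶜ) (fun r hr => ?_)
      (Set.finite_singleton (0 : ℂ)).infinite_compl)
    have hr0 : r ≠ 0 := hr
    change Polynomial.eval r _ = Polynomial.eval r _
    rw [eval_linePoly, Polynomial.eval_mul, Polynomial.eval_C, Polynomial.eval_pow,
      Polynomial.eval_X, ← h2 r⁻¹, mul_comm, ← eval_smul_of_isHomogeneous hA, smul_add, smul_smul,
      mul_inv_cancel₀ hr0, one_smul, add_comm]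
  have h4 := congrArg (Polynomial.eval 0) h3
  rw [eval_linePoly] at h4
  simpa [ha] using h4

end IrreducibleForms

/-! ### Irreducible hypersurfaces cutting out given cones -/

section SuitedIrreducible

variable {N d e : ℕ}

theorem V_subset_suitedLocus : V N d e ⊆ suitedLocus N d e := by
  rintro L ⟨F, hF, -, h⟩
  exact ⟨F, hF, h⟩

/-- A form cutting out the cones has, on the first hyperplane, the same values as a multiple of the
equation of the first cone. -/
theorem ConfigRel.exists_eval_eq {D : ConfigCoord N d e} {L : Config N d e} (h : ConfigRel D L)
    {F : MvPolynomial (Fin (N + 1)) ℂ} {k : ℕ} (hk : k < e)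
    (hF : (L.1 ⟨k, hk⟩).cone = Submodule.span ℂ {restr (L.1 ⟨k, hk⟩).hyp F}) :
    ∃ μ : ℂ, μ ≠ 0 ∧ ∀ x, lin D k x = 0 → eval x F = μ * eval x (eqn D k).1 := by
  obtain ⟨μ, hμ, G, hG⟩ := (h.cone_eq_span_iff ⟨k, hk⟩).1 hF
  refine ⟨μ, hμ, fun x hx => ?_⟩
  have h1 := congrArg (eval x) hG
  simp only at h1
  rw [map_mul, eval_linForm, hx, zero_mul, map_sub, sub_eq_zero, map_mul, eval_C] at h1
  exact h1

/-- The hypersurface can be changed by multiples of the product of all hyperplanes until it is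
smooth at P_0. Both factors of a proper factorization would vanish at P_0, making it singular there.
-/
theorem suitedLocus_subset_V_of_le (hN : 2 ≤ N) (he : 1 ≤ e) (hed : e ≤ d) :
    suitedLocus N d e ⊆ V N d e := by
  rintro L ⟨F, hFd, hF⟩
  obtain ⟨D, h⟩ := exists_configRel L
  have hP0 : vtx D 0 ≠ 0 := by
    have := h.good.vtx_ne ⟨0, he⟩
    rwa [← vtx_coe] at this
  obtain ⟨m, hm⟩ : ∃ m : Module.Dual ℂ (Vec N), m (vtx D 0) ≠ 0 := by
    by_contra! hall
    exact hP0 ((Module.forall_dual_apply_eq_zero_iff ℂ _).1 hall)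
  obtain ⟨v, hv⟩ : ∃ v, lin D 0 v ≠ 0 := by
    by_contra! h0
    exact h.good.lin_ne' he (LinearMap.ext h0)
  -- `G` vanishes on every Π_k, so adding it preserves the intersections. It vanishes only to first
  -- order at P_0, because m and the other hyperplanes avoid the vertex.
  set G := prodForms (lin D) e * linForm m ^ (d - e) with hG
  have hGd : G.IsHomogeneous d := by
    have := (prodForms_isHomogeneous (lin D) e).mul ((linForm_isHomogeneous m).pow (d - e))
    rwa [one_mul, Nat.add_sub_cancel' hed] at this
  obtain ⟨Q, hQ⟩ : ∃ Q, prodForms (lin D) e = linForm (lin D 0) * Q ∧ eval (vtx D 0) Q ≠ 0 := by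
    refine ⟨∏ j ∈ Finset.range (e - 1), linForm (lin D (j + 1)), ?_, ?_⟩
    · have := Finset.prod_range_succ' (fun j => linForm (lin D j)) (e - 1)
      rw [Nat.sub_add_cancel he] at this
      rw [prodForms, this, mul_comm]
    · rw [map_prod, Finset.prod_ne_zero_iff]
      intro j hj
      rw [eval_linForm]
      have := Finset.mem_range.1 hj
      exact h.good.lin_vtx_ne' (by omega) he (by omega)
  have hGv : dirDeriv G (vtx D 0) v ≠ 0 := by
    rw [hG, hQ.1, mul_assoc, dirDeriv_mul, dirDeriv_linForm, eval_linForm, h.good.lin_vtx' he]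
    simp [hv, hQ.2, eval_linForm, hm]
  have hGk : ∀ k : Fin e, restr (L.1 k).hyp G = 0 := fun k => by
    rw [restr_eq_zero_iff (h.hyp_eq k) (h.good.lin_ne' k.2)]
    exact (linForm_dvd_prodForms (lin D) k.2).mul_right _
  obtain ⟨t, ht⟩ : ∃ t : ℂ, dirDeriv (F + C t * G) (vtx D 0) v ≠ 0 := by
    by_cases hFv : dirDeriv F (vtx D 0) v = 0
    · exact ⟨1, by rw [dirDeriv_add, hFv, dirDeriv_C_mul]; simpa using hGv⟩
    · exact ⟨0, by simpa using hFv⟩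
  have hFt : ∀ k, (L.1 k).cone = Submodule.span ℂ {restr (L.1 k).hyp (F + C t * G)} := fun k => by
    rw [map_add, ← smul_eq_C_mul, map_smul, hGk, smul_zero, add_zero]
    exact hF k
  have hFtd : (F + C t * G).IsHomogeneous d := hFd.add (hGd.C_mul t)
  refine ⟨F + C t * G, hFtd, irreducible_of_isHomogeneous hFtd (by omega) ?_ ?_, hFt⟩
  · intro h0
    rw [h0] at ht
    simp [dirDeriv] at ht
  · intro A B a b hA hB ha hb hAB
    obtain ⟨μ, hμ, hμx⟩ := h.exists_eval_eq he (hFt ⟨0, he⟩)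
    obtain ⟨x, hx, hxf⟩ := (h.good.smooth' he).exists_eval_ne_zero hN
    have hconst : ∀ s : ℂ, eval (x + s • vtx D 0) (A * B) = μ * eval x (eqn D 0).1 := fun s => by
      rw [← hAB, hμx _ (by simp [hx, h.good.lin_vtx' he]), h.good.inv' he x hx]
    have hc := mul_ne_zero hμ hxf
    have h1 := eval_vertex_eq_zero hA ha hc hconst
    have hconst' : ∀ s : ℂ, eval (x + s • vtx D 0) (B * A) = μ * eval x (eqn D 0).1 := fun s => by
      rw [mul_comm B A, hconst]
    have h2 := eval_vertex_eq_zero hB hb hc hconst'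
    rw [hAB, dirDeriv_mul, h1, h2] at ht
    simp at ht

/-- Two proper factors, l_0 and a linear form nonzero at P_0 are four equations in at least five
variables, so they have a common projective zero. It is a point of C_0 other than P_0 at which both
factors vanish, hence a singular point of the cone. -/
theorem suitedLocus_subset_V_of_four_le (hN : 4 ≤ N) (hd : 1 ≤ d) (he : 1 ≤ e) :
    suitedLocus N d e ⊆ V N d e := by
  rintro L ⟨F, hFd, hF⟩
  obtain ⟨D, h⟩ := exists_configRel L
  have hP0 : vtx D 0 ≠ 0 := by
    have := h.good.vtx_ne ⟨0, he⟩
    rwa [← vtx_coe] at this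
  obtain ⟨m, hm⟩ : ∃ m : Module.Dual ℂ (Vec N), m (vtx D 0) ≠ 0 := by
    by_contra! hall
    exact hP0 ((Module.forall_dual_apply_eq_zero_iff ℂ _).1 hall)
  obtain ⟨μ, hμ, hμx⟩ := h.exists_eval_eq he (hF ⟨0, he⟩)
  refine ⟨F, hFd, irreducible_of_isHomogeneous hFd (by omega) ?_ ?_, hF⟩
  · rintro rfl
    obtain ⟨x, hx, hxf⟩ := (h.good.smooth' he).exists_eval_ne_zero (by omega)
    have := hμx x hx
    rw [map_zero] at this
    exact mul_ne_zero hμ hxf this.symm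
  · intro A B a b hA hB ha hb hAB
    classical
    obtain ⟨x, hx0, hx⟩ := exists_common_zero ({A, B, linForm (lin D 0), linForm m} : Finset _)
      (Finset.card_le_four.trans_lt (by omega)) (by
        simp only [Finset.mem_insert, Finset.mem_singleton, forall_eq_or_imp, forall_eq,
          eval_linForm, map_zero, eval_zero_of_isHomogeneous hA ha,
          eval_zero_of_isHomogeneous hB hb, and_self])
    simp only [Finset.mem_insert, Finset.mem_singleton, forall_eq_or_imp, forall_eq,
      eval_linForm] at hx
    obtain ⟨hxA, hxB, hxl, hxm⟩ := hx
    have hxP : x ∉ Submodule.span ℂ {vtx D 0} := by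
      intro hmem
      obtain ⟨t, rfl⟩ := Submodule.mem_span_singleton.1 hmem
      have : t = 0 := by simpa [hm] using hxm
      exact hx0 (by simp [this])
    have hxF : eval x (eqn D 0).1 = 0 := by
      have := hμx x hxl
      rw [hAB, map_mul, hxA, zero_mul] at this
      exact (mul_eq_zero.1 this.symm).resolve_left hμ
    obtain ⟨v, hv, hne⟩ := h.good.smooth' he x hxl hxP hxF
    have h1 := hasDerivAt_eval F x v
    have h2 : (fun s : ℂ => eval (x + s • v) F) = fun s => μ * eval (x + s • v) (eqn D 0).1 := by
      ext s
      exact hμx _ (by simp [hxl, hv])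
    rw [h2] at h1
    have h3 := h1.unique ((hasDerivAt_eval (eqn D 0).1 x v).const_mul μ)
    rw [hAB, dirDeriv_mul, hxA, hxB] at h3
    exact mul_ne_zero hμ hne (by simpa using h3.symm)

theorem V_eq_suitedLocus (hN : 2 ≤ N) (hd : 1 ≤ d) (he : 1 ≤ e) (h : e ≤ d ∨ 4 ≤ N) :
    V N d e = suitedLocus N d e := by
  refine V_subset_suitedLocus.antisymm ?_
  rcases h with h | h
  · exact suitedLocus_subset_V_of_le hN he h
  · exact suitedLocus_subset_V_of_four_le h hd he

end SuitedIrreducible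


/-! ### Open sets -/

section OpenSets

variable {M X : Type*} [AddCommGroup M] [Module ℂ M]

theorem isOpen_zariskiVec_iff {S : Set M} : IsOpen[zariskiVec M] S ↔
    ∀ D₀ ∈ S, ∃ h ∈ polyFun M, h D₀ ≠ 0 ∧ ∀ D, h D ≠ 0 → D ∈ S := by
  constructor
  · intro hS
    induction hS with
    | basic U hU =>
      obtain ⟨h, hh, rfl⟩ := hU
      exact fun D₀ hD₀ => ⟨h, hh, hD₀, fun D hD => hD⟩
    | univ => exact fun D₀ _ => ⟨1, one_mem _, one_ne_zero, fun D _ => Set.mem_univ D⟩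
    | inter s t _ _ hs ht =>
      intro D₀ hD₀
      obtain ⟨h, hh, h0, hD⟩ := hs D₀ hD₀.1
      obtain ⟨h', hh', h0', hD'⟩ := ht D₀ hD₀.2
      exact ⟨h * h', mul_mem hh hh', mul_ne_zero h0 h0', fun D hne =>
        ⟨hD D (left_ne_zero_of_mul hne), hD' D (right_ne_zero_of_mul hne)⟩⟩
    | sUnion s _ hs =>
      rintro D₀ ⟨U, hU, hD₀⟩
      obtain ⟨h, hh, h0, hD⟩ := hs U hU D₀ hD₀
      exact ⟨h, hh, h0, fun D hne => ⟨U, hU, hD D hne⟩⟩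
  · intro H
    have : S = ⋃₀ {U | U ⊆ S ∧ ∃ h ∈ polyFun M, U = {D | h D ≠ 0}} := by
      ext D
      constructor
      · intro hD
        obtain ⟨h, hh, h0, hS⟩ := H D hD
        exact ⟨_, ⟨hS, h, hh, rfl⟩, h0⟩
      · rintro ⟨U, ⟨hU, -⟩, hD⟩
        exact hU hD
    rw [this]
    exact .sUnion _ fun U hU => .basic _ hU.2

theorem isOpen_zariski_iff {rel : M → X → Prop} {U : Set X} : IsOpen[zariski rel] U ↔
    ∀ D₀, ∀ x₀ ∈ U, rel D₀ x₀ → ∃ h ∈ polyFun M, h D₀ ≠ 0 ∧ ∀ D x, rel D x → h D ≠ 0 → x ∈ U := by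
  have h1 : IsOpen[zariski rel] U ↔ ∃ S, IsOpen[zariskiVec M] S ∧
      (fun z : {z : M × X // rel z.1 z.2} => z.1.1) ⁻¹' S =
        (fun z : {z : M × X // rel z.1 z.2} => z.1.2) ⁻¹' U := Iff.rfl
  rw [h1]
  constructor
  · rintro ⟨S, hS, hSU⟩ D₀ x₀ hx₀ hrel
    obtain ⟨h, hh, h0, hD⟩ := isOpen_zariskiVec_iff.1 hS D₀
      ((Set.ext_iff.1 hSU ⟨(D₀, x₀), hrel⟩).2 hx₀)
    exact ⟨h, hh, h0, fun D x hx hne => (Set.ext_iff.1 hSU ⟨(D, x), hx⟩).1 (hD D hne)⟩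
  · intro H
    refine ⟨{D | ∃ h ∈ polyFun M, h D ≠ 0 ∧ ∀ D x, rel D x → h D ≠ 0 → x ∈ U},
      isOpen_zariskiVec_iff.2 ?_, ?_⟩
    · rintro D₀ ⟨h, hh, h0, hU⟩
      exact ⟨h, hh, h0, fun D hD => ⟨h, hh, hD, hU⟩⟩
    · ext ⟨⟨D, x⟩, hrel⟩
      constructor
      · rintro ⟨h, hh, h0, hU⟩
        exact hU D x hrel h0
      · intro hx
        exact H D x hx hrel

theorem mapIn_fst {M' : Type*} [AddCommGroup M'] [Module ℂ M'] :
    MapIn (polyFun (M × M')) fun z => z.1 :=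
  MapIn.linearMap (LinearMap.fst ℂ M M')

end OpenSets

/-! ### Charts of `𝒢^e` -/

section Chart

variable {N d e : ℕ}

theorem exists_span_sup_eq {W : Type*} [AddCommGroup W] [Module ℂ W] {n : ℕ} {K V : Submodule ℂ W}
    [FiniteDimensional ℂ V] (hKV : K ≤ V)
    (h : Module.finrank ℂ V = Module.finrank ℂ K + n) :
    ∃ E : Fin n → W, (∀ i, E i ∈ V) ∧ Submodule.span ℂ (Set.range E) ⊔ K = V := by
  induction n generalizing K with
  | zero =>
    refine ⟨Fin.elim0, fun i => i.elim0, ?_⟩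
    rw [Set.range_eq_empty, Submodule.span_empty, bot_sup_eq]
    exact Submodule.eq_of_le_of_finrank_eq hKV (by omega)
  | succ n ih =>
    have hfK : FiniteDimensional ℂ K := Submodule.finiteDimensional_of_le hKV
    obtain ⟨u, huV, huK⟩ : ∃ u ∈ V, u ∉ K := by
      by_contra! hall
      have : V = K := le_antisymm hall hKV
      rw [this] at h
      omega
    have hu0 : u ≠ 0 := fun h0 => huK (h0 ▸ zero_mem _)
    have hdisj : Submodule.span ℂ {u} ⊓ K = ⊥ :=
      disjoint_iff.1 ((Submodule.disjoint_span_singleton' hu0).2 huK).symm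
    have h1 := Submodule.finrank_sup_add_finrank_inf_eq (Submodule.span ℂ {u}) K
    rw [hdisj, finrank_bot, finrank_span_singleton hu0] at h1
    obtain ⟨E, hE, hspan⟩ := ih (K := Submodule.span ℂ {u} ⊔ K)
      (sup_le ((Submodule.span_singleton_le_iff_mem _ _).2 huV) hKV) (by omega)
    refine ⟨Fin.cons u E, fun i => ?_, ?_⟩
    · induction i using Fin.cases with
      | zero => exact huV
      | succ i => exact hE i
    · rw [Fin.range_cons, Submodule.span_insert, sup_comm (Submodule.span ℂ {u}), sup_assoc]
      exact hspan

/-- The dimension of the space of possible linear systems with number `k`. -/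
def codimSys (N d k : ℕ) : ℕ := (N + d - 1).choose (N - 1) - sysDim N d (k + 1) - 1

theorem sum_codimSys (N d e : ℕ) : ∑ k : Idx e, codimSys N d k.1 = relDim N d e := by
  have h1 : ∑ k : Idx e, codimSys N d k.1 = ∑ i ∈ Finset.Icc 2 e,
      ((N + d - 1).choose (N - 1) - sysDim N d i - 1) := by
    refine Finset.sum_bij (fun k _ => k.1.1 + 1) (fun k _ => ?_) (fun k _ k' _ h => ?_)
      (fun i hi => ?_) (fun k _ => rfl)
    · have h1 := k.1.2
      have h2 := k.2
      rw [Finset.mem_Icc]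
      omega
    · exact Subtype.ext (Fin.ext (by omega))
    · rw [Finset.mem_Icc] at hi
      exact ⟨⟨⟨i - 1, by omega⟩, by simp only; omega⟩, Finset.mem_univ _, by simp only; omega⟩
  have h2 : ∀ n ≤ d + 1, ∑ i ∈ Finset.Icc 2 n,
      ((N + d - 1).choose (N - 1) - sysDim N d i - 1) = ∑ i ∈ Finset.Icc 2 n,
      ((N + d - 1).choose (N - 1) - (N + d - i).choose (N - 1) - 1) := by
    intro n hn
    refine Finset.sum_congr rfl fun i hi => ?_
    rw [Finset.mem_Icc] at hi
    rw [sysDim, if_pos (by omega)]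
  rw [h1, relDim]
  split_ifs with he
  · exact h2 e he
  · rw [← h2 (d + 1) le_rfl]
    have h3 : Finset.Icc 2 e = Finset.Icc 2 (d + 1) ∪ Finset.Icc (d + 2) e := by
      ext i
      simp only [Finset.mem_union, Finset.mem_Icc]
      omega
    rw [h3, Finset.sum_union]
    · congr 1
      rw [Finset.sum_congr rfl (g := fun _ => (N + d - 1).choose (N - 1) - 1), Finset.sum_const,
        Nat.card_Icc, smul_eq_mul]
      · congr 1
        omega
      · intro i hi
        rw [Finset.mem_Icc] at hi
        rw [sysDim, if_neg (by omega), Nat.sub_zero]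
    · rw [Finset.disjoint_left]
      intro i hi hi'
      rw [Finset.mem_Icc] at hi hi'
      omega

/-- The numbering of the coordinates of the fibres of `τ`. -/
noncomputable def chartIndex (N d e : ℕ) :
    (Σ k : Idx e, Fin (codimSys N d k.1)) ≃ Fin (relDim N d e) :=
  Fintype.equivFinOfCardEq (by simp [sum_codimSys])

/-- The restriction of forms to a linear subspace. -/
noncomputable def restrForm (H : Submodule ℂ (Vec N)) : Form N d →ₗ[ℂ] (H → ℂ) :=
  restr H ∘ₗ Submodule.subtype _

theorem restrForm_mem (H : Submodule ℂ (Vec N)) (F : Form N d) : restrForm H F ∈ formsOn H d :=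
  ⟨F.1, F.2, rfl⟩

/-- The linear combinations of the forms `E k`. -/
noncomputable def comb (E : ∀ k : Idx e, Fin (codimSys N d k.1 + 1) → Form N d) (k : Idx e) :
    (Fin (codimSys N d k.1 + 1) → ℂ) →ₗ[ℂ] Form N d :=
  Fintype.linearCombination ℂ (E k)

/-- The forms `E k` span the forms on the hyperplane with number `k` modulo the fixed part. -/
def IsTransversal (E : ∀ k : Idx e, Fin (codimSys N d k.1 + 1) → Form N d) (L : Config N d e)
    (k : Idx e) : Prop :=
  ∀ F : Form N d, ∃ c, restrForm (L.1 k.1).hyp (F - comb E k c) ∈ fixedSys L k.1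

theorem GSpace.sysDim_lt (hN : 1 ≤ N) (y : GSpace N d e) (k : Idx e) :
    sysDim N d (k.1 + 1) + 1 ≤ (N + d - 1).choose (N - 1) := by
  obtain ⟨D, h⟩ := exists_configRel y.conf
  have h1 := Submodule.finrank_mono (y.sys_le k)
  rwa [y.sys_rank, finrank_formsOn hN (h.hyp_eq k.1) (h.good.lin_ne' k.1.2)] at h1

section

variable {E : ∀ k : Idx e, Fin (codimSys N d k.1 + 1) → Form N d}

/-- The number of forms `E k` equals the codimension of the fixed part, so spanning modulo it
implies independence modulo it. The bound `hk` prevents truncation in `codimSys`. -/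
theorem IsTransversal.eq_zero (hN : 1 ≤ N) {L : Config N d e} {k : Idx e}
    (hk : sysDim N d (k.1 + 1) + 1 ≤ (N + d - 1).choose (N - 1)) (hT : IsTransversal E L k)
    {c : Fin (codimSys N d k.1 + 1) → ℂ}
    (hc : restrForm (L.1 k.1).hyp (comb E k c) ∈ fixedSys L k.1) : c = 0 := by
  obtain ⟨D, h⟩ := exists_configRel L
  let T : (Fin (codimSys N d k.1 + 1) → ℂ) × fixedSys L k.1 →ₗ[ℂ] ((L.1 k.1).hyp → ℂ) :=
    LinearMap.coprod (restrForm (L.1 k.1).hyp ∘ₗ comb E k) (fixedSys L k.1).subtype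
  have hrange : LinearMap.range T = formsOn (L.1 k.1).hyp d := by
    refine le_antisymm ?_ ?_
    · rintro _ ⟨⟨c, φ⟩, rfl⟩
      exact add_mem (restrForm_mem _ _) (fixedSys_le_formsOn L k.1 φ.2)
    · rintro _ ⟨F, hF, rfl⟩
      obtain ⟨c, hc⟩ := hT ⟨F, hF⟩
      refine ⟨(c, ⟨_, hc⟩), ?_⟩
      rw [LinearMap.coprod_apply, LinearMap.comp_apply, Submodule.subtype_apply, ← map_add,
        add_sub_cancel]
      rfl
  have h1 := LinearMap.finrank_range_add_finrank_ker T
  rw [hrange, finrank_formsOn hN (h.hyp_eq k.1) (h.good.lin_ne' k.1.2), Module.finrank_prod,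
    finrank_fixedSys hN, Module.finrank_fin_fun] at h1
  have h2 : LinearMap.ker T = ⊥ := by
    rw [← Submodule.finrank_eq_zero (R := ℂ)]
    simp only [codimSys] at h1 ⊢
    omega
  have h3 : (c, -⟨_, hc⟩) ∈ LinearMap.ker T := by
    rw [LinearMap.mem_ker, LinearMap.coprod_apply, map_neg]
    exact add_neg_cancel _
  rw [h2, Submodule.mem_bot] at h3
  exact congrArg Prod.fst h3

/-- The coefficients of a form with respect to the forms `E k` depend rationally on the
configuration. -/
theorem exists_coefficients (hd : 1 ≤ d) {D₀ : ConfigCoord N d e} {L₀ : Config N d e}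
    (h₀ : ConfigRel D₀ L₀) (k : Idx e) (hT : IsTransversal E L₀ k) :
    ∃ (ε : ConfigCoord N d e × Form N d → Fin (codimSys N d k.1 + 1) → ℂ),
      ∃ h ∈ polyFun (ConfigCoord N d e), h D₀ ≠ 0 ∧
      (∀ G₀ j, (fun z => ε z j) ∈ ratAt (D₀, G₀)) ∧
      ∀ D L, ConfigRel D L → h D ≠ 0 → ∀ G,
        restrForm (L.1 k.1).hyp (G - comb E k (ε (D, G))) ∈ fixedSys L k.1 := by
  have hl₀ := h₀.good.lin_ne' k.1.2
  let B := Module.finBasis ℂ (Form N d)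
  -- Each basis form is split over `L₀` into a combination of the forms `E k`, an element of the
  -- fixed part and a multiple of the equation of Π_k.
  have hdec : ∀ i, ∃ (c : Fin (codimSys N d k.1 + 1) → ℂ) (g b : MvPolynomial (Fin (N + 1)) ℂ),
      (∀ D : ConfigCoord N d e, (prodForms (lin D) k.1 * g).IsHomogeneous d) ∧
      b.IsHomogeneous (d - 1) ∧
      (B i).1 = (comb E k c).1 + prodForms (lin D₀) k.1 * g + linForm (lin D₀ k.1) * b := by
    intro i
    obtain ⟨c, hc⟩ := hT (B i)
    obtain ⟨g, hg, hcg⟩ := (h₀.mem_fixedSys_iff k.1).1 hc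
    have hM0 := h₀.good.prodForms_ne_zero k.1.2.le
    have hM := prodForms_isHomogeneous (lin D₀) k.1
    obtain ⟨b, hb⟩ := (restr_eq_iff (h₀.hyp_eq k.1) hl₀).1 hcg
    have hb' : (linForm (lin D₀ k.1) * b).IsHomogeneous d := by
      rw [← hb]
      exact IsHomogeneous.sub (B i - comb E k c).2 hg
    refine ⟨c, g, b, fun D => ?_,
      isHomogeneous_right_of_mul (linForm_isHomogeneous _) (linForm_ne_zero hl₀) hb', ?_⟩
    · by_cases hk : k.1.1 ≤ d
      · have := (prodForms_isHomogeneous (lin D) k.1).mul (isHomogeneous_right_of_mul hM hM0 hg)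
        rwa [Nat.add_sub_cancel' hk] at this
      · rw [eq_zero_of_mul_isHomogeneous hM hM0 hg (not_le.1 hk), mul_zero]
        exact isHomogeneous_zero _ _ _
    · rw [← hb]
      change (B i).1 = (comb E k c).1 + _ + ((B i).1 - (comb E k c).1 - _)
      ring
  choose c g b hg hb hB using hdec
  have hlb : ∀ (D : ConfigCoord N d e) i, (linForm (lin D k.1) * b i).IsHomogeneous d := by
    intro D i
    have := (linForm_isHomogeneous (lin D k.1)).mul (hb i)
    rwa [Nat.add_sub_cancel' hd] at this
  -- The splittings are transported to nearby coordinates with the coefficients kept. `Θ D₀` is the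
  -- given basis, so `Θ D` remains a basis where the determinant of `A D` is nonzero. Cramer's rule
  -- expands `G` in it rationally, and each `Θ D i` has known coefficients modulo the fixed part.
  let Θ : ConfigCoord N d e → Fin (Module.finrank ℂ (Form N d)) → Form N d := fun D i =>
    ⟨(comb E k (c i)).1 + prodForms (lin D) k.1 * g i + linForm (lin D k.1) * b i,
      IsHomogeneous.add (IsHomogeneous.add (comb E k (c i)).2 (hg i D)) (hlb D i)⟩
  have hΘ₀ : Θ D₀ = B := funext fun i => Subtype.ext (hB i).symm
  have hΘ : ∀ i, MapIn (polyFun (ConfigCoord N d e)) fun D => Θ D i := fun i => CoeffIn.mapIn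
    (((CoeffIn.const _).add ((coeffIn_prodForms fun j _ => lin_apply_mem j).mul
      (CoeffIn.const _))).add ((coeffIn_linForm (lin_apply_mem _)).mul (CoeffIn.const _)))
  let A : ConfigCoord N d e → Matrix (Fin (Module.finrank ℂ (Form N d)))
    (Fin (Module.finrank ℂ (Form N d))) ℂ := fun D r i => B.repr (Θ D i) r
  have hA : ∀ r i, (fun D => A D r i) ∈ polyFun (ConfigCoord N d e) := fun r i => hΘ i (B.coord r)
  have hA₀ : A D₀ = 1 := by
    ext r i
    simp only [A, hΘ₀, Module.Basis.repr_self, Matrix.one_apply, Finsupp.single_apply, eq_comm]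
  let x : ConfigCoord N d e × Form N d → Fin (Module.finrank ℂ (Form N d)) → ℂ := fun z =>
    (A z.1).det⁻¹ • (A z.1).adjugate.mulVec (B.repr z.2)
  refine ⟨fun z => ∑ i, x z i • c i, fun D => (A D).det, det_mem_subalgebra hA,
    by change (A D₀).det ≠ 0; rw [hA₀]; simp, fun G₀ j => ?_, fun D L h hne G => ?_⟩
  · have hfst : MapIn (polyFun (ConfigCoord N d e × Form N d)) fun z => z.1 :=
      mapIn_fst
    have hA' : ∀ r i, (fun z : ConfigCoord N d e × Form N d => A z.1 r i) ∈
        polyFun (ConfigCoord N d e × Form N d) := fun r i => polyFun_comp hfst (hA r i)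
    have hadj : ∀ i r, (fun z : ConfigCoord N d e × Form N d => (A z.1).adjugate i r) ∈
        polyFun (ConfigCoord N d e × Form N d) := by
      intro i r
      simp only [Matrix.adjugate_apply]
      refine det_mem_subalgebra fun p q => ?_
      by_cases hp : p = r
      · subst hp
        simp only [Matrix.updateRow_self]
        exact const_mem_subalgebra _ _
      · simp only [Matrix.updateRow_ne hp]
        exact hA' p q
    have hdet : (fun z : ConfigCoord N d e × Form N d => (A z.1).det⁻¹) ∈ ratAt (D₀, G₀) :=
      inv_mem_ratAt (polyFun_le_ratAt _ (det_mem_subalgebra hA')) (by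
        change (A D₀).det ≠ 0
        rw [hA₀]
        simp)
    simp only [Finset.sum_apply, Pi.smul_apply, smul_eq_mul, x, Matrix.mulVec, dotProduct]
    refine sum_mem_subalgebra _ fun i _ => mul_mem (mul_mem hdet (polyFun_le_ratAt _
      (sum_mem_subalgebra _ fun r _ => mul_mem (hadj i r) ?_))) (const_mem_subalgebra _ _)
    exact linear_mem_polyFun (B.coord r ∘ₗ LinearMap.snd ℂ (ConfigCoord N d e) (Form N d))
  · have hmul : (A D).mulVec (x (D, G)) = B.repr G := by
      simp only [x]
      rw [Matrix.mulVec_smul, Matrix.mulVec_mulVec, Matrix.mul_adjugate, Matrix.smul_mulVec,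
        Matrix.one_mulVec, smul_smul, inv_mul_cancel₀ hne, one_smul]
    have hG : G = ∑ i, x (D, G) i • Θ D i := by
      refine B.repr.injective (Finsupp.ext fun r => ?_)
      rw [← hmul]
      simp only [map_sum, map_smul, Finsupp.coe_finsetSum, Finset.sum_apply, Finsupp.smul_apply,
        smul_eq_mul, Matrix.mulVec, dotProduct, A]
      exact Finset.sum_congr rfl fun i _ => mul_comm _ _
    have hsub : G - comb E k (∑ i, x (D, G) i • c i) =
        ∑ i, x (D, G) i • (Θ D i - comb E k (c i)) := by
      rw [map_sum]
      conv_lhs => rw [hG]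
      simp only [map_smul, smul_sub, Finset.sum_sub_distrib, ← hG]
    rw [hsub, map_sum]
    refine sum_mem fun i _ => ?_
    rw [map_smul]
    refine Submodule.smul_mem _ _ ((h.mem_fixedSys_iff k.1).2 ⟨g i, hg i D, ?_⟩)
    have : (Θ D i - comb E k (c i) : Form N d).1 - prodForms (lin D) k.1 * g i =
        linForm (lin D k.1) * b i := by
      change (comb E k (c i)).1 + _ + _ - (comb E k (c i)).1 - _ = _
      ring
    change restr _ (Θ D i - comb E k (c i) : Form N d).1 = _
    rw [restr_eq_iff (h.hyp_eq k.1) (h.good.lin_ne' k.1.2), this]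
    exact dvd_mul_right _ _

end

end Chart


/-! ### Affine charts of the fibres of `τ` and their inverses -/

section ChartConstruction

variable {N d e : ℕ}

/-- Forms giving a chart around a point of `𝒢^e`. -/
theorem GSpace.exists_chartForms (hN : 1 ≤ N) (y : GSpace N d e) :
    ∃ E : ∀ k : Idx e, Fin (codimSys N d k.1 + 1) → Form N d,
      ∀ k, IsTransversal E y.conf k ∧ restrForm (y.conf.1 k.1).hyp (E k 0) ∈ y.sys k := by
  obtain ⟨D, h⟩ := exists_configRel y.conf
  have H : ∀ k : Idx e, ∃ E : Fin (codimSys N d k.1 + 1) → Form N d,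
      restrForm (y.conf.1 k.1).hyp (E 0) ∈ y.sys k ∧
      Submodule.span ℂ (Set.range fun j => restrForm (y.conf.1 k.1).hyp (E j)) ⊔
        fixedSys y.conf k.1 = formsOn (y.conf.1 k.1).hyp d := by
    intro k
    have hfin : FiniteDimensional ℂ (y.sys k) := Submodule.finiteDimensional_of_le (y.sys_le k)
    obtain ⟨E₁, hE₁, hs₁⟩ := exists_span_sup_eq (n := 1) (y.fixedSys_le k)
      (by rw [y.sys_rank, finrank_fixedSys hN])
    have hlt := y.sysDim_lt hN k
    obtain ⟨E₂, hE₂, hs₂⟩ := exists_span_sup_eq (n := codimSys N d k.1) (y.sys_le k)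
      (by rw [y.sys_rank, finrank_formsOn hN (h.hyp_eq k.1) (h.good.lin_ne' k.1.2), codimSys]
          omega)
    choose F₂ hF₂ hF₂' using hE₂
    obtain ⟨F₁, hF₁, hF₁'⟩ := y.sys_le k (hE₁ 0)
    refine ⟨Fin.cons ⟨F₁, hF₁⟩ fun i => ⟨F₂ i, hF₂ i⟩, ?_, ?_⟩
    · change restr _ F₁ ∈ _
      rw [hF₁']
      exact hE₁ 0
    · have heq : (fun j => restrForm (y.conf.1 k.1).hyp
          ((Fin.cons ⟨F₁, hF₁⟩ fun i => ⟨F₂ i, hF₂ i⟩ : Fin (_ + 1) → Form N d) j)) =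
          Fin.cons (E₁ 0) E₂ := by
        ext1 j
        induction j using Fin.cases with
        | zero => exact hF₁'
        | succ j => exact hF₂' j
      have hr₁ : Set.range E₁ = {E₁ 0} := by
        ext z
        simp [Fin.exists_fin_one, eq_comm]
      rw [heq, Fin.range_cons, Submodule.span_insert, sup_comm (Submodule.span ℂ {E₁ 0}), sup_assoc,
        ← hr₁, hs₁, hs₂]
  choose E hE₀ hE using H
  refine ⟨E, fun k => ⟨fun F => ?_, hE₀ k⟩⟩
  have hF := restrForm_mem (y.conf.1 k.1).hyp F
  rw [← hE k, Submodule.mem_sup] at hF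
  obtain ⟨u, hu, v, hv, huv⟩ := hF
  have hr : (Set.range fun j => restrForm (y.conf.1 k.1).hyp (E k j)) =
      restrForm (y.conf.1 k.1).hyp '' Set.range (E k) := by
    rw [← Set.range_comp]
    rfl
  rw [hr, Submodule.span_image] at hu
  obtain ⟨G, hG, rfl⟩ := hu
  obtain ⟨c, rfl⟩ := (Submodule.mem_span_range_iff_exists_fun ℂ).1 hG
  refine ⟨c, ?_⟩
  have : restrForm (y.conf.1 k.1).hyp (F - comb E k c) = v := by
    rw [map_sub, ← huv, comb, Fintype.linearCombination_apply, add_sub_cancel_left]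
  rw [this]
  exact hv

section

variable (E : ∀ k : Idx e, Fin (codimSys N d k.1 + 1) → Form N d)

/-- The linear combination of the forms `E k` with leading coefficient one and the other
coefficients given by the coordinates `a`. -/
noncomputable def chartForm (a : Fin (relDim N d e) → ℂ) (k : Idx e) : Form N d :=
  comb E k (Fin.cons 1 fun j => a (chartIndex N d e ⟨k, j⟩))

/-- The domain of a chart. -/
def chartSource : Set (GSpace N d e) :=
  {y | ∀ k, IsTransversal E y.conf k ∧
    ∃ a : Fin (codimSys N d k.1) → ℂ,
      restrForm (y.conf.1 k.1).hyp (comb E k (Fin.cons 1 a)) ∈ y.sys k}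

/-- The range of a chart. -/
def chartTarget : Set (Config N d e × (Fin (relDim N d e) → ℂ)) :=
  {z | ∀ k, IsTransversal E z.1 k}

open Classical in
/-- The coordinates in a chart. -/
noncomputable def chartFun (y : GSpace N d e) : Config N d e × (Fin (relDim N d e) → ℂ) :=
  (y.conf, fun i => if h : y ∈ chartSource E then
    (h ((chartIndex N d e).symm i).1).2.choose ((chartIndex N d e).symm i).2 else 0)

end

variable {E : ∀ k : Idx e, Fin (codimSys N d k.1 + 1) → Form N d}

theorem IsTransversal.chartForm_notMem (hN : 1 ≤ N) {L : Config N d e} {k : Idx e}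
    (hk : sysDim N d (k.1 + 1) + 1 ≤ (N + d - 1).choose (N - 1)) (hT : IsTransversal E L k)
    (a : Fin (codimSys N d k.1) → ℂ) :
    restrForm (L.1 k.1).hyp (comb E k (Fin.cons 1 a)) ∉ fixedSys L k.1 := by
  intro hmem
  have := congrFun (hT.eq_zero hN hk hmem) 0
  simp at this

theorem span_sup_fixedSys_eq (hN : 1 ≤ N) (y : GSpace N d e) (k : Idx e)
    {g : (y.conf.1 k.1).hyp → ℂ} (hg : g ∈ y.sys k) (hg' : g ∉ fixedSys y.conf k.1) :
    Submodule.span ℂ {g} ⊔ fixedSys y.conf k.1 = y.sys k := by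
  have hfin : FiniteDimensional ℂ (y.sys k) := Submodule.finiteDimensional_of_le (y.sys_le k)
  refine Submodule.eq_of_le_of_finrank_eq
    (sup_le ((Submodule.span_singleton_le_iff_mem _ _).2 hg) (y.fixedSys_le k)) ?_
  have h0 : g ≠ 0 := fun h => hg' (h ▸ zero_mem _)
  have hdisj : Submodule.span ℂ {g} ⊓ fixedSys y.conf k.1 = ⊥ :=
    disjoint_iff.1 ((Submodule.disjoint_span_singleton' h0).2 hg').symm
  have h1 := Submodule.finrank_sup_add_finrank_inf_eq (Submodule.span ℂ {g}) (fixedSys y.conf k.1)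
  rw [hdisj, finrank_bot, finrank_span_singleton h0, finrank_fixedSys hN] at h1
  rw [y.sys_rank]
  omega

/-- The coefficients of an element of a linear system in the domain of a chart are proportional to
its coordinates. -/
theorem IsTransversal.coeff_eq (hN : 1 ≤ N) {y : GSpace N d e} {k : Idx e}
    (hT : IsTransversal E y.conf k) {a : Fin (codimSys N d k.1) → ℂ}
    (ha : restrForm (y.conf.1 k.1).hyp (comb E k (Fin.cons 1 a)) ∈ y.sys k) {F : Form N d}
    (hF : restrForm (y.conf.1 k.1).hyp F ∈ y.sys k) {c : Fin (codimSys N d k.1 + 1) → ℂ}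
    (hc : restrForm (y.conf.1 k.1).hyp (F - comb E k c) ∈ fixedSys y.conf k.1) :
    c = c 0 • Fin.cons 1 a := by
  have hk := y.sysDim_lt hN k
  rw [← span_sup_fixedSys_eq hN y k ha (hT.chartForm_notMem hN hk a), Submodule.mem_sup] at hF
  obtain ⟨u, hu, v, hv, huv⟩ := hF
  obtain ⟨s, rfl⟩ := Submodule.mem_span_singleton.1 hu
  have h1 : c = s • Fin.cons 1 a := by
    rw [← sub_eq_zero]
    refine hT.eq_zero hN hk ?_
    have : restrForm (y.conf.1 k.1).hyp (comb E k (c - s • Fin.cons 1 a)) =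
        v - restrForm (y.conf.1 k.1).hyp (F - comb E k c) := by
      rw [map_sub, map_sub, map_sub, map_smul, map_smul, ← huv]
      abel
    rw [this]
    exact sub_mem hv hc
  have h2 := congrFun h1 0
  simp only [Pi.smul_apply, Fin.cons_zero, smul_eq_mul, mul_one] at h2
  rw [h2]
  exact h1

theorem IsTransversal.coord_unique (hN : 1 ≤ N) {y : GSpace N d e} {k : Idx e}
    (hT : IsTransversal E y.conf k) {a a' : Fin (codimSys N d k.1) → ℂ}
    (ha : restrForm (y.conf.1 k.1).hyp (comb E k (Fin.cons 1 a)) ∈ y.sys k)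
    (ha' : restrForm (y.conf.1 k.1).hyp (comb E k (Fin.cons 1 a')) ∈ y.sys k) : a' = a := by
  have h1 := hT.coeff_eq hN ha ha' (c := Fin.cons 1 a') (by rw [sub_self, map_zero]; exact zero_mem _)
  rw [Fin.cons_zero, one_smul] at h1
  exact (Fin.cons_inj.1 h1).2

theorem chartFun_spec {y : GSpace N d e} (hy : y ∈ chartSource E) (k : Idx e) :
    restrForm (y.conf.1 k.1).hyp (chartForm E (chartFun E y).2 k) ∈ y.sys k := by
  have h1 := (hy k).2.choose_spec
  have h2 : (fun j => (chartFun E y).2 (chartIndex N d e ⟨k, j⟩)) = (hy k).2.choose := by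
    ext j
    simp only [chartFun, dif_pos hy]
    exact congrArg (fun s : Σ k : Idx e, Fin (codimSys N d k.1) => (hy s.1).2.choose s.2)
      ((chartIndex N d e).symm_apply_apply ⟨k, j⟩)
  rw [chartForm, h2]
  exact h1

theorem GSpace.ext_sys {y y' : GSpace N d e} (h : y.conf = y'.conf)
    (hs : ∀ k, HEq (y.sys k) (y'.sys k)) : y = y' := by
  obtain ⟨c, s, _, _, _⟩ := y
  obtain ⟨c', s', _, _, _⟩ := y'
  obtain rfl : c = c' := h
  obtain rfl : s = s' := funext fun k => eq_of_heq (hs k)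
  rfl

open Classical in
/-- The inverse of a chart. -/
noncomputable def chartInv (hN : 1 ≤ N)
    (hk : ∀ k : Idx e, sysDim N d (k.1 + 1) + 1 ≤ (N + d - 1).choose (N - 1)) (y₀ : GSpace N d e)
    (E : ∀ k : Idx e, Fin (codimSys N d k.1 + 1) → Form N d)
    (z : Config N d e × (Fin (relDim N d e) → ℂ)) : GSpace N d e :=
  if h : z ∈ chartTarget E then
    mkG hN z.1 (fun k => restrForm (z.1.1 k.1).hyp (chartForm E z.2 k))
      (fun _ => restrForm_mem _ _) (fun k => (h k).chartForm_notMem hN (hk k) _)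
  else y₀

/-- The conditions for belonging to the domain of a chart in terms of coefficients. -/
theorem mem_chartSource_of_coeff {y : GSpace N d e} (hT : ∀ k, IsTransversal E y.conf k)
    (H : ∀ k, ∃ (F : Form N d) (c : Fin (codimSys N d k.1 + 1) → ℂ), c 0 ≠ 0 ∧
      restrForm (y.conf.1 k.1).hyp F ∈ y.sys k ∧
      restrForm (y.conf.1 k.1).hyp (F - comb E k c) ∈ fixedSys y.conf k.1) :
    y ∈ chartSource E := by
  refine fun k => ⟨hT k, ?_⟩
  obtain ⟨F, c, hc0, hF, hc⟩ := H k
  refine ⟨fun j => (c 0)⁻¹ * c j.succ, ?_⟩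
  have h1 : (Fin.cons 1 fun j => (c 0)⁻¹ * c j.succ : Fin (codimSys N d k.1 + 1) → ℂ) =
      (c 0)⁻¹ • c := by
    ext j
    induction j using Fin.cases with
    | zero => simp [hc0]
    | succ j => simp
  rw [h1, map_smul, map_smul]
  refine Submodule.smul_mem _ _ ?_
  have h2 : restrForm (y.conf.1 k.1).hyp (comb E k c) = restrForm (y.conf.1 k.1).hyp F -
      restrForm (y.conf.1 k.1).hyp (F - comb E k c) := by
    rw [← map_sub, sub_sub_cancel]
  rw [h2]
  exact sub_mem hF (y.fixedSys_le k hc)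

theorem GRel.mem_sys {D : GCoord N d e} {y : GSpace N d e} (h : GRel D y) (k : Idx e)
    (m : Fin (sysDim N d (k.1 + 1) + 1)) : restrForm (y.conf.1 k.1).hyp (D.2 k m) ∈ y.sys k := by
  rw [h.2 k]
  exact Submodule.subset_span ⟨m, rfl⟩

/-- Around a point of the domain of a chart, one of the forms of every linear system has nonzero
leading coefficient, and the coefficients are rational functions. -/
theorem exists_chart_coefficients (hN : 1 ≤ N) (hd : 1 ≤ d) {D₀ : GCoord N d e} {y₀ : GSpace N d e}
    (hD₀ : GRel D₀ y₀) (hy₀ : y₀ ∈ chartSource E) (k : Idx e) :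
    ∃ (m : Fin (sysDim N d (k.1 + 1) + 1)) (ε : GCoord N d e → Fin (codimSys N d k.1 + 1) → ℂ),
      (∀ j, (fun D => ε D j) ∈ ratAt D₀) ∧ ε D₀ 0 ≠ 0 ∧
      ∃ h ∈ polyFun (GCoord N d e), h D₀ ≠ 0 ∧ ∀ D y, GRel D y → h D ≠ 0 →
        IsTransversal E y.conf k ∧ restrForm (y.conf.1 k.1).hyp (D.2 k m - comb E k (ε D)) ∈
          fixedSys y.conf k.1 := by
  obtain ⟨hT, a, ha⟩ := hy₀ k
  obtain ⟨ε, h, hh, h0, hε, hrel⟩ := exists_coefficients hd hD₀.1 k hT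
  -- If all leading coefficients were zero, all coefficients would be, and the linear system would
  -- lie in its fixed part.
  obtain ⟨m, hm⟩ : ∃ m, ε (D₀.1, D₀.2 k m) 0 ≠ 0 := by
    by_contra! hall
    have hle : y₀.sys k ≤ fixedSys y₀.conf k.1 := by
      rw [hD₀.2 k, Submodule.span_le]
      rintro _ ⟨m, rfl⟩
      have h1 := hrel D₀.1 y₀.conf hD₀.1 h0 (D₀.2 k m)
      have h2 := hT.coeff_eq hN ha (hD₀.mem_sys k m) h1
      rw [hall m, zero_smul] at h2
      rwa [h2, map_zero, sub_zero] at h1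
    exact hT.chartForm_notMem hN (y₀.sysDim_lt hN k) a (hle ha)
  let Δ : GCoord N d e →ₗ[ℂ] ConfigCoord N d e × Form N d :=
    LinearMap.prod (LinearMap.fst ℂ _ _) (LinearMap.proj m ∘ₗ LinearMap.proj k ∘ₗ LinearMap.snd ℂ _ _)
  have hΔ : ∀ D, Δ D = (D.1, D.2 k m) := fun D => rfl
  have hfst : MapIn (polyFun (GCoord N d e)) fun D => D.1 :=
    mapIn_fst
  refine ⟨m, fun D => ε (Δ D), fun j => ?_, hm, fun D => h D.1, polyFun_comp hfst hh, h0,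
    fun D y hD hne => ⟨fun F => ⟨_, hrel D.1 y.conf hD.1 hne F⟩,
      hrel D.1 y.conf hD.1 hne (D.2 k m)⟩⟩
  exact ratAt_comp (D₀ := D₀) ((MapIn.linearMap Δ).mono (polyFun_le_ratAt _)) (hε _ j)

/-- The projection `τ` is smooth. -/
theorem isSmoothOfRelDim_tau (hN : 1 ≤ N) (hd : 1 ≤ d) :
    IsSmoothOfRelDim (GRel (N := N) (d := d) (e := e)) ConfigRel tau (relDim N d e) := by
  intro y
  have hk := y.sysDim_lt hN
  obtain ⟨E, hE⟩ := y.exists_chartForms hN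
  have hinv : ∀ {z} (hz : z ∈ chartTarget E), chartInv hN hk y E z =
      mkG hN z.1 (fun k => restrForm (z.1.1 k.1).hyp (chartForm E z.2 k))
        (fun k => restrForm_mem _ _) (fun k => (hz k).chartForm_notMem hN (hk k) _) :=
    fun hz => dif_pos hz
  have hmapsψ : Set.MapsTo (chartInv hN hk y E) (chartTarget E) (chartSource E) := by
    intro z hz k
    rw [hinv hz]
    exact ⟨hz k, _, mem_sys_mkG k⟩
  refine ⟨chartSource E, chartTarget E, chartFun E, chartInv hN hk y E, ?_, ?_, ?_,
    fun y' hy' k => (hy' k).1, hmapsψ, ⟨?_, ?_⟩, ?_, ?_, fun _ _ => rfl⟩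
  · rw [isOpen_zariski_iff]
    intro D₀ y₀ hy₀ hD₀
    choose m ε hε hε0 h hh h0 hrel using exists_chart_coefficients hN hd hD₀ hy₀
    choose p hp hp0 hpne using fun k => exists_polyFun_of_ratAt (hε k 0) (hε0 k)
    refine ⟨fun D => ∏ k, (h k D * p k D), prod_mem_subalgebra _ fun k _ => mul_mem (hh k) (hp k),
      Finset.prod_ne_zero_iff.2 fun k _ => mul_ne_zero (h0 k) (hp0 k), fun D y' hD hne => ?_⟩
    have hne' := fun k => Finset.prod_ne_zero_iff.1 hne k (Finset.mem_univ k)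
    refine mem_chartSource_of_coeff
      (fun k => (hrel k D y' hD (left_ne_zero_of_mul (hne' k))).1) fun k =>
        ⟨D.2 k (m k), ε k D, hpne k D (right_ne_zero_of_mul (hne' k)), hD.mem_sys k _,
          (hrel k D y' hD (left_ne_zero_of_mul (hne' k))).2⟩
  · refine fun k => ⟨(hE k).1, 0, ?_⟩
    have : comb E k (Fin.cons 1 0) = E k 0 := by
      rw [comb, Fintype.linearCombination_apply, Fin.sum_univ_succ]
      simp
    rw [this]
    exact (hE k).2
  · rw [isOpen_zariski_iff]
    intro D₀ z₀ hz₀ hD₀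
    choose ε h hh h0 hε hrel using fun k => exists_coefficients hd hD₀.1 k (hz₀ k)
    have hfst : MapIn (polyFun (ConfigCoord N d e × (Fin (relDim N d e) → ℂ))) fun D => D.1 :=
      mapIn_fst
    refine ⟨fun D => ∏ k, h k D.1, prod_mem_subalgebra _ fun k _ => polyFun_comp hfst (hh k),
      Finset.prod_ne_zero_iff.2 fun k _ => h0 k, fun D z hD hne k F => ⟨_, hrel k D.1 z.1 hD.1
        (Finset.prod_ne_zero_iff.1 hne k (Finset.mem_univ k)) F⟩⟩
  · intro y' hy'
    have hz : chartFun E y' ∈ chartTarget E := fun k => (hy' k).1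
    rw [hinv hz]
    refine GSpace.ext_sys rfl fun k => heq_of_eq ?_
    exact span_sup_fixedSys_eq hN y' k (chartFun_spec hy' k)
      ((hy' k).1.chartForm_notMem hN (hk k) _)
  · intro z hz
    have hy' := hmapsψ hz
    have hconf : (chartInv hN hk y E z).conf = z.1 := by rw [hinv hz]; rfl
    refine Prod.ext hconf (funext fun i => ?_)
    obtain ⟨⟨k, j⟩, rfl⟩ := (chartIndex N d e).surjective i
    have h1 := chartFun_spec hy' k
    have h2 : restrForm ((chartInv hN hk y E z).conf.1 k.1).hyp (chartForm E z.2 k) ∈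
        (chartInv hN hk y E z).sys k := by
      rw [hinv hz]
      exact mem_sys_mkG k
    exact congrFun ((hy' k).1.coord_unique hN h2 h1) j
  · refine isRegularOn_of_mapIn fun D₀ y₀ hy₀ hD₀ => ?_
    choose m ε hε hε0 h hh h0 hrel using exists_chart_coefficients hN hd hD₀ hy₀
    choose p hp hp0 hpne using fun k => exists_polyFun_of_ratAt (hε k 0) (hε0 k)
    refine ⟨fun D => (D.1, fun i => (ε ((chartIndex N d e).symm i).1 D 0)⁻¹ *
      ε ((chartIndex N d e).symm i).1 D ((chartIndex N d e).symm i).2.succ), ?_,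
      fun D => ∏ k, (h k D * p k D), prod_mem_subalgebra _ fun k _ => mul_mem (hh k) (hp k),
      Finset.prod_ne_zero_iff.2 fun k _ => mul_ne_zero (h0 k) (hp0 k), fun D y' hy' hD hne => ?_⟩
    · have hfst : MapIn (polyFun (GCoord N d e)) fun D => D.1 :=
        mapIn_fst
      exact (hfst.mono (polyFun_le_ratAt _)).prodMk (MapIn.pi fun i => mapIn_scalar.2
        (mul_mem (inv_mem_ratAt (hε _ 0) (hε0 _)) (hε _ _)))
    · have hne' := fun k => Finset.prod_ne_zero_iff.1 hne k (Finset.mem_univ k)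
      refine ⟨hD.1, funext fun i => ?_⟩
      obtain ⟨⟨k, j⟩, rfl⟩ := (chartIndex N d e).surjective i
      have h1 := (hrel k D y' hD (left_ne_zero_of_mul (hne' k))).2
      have h2 := (hy' k).1.coeff_eq hN (chartFun_spec hy' k) (hD.mem_sys k _) h1
      have h3 := congrFun h2 j.succ
      have h4 := hpne k D (right_ne_zero_of_mul (hne' k))
      simp only [Pi.smul_apply, Fin.cons_succ, smul_eq_mul] at h3
      refine (congrArg (fun s : Σ k : Idx e, Fin (codimSys N d k.1) =>
        (ε s.1 D 0)⁻¹ * ε s.1 D s.2.succ) ((chartIndex N d e).symm_apply_apply ⟨k, j⟩)).trans ?_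
      simp only
      rw [h3, ← mul_assoc, inv_mul_cancel₀ h4, one_mul]
  · refine isRegularOn_of_mapIn fun D₀ z₀ hz₀ hD₀ => ?_
    choose ρ w hw hρ using fun k : Idx e => exists_projection_lin hD₀.1.good k.1
    have hfst : MapIn (polyFun (ConfigCoord N d e × (Fin (relDim N d e) → ℂ))) fun D => D.1 :=
      mapIn_fst
    refine ⟨fun D => (D.1, fun k => Fin.cons (chartForm E D.2 k)
      (fixedForm (d := d) hN (lin D.1) (ρ k) k.1)), ?_,
      fun D => ∏ k : Idx e, lin D.1 k.1 (w k), prod_mem_subalgebra _ fun k _ =>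
        polyFun_comp hfst (lin_apply_mem _ _), Finset.prod_ne_zero_iff.2 fun k _ => hw k,
      fun D z hz hD hne => ?_⟩
    · refine MapIn.mono (polyFun_le_ratAt _) (hfst.prodMk (MapIn.pi fun k => MapIn.pi fun m => ?_))
      induction m using Fin.cases with
      | zero =>
        refine MapIn.linear (MapIn.pi fun j => ?_) (comb E k)
        induction j using Fin.cases with
        | zero => exact MapIn.const _ _
        | succ j => exact MapIn.linearMap (LinearMap.proj (chartIndex N d e ⟨k, j⟩) ∘ₗ
            LinearMap.snd ℂ (ConfigCoord N d e) (Fin (relDim N d e) → ℂ))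
      | succ m => exact hfst.comp (mapIn_fixedForm hN (ρ k) k.1 m)
    · rw [hinv hz]
      have h2 : D.2 = z.2 := hD.2
      exact gRel_mkG hN hD.1 (fun k => by rw [h2]; rfl) fun k =>
        hρ k D.1 (Finset.prod_ne_zero_iff.1 hne k (Finset.mem_univ k))

end ChartConstruction

/-! ### Codimension of loci that are locally given by few equations -/

section Codim

variable {M X Γ : Type*} [AddCommGroup M] [Module ℂ M] [AddCommGroup Γ] [Module ℂ Γ]
  {rel : M → X → Prop}

/-- Polynomial families of changes of coordinates, which act transitively on the systems of
coordinates of every point. -/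
structure CoordChange (Γ : Type*) [AddCommGroup Γ] [Module ℂ Γ] (rel : M → X → Prop) where
  act : Γ → M → M
  den : Γ → ℂ
  mapIn_act : ∀ γ, MapIn (polyFun M) (act γ)
  mapIn_orbit : ∀ D, MapIn (polyFun Γ) fun γ => act γ D
  den_mem : den ∈ polyFun Γ
  rel_act : ∀ γ D x, den γ ≠ 0 → rel D x → rel (act γ D) x
  exists_act_eq : ∀ D D' x, rel D x → rel D' x → ∃ γ, den γ ≠ 0 ∧ act γ D = D'

/-- The ideal of the polynomial functions that vanish on all coordinates of the points of `T`. -/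
def coordIdeal (rel : M → X → Prop) (T : Set X) : Ideal (polyFun M) where
  carrier := {p | ∀ D x, rel D x → x ∈ T → (p : M → ℂ) D = 0}
  add_mem' {p q} hp hq D x hD hx := by
    change (p : M → ℂ) D + (q : M → ℂ) D = 0
    rw [hp D x hD hx, hq D x hD hx, add_zero]
  zero_mem' _ _ _ _ := rfl
  smul_mem' c p hp D x hD hx := by
    change (c : M → ℂ) D * (p : M → ℂ) D = 0
    rw [hp D x hD hx, mul_zero]

theorem coordIdeal_anti {T T' : Set X} (h : T ⊆ T') : coordIdeal rel T' ≤ coordIdeal rel T :=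
  fun _ hp D x hD hx => hp D x hD (h hx)

/-- Any coordinates of the point are carried by some change γ to ones where `p` is nonzero; pulling
`p` back by γ gives a neighbourhood. So the map from coordinates to points is open. -/
theorem CoordChange.isOpen_image (κ : CoordChange Γ rel) {p : M → ℂ} (hp : p ∈ polyFun M) :
    IsOpen[zariski rel] {x | ∃ D, rel D x ∧ p D ≠ 0} := by
  rw [isOpen_zariski_iff]
  rintro D₀ x₀ ⟨D₁, hD₁, hne⟩ hD₀
  obtain ⟨γ, hγ, rfl⟩ := κ.exists_act_eq D₀ D₁ x₀ hD₀ hD₁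
  exact ⟨fun D => p (κ.act γ D), polyFun_comp (κ.mapIn_act γ) hp, hne,
    fun D x hD hne' => ⟨_, κ.rel_act γ D x hγ hD, hne'⟩⟩

/-- If neither of two functions vanishes on all coordinates over `T`, then by openness and
irreducibility both are nonzero somewhere over a common point x. The coordinates of x are an orbit
parametrized by an open part of affine space, so the functions are nonzero at a common system of
coordinates. -/
theorem CoordChange.isPrime_coordIdeal [Module.Finite ℂ Γ] (κ : CoordChange Γ rel)
    (hsurj : ∀ x, ∃ D, rel D x) {T : Set X} (hT : @IsIrreducible X (zariski rel) T) :
    (coordIdeal rel T).IsPrime := by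
  refine (Ideal.isPrime_iff).2 ⟨fun h => ?_, fun {p q} hpq => ?_⟩
  · obtain ⟨x, hx⟩ := hT.1
    obtain ⟨D, hD⟩ := hsurj x
    exact one_ne_zero ((Ideal.eq_top_iff_one _).1 h D x hD hx)
  · by_contra! hne
    obtain ⟨h1, h2⟩ := hne
    have key : ∀ r : polyFun M, r ∉ coordIdeal rel T →
        (T ∩ {x | ∃ D, rel D x ∧ (r : M → ℂ) D ≠ 0}).Nonempty := by
      intro r hr
      by_contra hemp
      refine hr fun D x hD hx => ?_
      by_contra h0
      exact hemp ⟨x, hx, D, hD, h0⟩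
    obtain ⟨x, hx, ⟨D₁, hD₁, h1'⟩, ⟨D₂, hD₂, h2'⟩⟩ := hT.2 _ _ (κ.isOpen_image p.2)
      (κ.isOpen_image q.2) (key p h1) (key q h2)
    obtain ⟨γ₁, hγ₁, e₁⟩ := κ.exists_act_eq D₁ D₁ x hD₁ hD₁
    obtain ⟨γ₂, hγ₂, e₂⟩ := κ.exists_act_eq D₁ D₂ x hD₁ hD₂
    have hp := polyFun_comp (κ.mapIn_orbit D₁) p.2
    have hq := polyFun_comp (κ.mapIn_orbit D₁) q.2
    obtain ⟨γ₃, hγ₃⟩ := exists_ne_zero_of_polyFun hp hq ⟨γ₁, by rwa [e₁]⟩ ⟨γ₂, by rwa [e₂]⟩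
    obtain ⟨γ, hγ, hγ'⟩ := exists_ne_zero_of_polyFun (mul_mem hp hq) κ.den_mem
      ⟨γ₃, mul_ne_zero hγ₃.1 hγ₃.2⟩ ⟨γ₁, hγ₁⟩
    exact hγ (hpq _ x (κ.rel_act γ D₁ x hγ' hD₁) hx)

theorem mem_iff_coordIdeal {T : Set X} (hT : IsClosed[zariski rel] T) {D : M} {x : X}
    (hD : rel D x) : x ∈ T ↔ ∀ p ∈ coordIdeal rel T, (p : M → ℂ) D = 0 := by
  refine ⟨fun hx p hp => hp D x hD hx, fun H => ?_⟩
  by_contra hx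
  have hT' : IsOpen[zariski rel] Tᶜ := (@isOpen_compl_iff _ _ (zariski rel)).2 hT
  obtain ⟨h, hh, h0, hU⟩ := isOpen_zariski_iff.1 hT' D x hx hD
  refine h0 (H ⟨h, hh⟩ fun D' x' hD' hx' => ?_)
  by_contra hne
  exact hU D' x' hD' hne hx'

theorem CoordChange.coordIdeal_closure (κ : CoordChange Γ rel) (T : Set X) :
    coordIdeal rel (@closure X (zariski rel) T) = coordIdeal rel T := by
  let := zariski rel
  refine le_antisymm (coordIdeal_anti subset_closure) fun p hp D x hD hx => ?_
  by_contra hne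
  obtain ⟨x', ⟨D', hD', hne'⟩, hx'⟩ := mem_closure_iff.1 hx _ (κ.isOpen_image p.2) ⟨D, hD, hne⟩
  exact hne' (hp D' x' hD' hx')

/-- The codimension of an irreducible subset is at most the height of its ideal in the coordinate
ring. -/
theorem CoordChange.codim_le_height [Module.Finite ℂ Γ] (κ : CoordChange Γ rel)
    (hsurj : ∀ x, ∃ D, rel D x) {T : Set X} (hT : @IsIrreducible X (zariski rel) T) :
    @codim X (zariski rel) T hT ≤
      ((coordIdeal rel T).map (Ideal.Quotient.mk (coordIdeal rel Set.univ))).height := by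
  let := zariski rel
  have hprime : ∀ s : IrreducibleCloseds X,
      ((coordIdeal rel (s : Set X)).map (Ideal.Quotient.mk (coordIdeal rel Set.univ))).IsPrime := by
    intro s
    have := κ.isPrime_coordIdeal hsurj s.isIrreducible
    exact Ideal.map_isPrime_of_surjective Ideal.Quotient.mk_surjective
      (by rw [Ideal.mk_ker]; exact coordIdeal_anti (Set.subset_univ _))
  have hcomap : ∀ s : Set X,
      ((coordIdeal rel s).map (Ideal.Quotient.mk (coordIdeal rel Set.univ))).comap
        (Ideal.Quotient.mk (coordIdeal rel Set.univ)) = coordIdeal rel s := by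
    intro s
    rw [Ideal.comap_map_of_surjective' _ Ideal.Quotient.mk_surjective, Ideal.mk_ker,
      sup_eq_left]
    exact coordIdeal_anti (Set.subset_univ _)
  -- Chains of irreducible closed sets above the closure of `T` become strict chains of primes below
  -- its ideal; strictness holds because a closed set is recovered from its ideal.
  let φ : (IrreducibleCloseds X)ᵒᵈ → PrimeSpectrum (polyFun M ⧸ coordIdeal rel Set.univ) :=
    fun s => ⟨_, hprime (OrderDual.ofDual s)⟩
  have hφ : StrictMono φ := by
    intro s t hst
    have hlt : ((OrderDual.ofDual t : IrreducibleCloseds X) : Set X) ⊂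
        (OrderDual.ofDual s : IrreducibleCloseds X) := hst
    refine lt_of_le_not_ge (Ideal.map_mono (coordIdeal_anti hlt.1)) fun hle => hlt.2 fun x hx => ?_
    have hle' := Ideal.comap_mono (f := Ideal.Quotient.mk (coordIdeal rel Set.univ)) hle
    change Ideal.comap _ (Ideal.map _ _) ≤ Ideal.comap _ (Ideal.map _ _) at hle'
    rw [hcomap, hcomap] at hle'
    obtain ⟨D, hD⟩ := hsurj x
    exact (mem_iff_coordIdeal (OrderDual.ofDual t).isClosed hD).2 fun p hp =>
      hle' hp D x hD hx
  have h1 := Order.height_le_height_apply_of_strictMono φ hφ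
    (OrderDual.toDual ⟨closure T, hT.closure, isClosed_closure⟩)
  refine h1.trans (le_of_eq ?_)
  have h2 : (φ (OrderDual.toDual ⟨closure T, hT.closure, isClosed_closure⟩)).asIdeal =
      (coordIdeal rel T).map (Ideal.Quotient.mk (coordIdeal rel Set.univ)) := by
    change (coordIdeal rel (closure T)).map _ = _
    rw [κ.coordIdeal_closure]
  rw [← h2]
  exact (PrimeSpectrum.height_eq_orderHeight (R := polyFun M ⧸ coordIdeal rel Set.univ) _).symm

/-- If a subset `A` of `X` is locally given by `f` equations, then the components of `A` have
codimension at most `f`. -/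
theorem CoordChange.codim_component_le [Module.Finite ℂ Γ] [Module.Finite ℂ M]
    (κ : CoordChange Γ rel) (hsurj : ∀ x, ∃ D, rel D x)
    {A : Set X} {f : ℕ}
    (hA : ∀ D₀, ∀ x₀ ∈ A, rel D₀ x₀ → ∃ h ∈ polyFun M, h D₀ ≠ 0 ∧ ∃ g : Fin f → M → ℂ,
      (∀ i, g i ∈ polyFun M) ∧ (∀ D, ∀ x ∈ A, rel D x → h D ≠ 0 → ∀ i, g i D = 0) ∧
      ∀ D, (∀ p ∈ polyFun M, (∀ D' x, rel D' x → p D' = 0) → p D = 0) → h D ≠ 0 →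
        (∀ i, g i D = 0) → ∃ x ∈ A, rel D x)
    {Z : Set A} (hZ : letI := zariski rel; Z ∈ irreducibleComponents A) :
    @codim X (zariski rel) (Subtype.val '' Z) (letI := zariski rel; isIrreducible_image hZ) ≤ f := by
  let := zariski rel
  have hZ' : IsIrreducible (Subtype.val '' Z) := isIrreducible_image hZ
  refine (κ.codim_le_height hsurj hZ').trans ?_
  have hp := κ.isPrime_coordIdeal hsurj hZ'
  obtain ⟨z₀, hz₀⟩ := hZ.1.1
  obtain ⟨D₀, hD₀⟩ := hsurj z₀
  obtain ⟨h, hh, h0, g, hg, hgA, hAg⟩ := hA D₀ z₀ z₀.2 hD₀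
  have hh' : (⟨h, hh⟩ : polyFun M) ∉ coordIdeal rel (Subtype.val '' Z) := fun hmem =>
    h0 (hmem D₀ z₀ hD₀ ⟨z₀, hz₀, rfl⟩)
  let s : Set (polyFun M) := Set.range fun i => ⟨g i, hg i⟩
  have hs : ∀ i, (⟨g i, hg i⟩ : polyFun M) ∈ coordIdeal rel (Subtype.val '' Z) := by
    intro i
    refine (hp.mem_or_mem (x := ⟨h, hh⟩) fun D x hD hx => ?_).resolve_left hh'
    obtain ⟨z, hz, rfl⟩ := hx
    by_cases hne : h D = 0
    · exact mul_eq_zero_of_left hne _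
    · exact mul_eq_zero_of_right _ (hgA D z z.2 hD hne i)
  -- The equations `g` only describe `A` where `h ≠ 0`, but a smaller prime q cannot contain `h`.
  -- The points of q with `h ≠ 0` form an irreducible subset of `A` whose closure contains `Z`, so
  -- they lie in `Z` by maximality, and the Nullstellensatz gives equality of the ideals.
  have hmin : coordIdeal rel (Subtype.val '' Z) ∈
      (Ideal.span s ⊔ coordIdeal rel Set.univ).minimalPrimes := by
    refine ⟨⟨hp, sup_le (Ideal.span_le.2 ?_) (coordIdeal_anti (Set.subset_univ _))⟩, ?_⟩
    · rintro _ ⟨i, rfl⟩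
      exact hs i
    rintro q ⟨hq, hJq⟩ hqp
    have hhq : (⟨h, hh⟩ : polyFun M) ∉ q := fun hmem => hh' (hqp hmem)
    have hzero : ∀ r : polyFun M, r ∉ q →
        ∃ D, (∀ c ∈ q, (c : M → ℂ) D = 0) ∧ (r : M → ℂ) D ≠ 0 := by
      intro r hr
      by_contra! hall
      exact hr (mem_of_vanishes_on_zeros q hall)
    have hpoint : ∀ D, (∀ c ∈ q, (c : M → ℂ) D = 0) → h D ≠ 0 → ∃ x ∈ A, rel D x :=
      fun D hD hne => hAg D (fun p hp' hvan => hD ⟨p, hp'⟩ (hJq (Ideal.mem_sup_right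
        fun D' x hD' _ => hvan D' x hD'))) hne fun i => hD _ (hJq (Ideal.mem_sup_left
          (Ideal.subset_span ⟨i, rfl⟩)))
    let W : Set A := {z | ∃ D, rel D z ∧ (∀ c ∈ q, (c : M → ℂ) D = 0) ∧ h D ≠ 0}
    have hmeet : ∀ r : polyFun M, r ∉ q → ∃ D, ∃ z ∈ W, rel D z ∧ (r : M → ℂ) D ≠ 0 := by
      intro r hr
      obtain ⟨D, hD, hne⟩ := hzero (⟨h, hh⟩ * r) (hq.mul_notMem hhq hr)
      obtain ⟨x, hx, hrel⟩ := hpoint D hD (left_ne_zero_of_mul hne)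
      exact ⟨D, ⟨x, hx⟩, ⟨D, hrel, hD, left_ne_zero_of_mul hne⟩, hrel, right_ne_zero_of_mul hne⟩
    have hopen : ∀ U : Set A, IsOpen U → ∀ D, ∀ z ∈ U, rel D z → ∃ r : polyFun M,
        (r : M → ℂ) D ≠ 0 ∧ ∀ D' (z' : A), rel D' z' → (r : M → ℂ) D' ≠ 0 → z' ∈ U := by
      rintro U ⟨U', hU', rfl⟩ D z hz hD
      obtain ⟨r, hr, hr0, hrU⟩ := isOpen_zariski_iff.1 hU' D z hz hD
      exact ⟨⟨r, hr⟩, hr0, fun D' z' hD' hne => hrU D' z' hD' hne⟩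
    have hWirr : IsIrreducible W := by
      constructor
      · obtain ⟨D, z, hz, -⟩ := hmeet ⟨h, hh⟩ hhq
        exact ⟨z, hz⟩
      · rintro U₁ U₂ hU₁ hU₂ ⟨z₁, ⟨D₁, hD₁, hq₁, -⟩, hz₁⟩ ⟨z₂, ⟨D₂, hD₂, hq₂, -⟩, hz₂⟩
        obtain ⟨r₁, hr₁, hU₁'⟩ := hopen U₁ hU₁ D₁ z₁ hz₁ hD₁
        obtain ⟨r₂, hr₂, hU₂'⟩ := hopen U₂ hU₂ D₂ z₂ hz₂ hD₂
        obtain ⟨D, z, hz, hD, hne⟩ := hmeet (r₁ * r₂)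
          (hq.mul_notMem (fun hmem => hr₁ (hq₁ _ hmem)) fun hmem => hr₂ (hq₂ _ hmem))
        exact ⟨z, hz, hU₁' D z hD (left_ne_zero_of_mul hne),
          hU₂' D z hD (right_ne_zero_of_mul hne)⟩
    have hZW : Z ⊆ closure W := by
      intro z hz
      rw [mem_closure_iff]
      intro U hU hzU
      obtain ⟨D, hD⟩ := hsurj z
      obtain ⟨r, hr, hU'⟩ := hopen U hU D z hzU hD
      obtain ⟨D', z', hz', hD', hne⟩ := hmeet r
        fun hmem => hr (hqp hmem D z hD ⟨z, hz, rfl⟩)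
      exact ⟨z', hU' D' z' hD' hne, hz'⟩
    have hWZ : W ⊆ Z := subset_closure.trans (hZ.2 hWirr.closure hZW)
    intro P hP
    refine (hq.mem_or_mem (x := ⟨h, hh⟩) (mem_of_vanishes_on_zeros q fun D hD => ?_)).resolve_left
      hhq
    by_cases hne : h D = 0
    · exact mul_eq_zero_of_left hne _
    · obtain ⟨x, hx, hrel⟩ := hpoint D hD hne
      exact mul_eq_zero_of_right _
        (hP D x hrel ⟨⟨x, hx⟩, hWZ ⟨D, hrel, hD, hne⟩, rfl⟩)
  have hmap : (coordIdeal rel (Subtype.val '' Z)).map (Ideal.Quotient.mk (coordIdeal rel Set.univ)) ∈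
      Ideal.minimalPrimes (R := polyFun M ⧸ coordIdeal rel Set.univ)
        (Ideal.span (Ideal.Quotient.mk (coordIdeal rel Set.univ) '' s)) := by
    rw [← Ideal.map_span, Ideal.minimalPrimes_map_of_surjective Ideal.Quotient.mk_surjective,
      Ideal.mk_ker]
    exact ⟨_, hmin, rfl⟩
  refine (Ideal.height_le_card_of_mem_minimalPrimes_span
    ((Set.finite_range _).image _) hmap).trans ?_
  have h1 := Set.ncard_image_le (f := Ideal.Quotient.mk (coordIdeal rel Set.univ)) (s := s)
    (Set.finite_range _)
  have h2 : s.ncard ≤ f := by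
    rw [show s = _ from Set.image_univ.symm]
    refine (Set.ncard_image_le Set.finite_univ).trans ?_
    rw [Set.ncard_univ, Nat.card_eq_fintype_card, Fintype.card_fin]
  exact_mod_cast h1.trans h2

end Codim

/-! ### Irreducibility is an open condition -/

section IrreducibleForms

variable {σ : Type*} [Fintype σ]

/-- Polynomials with coefficients indexed by pairs of monomials. -/
noncomputable def pairCoeff (a b : ℕ) (s : σ →₀ ℕ) :
    MvPolynomial (degMonomials σ a × degMonomials σ b) ℂ := by
  classical
  exact ∑ p, if p.1.1 + p.2.1 = s then X p else 0

theorem pairCoeff_isHomogeneous (a b : ℕ) (s : σ →₀ ℕ) :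
    (pairCoeff a b s).IsHomogeneous 1 := by
  classical
  refine IsHomogeneous.sum _ _ _ fun p _ => ?_
  split_ifs
  · exact isHomogeneous_X _ _
  · exact isHomogeneous_zero _ _ _

theorem eval_pairCoeff {a b : ℕ} (c : degMonomials σ a × degMonomials σ b → ℂ) (s : σ →₀ ℕ) :
    eval c (pairCoeff a b s) = coeff s (∑ p, monomial (p.1.1 + p.2.1) (c p)) := by
  classical
  rw [pairCoeff, map_sum, coeff_sum]
  refine Finset.sum_congr rfl fun p _ => ?_
  rw [coeff_monomial]
  split_ifs <;> simp

theorem sum_monomial_mul {a b : ℕ} (u : degMonomials σ a → ℂ) (v : degMonomials σ b → ℂ) :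
    (∑ s, monomial s.1 (u s)) * ∑ t, monomial t.1 (v t) =
      ∑ p : degMonomials σ a × degMonomials σ b, monomial (p.1.1 + p.2.1) (u p.1 * v p.2) := by
  rw [Finset.sum_mul_sum, Fintype.sum_prod_type]
  simp only [monomial_mul]

theorem sum_monomial_isHomogeneous {a : ℕ} (u : degMonomials σ a → ℂ) :
    (∑ s, monomial s.1 (u s)).IsHomogeneous a :=
  IsHomogeneous.sum _ _ _ fun s _ => isHomogeneous_monomial _ (mem_degMonomials.1 s.2)

theorem sum_monomial_ne_zero {a : ℕ} {u : degMonomials σ a → ℂ} {s : degMonomials σ a}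
    (h : u s ≠ 0) : ∑ s, monomial s.1 (u s) ≠ 0 := by
  classical
  intro h0
  have h1 := congrArg (coeff s.1) h0
  rw [coeff_sum, Finset.sum_eq_single s (fun t _ hts => by
    rw [coeff_monomial, if_neg fun h' => hts (Subtype.ext h')]) (by simp), coeff_monomial,
    if_pos rfl, coeff_zero] at h1
  exact h h1

theorem exists_sum_monomial {a : ℕ} {F : MvPolynomial σ ℂ} (hF : F.IsHomogeneous a) :
    F = ∑ s : degMonomials σ a, monomial s.1 (coeff s.1 F) := by
  conv_lhs => rw [sum_degMonomials hF]
  exact (Finset.sum_coe_sort (degMonomials σ a) fun s => monomial s (coeff s F)).symm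

omit [Fintype σ] in
theorem not_isUnit_of_isHomogeneous {F : MvPolynomial σ ℂ} {n : ℕ} (hF : F.IsHomogeneous n)
    (hn : n ≠ 0) : ¬ IsUnit F := by
  intro hu
  have h1 : IsUnit (eval 0 F) := hu.map (eval (0 : σ → ℂ))
  rw [eval_zero_of_isHomogeneous hF hn] at h1
  exact not_isUnit_zero h1

/-- Having no factors of degrees `a` and `b` is an open condition on forms. -/
theorem exists_neighbourhood_no_factors {d a b : ℕ} (ha : a ≠ 0) (hb : b ≠ 0)
    (hab : a + b = d)
    {F₀ : homogeneousSubmodule σ ℂ d} (hF₀ : Irreducible F₀.1) :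
    ∃ h ∈ polyFun (homogeneousSubmodule σ ℂ d), h F₀ ≠ 0 ∧ ∀ F, h F ≠ 0 →
      ∀ A B : MvPolynomial σ ℂ, A.IsHomogeneous a → B.IsHomogeneous b → F.1 = A * B → F.1 = 0 := by
  classical
  -- The unknown is the matrix of products of coefficients of the two factors. The equations say
  -- that it has rank at most one and that the resulting form is proportional to `F`. Unlike the
  -- factorization itself these are homogeneous in the unknown, so elimination applies.
  let J := ((degMonomials σ a × degMonomials σ b) × (degMonomials σ a × degMonomials σ b)) ⊕
    (degMonomials σ d × degMonomials σ d)
  let f : J → homogeneousSubmodule σ ℂ d →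
      MvPolynomial (degMonomials σ a × degMonomials σ b) ℂ := fun j F => match j with
    | .inl (p, q) => X p * X q - X (p.1, q.2) * X (q.1, p.2)
    | .inr (s, t) => C (coeff t.1 F.1) * pairCoeff a b s.1 - C (coeff s.1 F.1) * pairCoeff a b t.1
  have hcoeff : ∀ j, CoeffIn (polyFun _) (f j) := by
    rintro (⟨p, q⟩ | ⟨s, t⟩)
    · exact CoeffIn.const _
    · exact ((CoeffIn.scalar (coeff_mem_polyFun d t.1)).mul (CoeffIn.const _)).sub
        ((CoeffIn.scalar (coeff_mem_polyFun d s.1)).mul (CoeffIn.const _))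
  have hdeg : ∀ j F, (f j F).IsHomogeneous (Sum.elim (fun _ => 2) (fun _ => 1) j) := by
    rintro (⟨p, q⟩ | ⟨s, t⟩) F
    · exact ((isHomogeneous_X _ _).mul (isHomogeneous_X _ _)).sub
        ((isHomogeneous_X _ _).mul (isHomogeneous_X _ _))
    · exact ((pairCoeff_isHomogeneous a b _).C_mul _).sub ((pairCoeff_isHomogeneous a b _).C_mul _)
  have hzero : ∀ c : degMonomials σ a × degMonomials σ b → ℂ, c ≠ 0 →
      ∃ j, eval c (f j F₀) ≠ 0 := by
    intro c hc
    by_contra! hall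
    obtain ⟨p₀, hp₀⟩ : ∃ p, c p ≠ 0 := by
      by_contra! h
      exact hc (funext h)
    have hrank : ∀ p, c (p.1, p₀.2) * c (p₀.1, p.2) = c p₀ * c p := by
      intro p
      have h1 := hall (.inl (p₀, p))
      simp only [f, map_sub, map_mul, eval_X] at h1
      linear_combination -h1
    have hA0 := sum_monomial_ne_zero (u := fun s => c (s, p₀.2)) (s := p₀.1) hp₀
    have hB0 := sum_monomial_ne_zero (u := fun t => c (p₀.1, t)) (s := p₀.2) hp₀
    have hA := sum_monomial_isHomogeneous (fun s => c (s, p₀.2))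
    have hB := sum_monomial_isHomogeneous (fun t => c (p₀.1, t))
    have hAB := sum_monomial_mul (fun s => c (s, p₀.2)) (fun t => c (p₀.1, t))
    set A := ∑ s : degMonomials σ a, monomial s.1 (c (s, p₀.2))
    set B := ∑ t : degMonomials σ b, monomial t.1 (c (p₀.1, t))
    have hAB' : A * B = C (c p₀) * ∑ p : degMonomials σ a × degMonomials σ b,
        monomial (p.1.1 + p.2.1) (c p) := by
      rw [hAB, Finset.mul_sum]
      exact Finset.sum_congr rfl fun p _ => by rw [hrank p, C_mul_monomial]
    set S := ∑ p : degMonomials σ a × degMonomials σ b, monomial (p.1.1 + p.2.1) (c p)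
    have hS : S.IsHomogeneous d := by
      refine IsHomogeneous.sum _ _ _ fun p _ => isHomogeneous_monomial _ ?_
      rw [map_add, mem_degMonomials.1 p.1.2, mem_degMonomials.1 p.2.2, hab]
    have hS0 : S ≠ 0 := fun h => mul_ne_zero hA0 hB0 (by rw [hAB', h, mul_zero])
    obtain ⟨t, ht⟩ := MvPolynomial.ne_zero_iff.1 hF₀.ne_zero
    have htd : t ∈ degMonomials σ d := by
      by_contra hn
      exact ht (IsHomogeneous.coeff_eq_zero F₀.2 fun h => hn (mem_degMonomials.2 h))
    have hprop : C (coeff t F₀.1) * S = C (coeff t S) * F₀.1 := by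
      ext s
      rw [coeff_C_mul, coeff_C_mul]
      by_cases hs : s ∈ degMonomials σ d
      · have h1 := hall (.inr (⟨s, hs⟩, ⟨t, htd⟩))
        simp only [f, map_sub, map_mul, eval_C, eval_pairCoeff] at h1
        linear_combination h1
      · rw [mem_degMonomials] at hs
        rw [hS.coeff_eq_zero hs, F₀.2.coeff_eq_zero hs, mul_zero, mul_zero]
    have htS : coeff t S ≠ 0 := by
      intro h
      rw [h, C_0, zero_mul] at hprop
      exact mul_ne_zero (C_ne_zero.2 ht) hS0 hprop
    have hfac : F₀.1 = C ((coeff t S)⁻¹ * coeff t F₀.1 * (c p₀)⁻¹) * A * B := by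
      rw [mul_assoc, hAB', ← mul_assoc, ← C_mul, mul_assoc, inv_mul_cancel₀ hp₀, mul_one, C_mul,
        mul_assoc, hprop, ← mul_assoc, ← C_mul, inv_mul_cancel₀ htS, C_1, one_mul]
    rcases hF₀.isUnit_or_isUnit hfac with hu | hu
    · exact not_isUnit_of_isHomogeneous hA ha (isUnit_of_mul_isUnit_right hu)
    · exact not_isUnit_of_isHomogeneous hB hb hu
  obtain ⟨h, hh, h0, H⟩ := exists_neighbourhood_no_common_zero _ f hcoeff hdeg F₀ hzero
  refine ⟨h, hh, h0, fun F hF A B hA hB hAB => ?_⟩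
  by_contra hne
  rw [hAB] at hne
  let c : degMonomials σ a × degMonomials σ b → ℂ := fun p => coeff p.1.1 A * coeff p.2.1 B
  have hsum : ∑ p : degMonomials σ a × degMonomials σ b, monomial (p.1.1 + p.2.1) (c p) = F.1 := by
    rw [hAB, exists_sum_monomial hA, exists_sum_monomial hB, sum_monomial_mul]
  have hc : c ≠ 0 := by
    intro hc
    rw [hc] at hsum
    simp only [Pi.zero_apply, map_zero, Finset.sum_const_zero] at hsum
    exact hne (hAB ▸ hsum.symm)
  obtain ⟨j, hj⟩ := H F hF c hc
  refine hj ?_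
  rcases j with ⟨p, q⟩ | ⟨s, t⟩
  · simp only [f, c, map_sub, map_mul, eval_X]
    ring
  · simp only [f, map_sub, map_mul, eval_C, eval_pairCoeff, hsum]
    ring

/-- Irreducibility of forms is an open condition. -/
theorem exists_neighbourhood_irreducible {d : ℕ} (hd : d ≠ 0) {F₀ : homogeneousSubmodule σ ℂ d}
    (hF₀ : Irreducible F₀.1) :
    ∃ h ∈ polyFun (homogeneousSubmodule σ ℂ d), h F₀ ≠ 0 ∧ ∀ F, h F ≠ 0 → Irreducible F.1 := by
  have h1 : ∀ i : Fin (d - 1), ∃ h ∈ polyFun (homogeneousSubmodule σ ℂ d), h F₀ ≠ 0 ∧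
      ∀ F, h F ≠ 0 → ∀ A B : MvPolynomial σ ℂ, A.IsHomogeneous (i + 1) →
        B.IsHomogeneous (d - (i + 1)) → F.1 = A * B → F.1 = 0 :=
    fun i => exists_neighbourhood_no_factors (Nat.succ_ne_zero _) (by omega) (by omega) hF₀
  obtain ⟨h, hh, h0, H⟩ := exists_common_neighbourhood h1
  obtain ⟨s, hs⟩ := MvPolynomial.ne_zero_iff.1 hF₀.ne_zero
  refine ⟨_, mul_mem hh (coeff_mem_polyFun d s), mul_ne_zero h0 hs, fun F hF => ?_⟩
  have hF0 : F.1 ≠ 0 := fun hF0 => right_ne_zero_of_mul hF <| by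
    change coeff s F.1 = 0
    rw [hF0, coeff_zero]
  refine irreducible_of_isHomogeneous F.2 hd hF0 fun A B a b hA hB ha hb hAB => ?_
  have hdeg : a + b = d := (hA.mul hB).inj_right (hAB ▸ F.2) (hAB ▸ hF0)
  refine hF0 (H F (left_ne_zero_of_mul hF) ⟨a - 1, by omega⟩ A B ?_ ?_ hAB)
  · rwa [Nat.sub_add_cancel (Nat.one_le_iff_ne_zero.2 ha)]
  · rwa [Nat.sub_add_cancel (Nat.one_le_iff_ne_zero.2 ha), ← hdeg, Nat.add_sub_cancel_left]

end IrreducibleForms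

/-! ### The codimension of `𝒱_{d,e}` -/

section LocalEquations

variable {M X M' Y : Type*} [AddCommGroup M] [Module ℂ M] [AddCommGroup M'] [Module ℂ M']
  {relX : M → X → Prop} {relY : M' → Y → Prop} {τ : Y → X} {n : ℕ}

/-- Around a point `y`, a regular section that passes through `y` is given in a chart by rational
functions. -/
theorem exists_section_coordinates {U : Set Y} {φ : Y → X × (Fin n → ℂ)}
    (hU : IsOpen[zariski relY] U) (hφ : IsRegularOn relY (prodAffine relX n) φ U) {S : X → Y}
    (hS : IsRegularOn relX relY S Set.univ) {D₀ : M} {x₀ : X} (hD₀ : relX D₀ x₀)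
    (hx₀ : S x₀ ∈ U) : ∃ r : Fin n → M → ℂ, (∀ i, r i ∈ ratAt D₀) ∧
      ∃ h ∈ polyFun M, h D₀ ≠ 0 ∧ ∀ D x, relX D x → h D ≠ 0 →
        S x ∈ U ∧ ∀ i, (φ (S x)).2 i = r i D := by
  obtain ⟨G, hG, k, hk, hk0, hGrel⟩ := hS.exists_mapIn (Set.mem_univ x₀) hD₀
  have hy₀ := hGrel D₀ x₀ (Set.mem_univ _) hD₀ hk0
  obtain ⟨Φ, hΦ, κ, hκ, hκ0, hΦrel⟩ := hφ.exists_mapIn hx₀ hy₀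
  obtain ⟨u, hu, hu0, hUu⟩ := isOpen_zariski_iff.1 hU _ _ hx₀ hy₀
  obtain ⟨p, hp, hp0, hpne⟩ := exists_polyFun_of_ratAt (polyFun_comp hG (mul_mem hκ hu))
    (mul_ne_zero hκ0 hu0)
  refine ⟨fun i D => (Φ (G D)).2 i, fun i => ratAt_comp hG (f := fun D' => (Φ D').2 i)
    (hΦ (LinearMap.proj i ∘ₗ LinearMap.snd ℂ M (Fin n → ℂ))), _, mul_mem hk hp,
    mul_ne_zero hk0 hp0, fun D x hD hne => ?_⟩
  have h1 := hGrel D x (Set.mem_univ _) hD (left_ne_zero_of_mul hne)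
  have h2 := hpne D (right_ne_zero_of_mul hne)
  have h3 := hUu _ _ h1 (right_ne_zero_of_mul h2)
  exact ⟨h3, fun i => (congrFun (hΦrel _ _ h3 h1 (left_ne_zero_of_mul h2)).2 i).symm⟩

/-- The locus where two sections of a smooth map coincide is locally given by as many equations as
the relative dimension. -/
theorem IsSmoothOfRelDim.exists_local_equations (hτ : IsSmoothOfRelDim relY relX τ n)
    {S₁ S₂ : X → Y} (h₁ : IsRegularOn relX relY S₁ Set.univ) (h₁' : ∀ x, τ (S₁ x) = x)
    (h₂ : IsRegularOn relX relY S₂ Set.univ) (h₂' : ∀ x, τ (S₂ x) = x) {D₀ : M} {x₀ : X}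
    (hD₀ : relX D₀ x₀) (hx₀ : S₁ x₀ = S₂ x₀) :
    ∃ h ∈ polyFun M, h D₀ ≠ 0 ∧ ∃ g : Fin n → M → ℂ, (∀ i, g i ∈ polyFun M) ∧
      ∀ D x, relX D x → h D ≠ 0 → (S₁ x = S₂ x ↔ ∀ i, g i D = 0) := by
  obtain ⟨U, W, φ, ψ, hU, hyU, -, -, -, hinv, hφ, -, hτφ⟩ := hτ (S₁ x₀)
  obtain ⟨r₁, hr₁, k₁, hk₁, hk₁0, H₁⟩ := exists_section_coordinates hU hφ h₁ hD₀ hyU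
  obtain ⟨r₂, hr₂, k₂, hk₂, hk₂0, H₂⟩ := exists_section_coordinates hU hφ h₂ hD₀ (hx₀ ▸ hyU)
  obtain ⟨k, hk, hk0, g, hg, H⟩ := exists_denominator fun i => sub_mem (hr₁ i) (hr₂ i)
  refine ⟨_, mul_mem (mul_mem hk₁ hk₂) hk, mul_ne_zero (mul_ne_zero hk₁0 hk₂0) hk0, g, hg,
    fun D x hD hne => ?_⟩
  obtain ⟨hU₁, e₁⟩ := H₁ D x hD (left_ne_zero_of_mul (left_ne_zero_of_mul hne))
  obtain ⟨hU₂, e₂⟩ := H₂ D x hD (right_ne_zero_of_mul (left_ne_zero_of_mul hne))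
  have hkD : k D ≠ 0 := right_ne_zero_of_mul hne
  have hg' : ∀ i, g i D = 0 ↔ (φ (S₁ x)).2 i = (φ (S₂ x)).2 i := by
    intro i
    rw [← H D hkD i, e₁, e₂, mul_eq_zero, or_iff_right hkD]
    exact sub_eq_zero
  simp only [hg']
  refine ⟨fun h i => by rw [h], fun h => ?_⟩
  rw [← hinv.1 hU₁, ← hinv.1 hU₂]
  congr 1
  refine Prod.ext ?_ (funext h)
  rw [hτφ _ hU₁, hτφ _ hU₂, h₁', h₂']

end LocalEquations

/-! ### Changes of coordinates of configurations and the codimension bound -/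

section ConfigCodim

variable {N d e : ℕ}

theorem mapIn_coord_lin (i : Fin e) : MapIn (polyFun (ConfigCoord N d e)) fun D => (D i).1 :=
  MapIn.linear (MapIn.linearMap (coordProj i)) (LinearMap.fst ℂ _ _)

theorem mapIn_coord_vtx (i : Fin e) : MapIn (polyFun (ConfigCoord N d e)) fun D => (D i).2.1 :=
  MapIn.linear (MapIn.linearMap (coordProj i)) (LinearMap.fst ℂ _ _ ∘ₗ LinearMap.snd ℂ _ _)

theorem mapIn_coord_eqn (i : Fin e) : MapIn (polyFun (ConfigCoord N d e)) fun D => (D i).2.2 :=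
  MapIn.linear (MapIn.linearMap (coordProj i)) (LinearMap.snd ℂ _ _ ∘ₗ LinearMap.snd ℂ _ _)

/-- The product of a linear form and a form of degree `d - 1`. -/
noncomputable def linMul (hd : 1 ≤ d) (l : Module.Dual ℂ (Vec N)) (H : Form N (d - 1)) : Form N d :=
  ⟨linForm l * H.1, by
    have := (linForm_isHomogeneous l).mul H.2
    rwa [Nat.add_sub_cancel' hd] at this⟩

/-- Changes of coordinates of configurations. -/
noncomputable def configChange (hd : 1 ≤ d) :
    CoordChange (Fin e → ℂ × ℂ × ℂ × Form N (d - 1)) (ConfigRel (N := N) (d := d) (e := e)) where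
  act γ D i := ((γ i).1 • (D i).1, (γ i).2.1 • (D i).2.1,
    (γ i).2.2.1 • (D i).2.2 + linMul hd (D i).1 (γ i).2.2.2)
  den γ := ∏ i, (γ i).1 * ((γ i).2.1 * (γ i).2.2.1)
  mapIn_act γ := by
    refine MapIn.pi fun i => ?_
    have hl := mapIn_coord_lin (N := N) (d := d) i
    have hP := mapIn_coord_vtx (N := N) (d := d) i
    have hf := mapIn_coord_eqn (N := N) (d := d) i
    refine (hl.smul (const_mem_subalgebra _ _)).prodMk ((hP.smul (const_mem_subalgebra _ _)).prodMk
      ((hf.smul (const_mem_subalgebra _ _)).add (CoeffIn.mapIn ?_)))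
    exact (coeffIn_linForm hl.dual_apply_const).mul (CoeffIn.const _)
  mapIn_orbit D := by
    refine MapIn.pi fun i => ?_
    have hγ := MapIn.linearMap
      (LinearMap.proj (R := ℂ) (φ := fun _ : Fin e => ℂ × ℂ × ℂ × Form N (d - 1)) i)
    have hs := mapIn_scalar.1 (hγ.linear (LinearMap.fst ℂ _ _))
    have ht := mapIn_scalar.1 (hγ.linear (LinearMap.fst ℂ _ _ ∘ₗ LinearMap.snd ℂ _ _))
    have hu := mapIn_scalar.1 (hγ.linear
      (LinearMap.fst ℂ _ _ ∘ₗ LinearMap.snd ℂ _ _ ∘ₗ LinearMap.snd ℂ _ _))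
    have hH := hγ.linear (LinearMap.snd ℂ _ _ ∘ₗ LinearMap.snd ℂ _ _ ∘ₗ LinearMap.snd ℂ _ _)
    refine ((MapIn.const _ _).smul hs).prodMk (((MapIn.const _ _).smul ht).prodMk
      (((MapIn.const _ _).smul hu).add (CoeffIn.mapIn ?_)))
    exact (CoeffIn.const _).mul hH.coeffIn
  den_mem := by
    refine prod_mem_subalgebra _ fun i _ => ?_
    have hγ := MapIn.linearMap
      (LinearMap.proj (R := ℂ) (φ := fun _ : Fin e => ℂ × ℂ × ℂ × Form N (d - 1)) i)
    have hs := mapIn_scalar.1 (hγ.linear (LinearMap.fst ℂ _ _))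
    have ht := mapIn_scalar.1 (hγ.linear (LinearMap.fst ℂ _ _ ∘ₗ LinearMap.snd ℂ _ _))
    have hu := mapIn_scalar.1 (hγ.linear
      (LinearMap.fst ℂ _ _ ∘ₗ LinearMap.snd ℂ _ _ ∘ₗ LinearMap.snd ℂ _ _))
    exact mul_mem hs (mul_mem ht hu)
  rel_act γ D L hγ hD := by
    refine hD.of_scale fun i => ?_
    have h := Finset.prod_ne_zero_iff.1 hγ i (Finset.mem_univ i)
    refine ⟨_, _, _, left_ne_zero_of_mul h, left_ne_zero_of_mul (right_ne_zero_of_mul h),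
      right_ne_zero_of_mul (right_ne_zero_of_mul h), rfl, rfl, (γ i).2.2.2.1, ?_⟩
    change (γ i).2.2.1 • (D i).2.2.1 + linForm (D i).1 * (γ i).2.2.2.1 -
      C (γ i).2.2.1 * (D i).2.2.1 = _
    rw [smul_eq_C_mul, add_sub_cancel_left]
  exists_act_eq D D' L hD hD' := by
    choose s t u hs ht hu hl hP H hH using hD.exists_scale hD'
    have hhom : ∀ i, (H i).IsHomogeneous (d - 1) := fun i =>
      isHomogeneous_right_of_mul (linForm_isHomogeneous _) (linForm_ne_zero (hD.good.lin_ne i))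
        (hH i ▸ (D' i).2.2.2.sub ((D i).2.2.2.C_mul _))
    refine ⟨fun i => (s i, t i, u i, ⟨H i, hhom i⟩), Finset.prod_ne_zero_iff.2 fun i _ =>
      mul_ne_zero (hs i) (mul_ne_zero (ht i) (hu i)), funext fun i => ?_⟩
    refine Prod.ext (hl i).symm (Prod.ext (hP i).symm (Subtype.ext ?_))
    change u i • (D i).2.2.1 + linForm (D i).1 * H i = (D' i).2.2.1
    rw [← hH i, smul_eq_C_mul, add_sub_cancel]

/-- The vectors l(w) y - l(y) w parametrize the hyperplane by polynomials in the coordinates.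
Invariance under the vertex thereby becomes a family of polynomial identities, which pass from
genuine coordinates to their Zariski closure. -/
theorem coneInv_of_vanishes {D : ConfigCoord N d e}
    (hD : ∀ p ∈ polyFun (ConfigCoord N d e), (∀ D' L, ConfigRel D' L → p D' = 0) → p D = 0)
    (i : Fin e) {w : Vec N} (hw : (D i).1 w ≠ 0) : ConeInv (D i).1 (D i).2.1 (D i).2.2.1 := by
  intro y hy t
  have hl := mapIn_coord_lin (N := N) (d := d) i
  have hP := mapIn_coord_vtx (N := N) (d := d) i
  have hf := mapIn_coord_eqn (N := N) (d := d) i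
  have hev : ∀ t : ℂ, (fun D : ConfigCoord N d e => eval ((D i).1 w • y - (D i).1 y • w +
      t • (D i).2.1) (D i).2.2.1) ∈ polyFun (ConfigCoord N d e) := by
    intro t
    have hv : MapIn (polyFun (ConfigCoord N d e)) fun D => (D i).1 w • y - (D i).1 y • w +
        t • (D i).2.1 :=
      (((MapIn.const _ y).smul (hl.dual_apply_const w)).sub
        ((MapIn.const _ w).smul (hl.dual_apply_const y))).add (hP.smul (const_mem_subalgebra _ t))
    exact CoeffIn.eval hf.coeffIn (fun D => (D i).2.2.2) fun j => hv (LinearMap.proj j)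
  have h3 := hD _ (sub_mem (hev ((D i).1 w * t)) (hev 0)) fun D' L hD' => by
    have hker : (D' i).1 ((D' i).1 w • y - (D' i).1 y • w) = 0 := by
      rw [map_sub, map_smul, map_smul, smul_eq_mul, smul_eq_mul, mul_comm, sub_self]
    rw [Pi.sub_apply, hD'.good.inv i _ hker, hD'.good.inv i _ hker, sub_self]
  rw [Pi.sub_apply, hy, zero_smul, sub_zero, zero_smul, add_zero, mul_smul, ← smul_add,
    eval_smul_of_isHomogeneous (D i).2.2.2, eval_smul_of_isHomogeneous (D i).2.2.2, ← mul_sub,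
    mul_eq_zero, or_iff_right (pow_ne_zero _ hw)] at h3
  exact sub_eq_zero.1 h3

/-- The discriminant of the associated form on the whole space turns smoothness of a cone outside
its vertex into a single polynomial inequality. The auxiliary `m` and `w` are chosen at `D₀` and
kept nearby. -/
theorem GoodCoord.exists_neighbourhood_disc (hd : 2 ≤ d) {D₀ : ConfigCoord N d e}
    (hg : GoodCoord D₀) (i : Fin e) : ∃ (m : Module.Dual ℂ (Vec N)) (w : Vec N), m w = 0 ∧
      ∃ k ∈ polyFun (ConfigCoord N d e), k D₀ ≠ 0 ∧ ∀ D : ConfigCoord N d e, k D ≠ 0 →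
        m (D i).2.1 ≠ 0 ∧ (D i).1 w ≠ 0 ∧
        disc N d (coneForm (D i).1 (D i).2.1 m w (D i).2.2 1 1 1) ≠ 0 := by
  obtain ⟨m, hm⟩ : ∃ m : Module.Dual ℂ (Vec N), m (D₀ i).2.1 ≠ 0 := by
    by_contra! hall
    exact hg.vtx_ne i ((Module.forall_dual_apply_eq_zero_iff ℂ _).1 hall)
  obtain ⟨w₀, hw₀⟩ : ∃ w, (D₀ i).1 w ≠ 0 := by
    by_contra! hall
    exact hg.lin_ne i (LinearMap.ext hall)
  obtain ⟨w, hmw, hw⟩ : ∃ w, m w = 0 ∧ (D₀ i).1 w ≠ 0 := by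
    refine ⟨w₀ - (m w₀ / m (D₀ i).2.1) • (D₀ i).2.1, ?_, ?_⟩
    · rw [map_sub, map_smul, smul_eq_mul, div_mul_cancel₀ _ hm, sub_self]
    · rwa [map_sub, map_smul, hg.lin_vtx, smul_zero, sub_zero]
  have h1 : (fun D : ConfigCoord N d e => m (D i).2.1) ∈ polyFun (ConfigCoord N d e) :=
    mapIn_coord_vtx i m
  have h2 : (fun D : ConfigCoord N d e => (D i).1 w) ∈ polyFun (ConfigCoord N d e) :=
    (mapIn_coord_lin i).dual_apply_const w
  have h3 : (fun D : ConfigCoord N d e => disc N d (coneForm (D i).1 (D i).2.1 m w (D i).2.2 1 1 1))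
      ∈ polyFun (ConfigCoord N d e) :=
    polyFun_comp ((mapIn_coord_lin i).coneForm (MapIn.const _ m) (mapIn_coord_vtx i)
      (MapIn.const _ w) (mapIn_coord_eqn i)) (disc_mem hd)
  refine ⟨m, w, hmw, _, mul_mem h1 (mul_mem h2 h3), mul_ne_zero hm (mul_ne_zero hw
    (disc_coneForm_ne_zero hd (hg.lin_vtx i) hmw hw hm (hg.inv i) (hg.smooth i))), fun D hD => ?_⟩
  exact ⟨left_ne_zero_of_mul hD, left_ne_zero_of_mul (right_ne_zero_of_mul hD),
    right_ne_zero_of_mul (right_ne_zero_of_mul hD)⟩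

theorem coneSmooth_of_disc_ne_zero (hd : 2 ≤ d) {l m : Module.Dual ℂ (Vec N)} {P w : Vec N}
    {f : Form N d} (hlP : l P = 0) (hmw : m w = 0) (hlw : l w ≠ 0) (hmP : m P ≠ 0)
    (hinv : ConeInv l P f.1) (h : disc N d (coneForm l P m w f 1 1 1) ≠ 0) :
    ConeSmooth l P f.1 := by
  rw [disc_ne_zero_iff hd] at h
  exact (coneSum_smooth_iff hd f.2 hlP hmw hlw hmP hinv (one_ne_zero (α := ℂ))
    (one_ne_zero (α := ℂ)) (one_ne_zero (α := ℂ))).1 h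

/-- Being coordinates of a configuration is a locally closed condition. -/
theorem ConfigRel.exists_neighbourhood (hN : 2 ≤ N) (hd : 2 ≤ d) {D₀ : ConfigCoord N d e}
    {L₀ : Config N d e} (h : ConfigRel D₀ L₀) :
    ∃ k ∈ polyFun (ConfigCoord N d e), k D₀ ≠ 0 ∧ ∀ D : ConfigCoord N d e,
      (∀ p ∈ polyFun (ConfigCoord N d e), (∀ D' L, ConfigRel D' L → p D' = 0) → p D = 0) →
      k D ≠ 0 → ∃ L, ConfigRel D L := by
  have hl := mapIn_coord_lin (N := N) (d := d) (e := e)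
  have hP := mapIn_coord_vtx (N := N) (d := d) (e := e)
  have hg := h.good
  choose m w hmw hopen using fun i => hg.exists_neighbourhood_disc hd i
  have hopen' : ∀ z : {z : Fin e × Fin e // z.1 ≠ z.2}, ∃ k ∈ polyFun (ConfigCoord N d e),
      k D₀ ≠ 0 ∧ ∀ D, k D ≠ 0 → (D z.1.1).1 (D z.1.2).2.1 ≠ 0 :=
    fun z => ⟨_, (hl z.1.1).dual_apply (hP z.1.2), hg.lin_vtx_ne _ _ z.2, fun D hD => hD⟩
  obtain ⟨k, hk, hk0, H⟩ := exists_common_neighbourhood hopen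
  obtain ⟨k', hk', hk0', H'⟩ := exists_common_neighbourhood hopen'
  refine ⟨_, mul_mem hk hk', mul_ne_zero hk0 hk0', fun D hD hne => ?_⟩
  have h1 := H D (left_ne_zero_of_mul hne)
  have h2 := H' D (right_ne_zero_of_mul hne)
  have hlP : ∀ i, (D i).1 (D i).2.1 = 0 := fun i =>
    hD _ ((hl i).dual_apply (hP i)) fun D' L hD' => hD'.good.lin_vtx i
  have hinv := fun i => coneInv_of_vanishes hD i (h1 i).2.1
  have hsm : ∀ i, ConeSmooth (D i).1 (D i).2.1 (D i).2.2.1 := fun i =>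
    coneSmooth_of_disc_ne_zero hd (hlP i) (hmw i) (h1 i).2.1 (h1 i).1 (hinv i) (h1 i).2.2
  have hl0 : ∀ i, (D i).1 ≠ 0 := fun i h0 => (h1 i).2.1 (by rw [h0, LinearMap.zero_apply])
  have hP0 : ∀ i, (D i).2.1 ≠ 0 := fun i h0 => (h1 i).1 (by rw [h0, map_zero])
  exact GoodCoord.exists_rel hN ⟨hl0, hP0, hlP, fun i j hij => h2 ⟨(i, j), hij⟩, hinv, hsm⟩

/-- `𝒱_{d,e}` is open in the locus of configurations cut out by a hypersurface. -/
theorem ConfigRel.exists_neighbourhood_V (hN : 2 ≤ N) (hd : 2 ≤ d) (he : 0 < e)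
    {D₀ : ConfigCoord N d e} {L₀ : Config N d e} (h : ConfigRel D₀ L₀) (hL₀ : L₀ ∈ V N d e) :
    ∃ k ∈ polyFun (ConfigCoord N d e), k D₀ ≠ 0 ∧ ∀ D L, ConfigRel D L → k D ≠ 0 →
      L ∈ suitedLocus N d e → L ∈ V N d e := by
  rcases le_or_gt e d with hed | hed
  · exact ⟨1, one_mem _, one_ne_zero, fun D L _ _ hL =>
      suitedLocus_subset_V_of_le hN he hed hL⟩
  obtain ⟨F, hFd, hFirr, hF⟩ := hL₀
  obtain ⟨c, hc0, hc⟩ := h.exists_prodForms_dvd hN hd he hF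
  obtain ⟨-, -, G, hG⟩ := hc (e - 1) (by omega)
  rw [Nat.sub_add_cancel he] at hG
  -- For `e > d` a product of `e` equations has no nonzero multiple of degree `d`, so the
  -- hypersurface is unique and is the interpolating one. It varies rationally, and irreducibility
  -- of forms is open.
  have hG0 : G = 0 := eq_zero_of_mul_isHomogeneous (prodForms_isHomogeneous _ e)
    (h.good.prodForms_ne_zero le_rfl)
    (hG ▸ (hFd.C_mul c).sub (interp D₀ (e - 1)).2) hed
  rw [hG0, mul_zero, sub_eq_zero] at hG
  have hirr : Irreducible (interp D₀ (e - 1)).1 := by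
    rw [← hG]
    exact (irreducible_isUnit_mul ((IsUnit.mk0 c hc0).map C)).2 hFirr
  obtain ⟨k, hk, hk0, H⟩ := exists_neighbourhood_irreducible (by omega) hirr
  obtain ⟨p, hp, hp0, hpne⟩ := exists_polyFun_of_ratAt
    (polyFun_comp (h.good.mapIn_interp hN hd (Nat.sub_lt he Nat.one_pos)) hk) hk0
  exact ⟨p, hp, hp0, fun D L hD hne hL => ⟨(interp D (e - 1)).1, (interp D (e - 1)).2,
    H _ (hpne D hne), fun i => (hD.cone_eq_span_iff i).2
      ⟨ratio D i, hD.linForm_dvd_interp_sub hN hd ((mem_suitedLocus_iff hN hd he).1 hL) i.2⟩⟩⟩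

/-- Near a point, three open conditions on coordinates are imposed: the sections lie in a chart, the
limit coordinates still define a configuration, and the interpolating hypersurfaces can be taken
irreducible. There the locus is cut out by the differences of the chart coordinates of the two
sections. -/
theorem codim_V_le (hN : 2 ≤ N) (hd : 3 ≤ d) (he : 1 ≤ e) (Z : Set (V N d e))
    (hZ : Z ∈ irreducibleComponents (V N d e)) :
    codim (Subtype.val '' Z) (isIrreducible_image hZ) ≤ relDim N d e := by
  refine (configChange (by omega)).codim_component_le exists_configRel (fun D₀ L₀ hL₀ hD₀ => ?_) hZ
  have hd2 : 2 ≤ d := by omega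
  have hs := isSection_coneSection (d := d) (e := e) hN
  have hs' := isSection_interpSection (d := d) (e := e) hN hd2
  have hL₀' := (mem_suitedLocus_iff hN hd2 he).1 (V_subset_suitedLocus hL₀)
  obtain ⟨h₁, hh₁, h₁0, g, hg, H₁⟩ := (isSmoothOfRelDim_tau (by omega)
    (by omega)).exists_local_equations hs.1 hs.2 hs'.1 hs'.2 hD₀ hL₀'
  obtain ⟨h₂, hh₂, h₂0, H₂⟩ := hD₀.exists_neighbourhood hN hd2
  obtain ⟨h₃, hh₃, h₃0, H₃⟩ := hD₀.exists_neighbourhood_V hN hd2 he hL₀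
  refine ⟨_, mul_mem (mul_mem hh₁ hh₂) hh₃, mul_ne_zero (mul_ne_zero h₁0 h₂0) h₃0, g, hg,
    fun D L hL hD hne => ?_, fun D hD hne hgD => ?_⟩
  · exact (H₁ D L hD (left_ne_zero_of_mul (left_ne_zero_of_mul hne))).1
      ((mem_suitedLocus_iff hN hd2 he).1 (V_subset_suitedLocus hL))
  · obtain ⟨L, hL⟩ := H₂ D hD (right_ne_zero_of_mul (left_ne_zero_of_mul hne))
    refine ⟨L, H₃ D L hL (right_ne_zero_of_mul hne) ((mem_suitedLocus_iff hN hd2 he).2 ?_), hL⟩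
    exact (H₁ D L hL (left_ne_zero_of_mul (left_ne_zero_of_mul hne))).2 hgD

end ConfigCodim

end StarPoints

theorem mainTheorem7 (N d e : ℕ) (hN : 2 ≤ N) (hd : 3 ≤ d) (he : 1 ≤ e) :
    StarPoints.IsSmoothOfRelDim (StarPoints.GRel (N := N) (d := d) (e := e)) StarPoints.ConfigRel
      StarPoints.tau (StarPoints.relDim N d e) ∧
    (∃ S₁ S₂ : StarPoints.Config N d e → StarPoints.GSpace N d e,
      StarPoints.IsSection S₁ ∧ StarPoints.IsSection S₂ ∧
      StarPoints.suitedLocus N d e = StarPoints.tau '' (Set.range S₁ ∩ Set.range S₂) ∧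
      (e ≤ d ∨ 4 ≤ N →
        StarPoints.V N d e = StarPoints.tau '' (Set.range S₁ ∩ Set.range S₂))) ∧
    ∀ (Z : Set (StarPoints.V N d e)) (hZ : Z ∈ irreducibleComponents (StarPoints.V N d e)),
      StarPoints.codim (Subtype.val '' Z) (StarPoints.isIrreducible_image hZ) ≤
        StarPoints.relDim N d e := by
  have hd2 : 2 ≤ d := by omega
  have h₁ := StarPoints.isSection_coneSection (d := d) (e := e) hN
  have h₂ := StarPoints.isSection_interpSection (d := d) (e := e) hN hd2
  have hloc : StarPoints.suitedLocus N d e = StarPoints.tau ''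
      (Set.range (StarPoints.coneSection hN) ∩ Set.range (StarPoints.interpSection hN)) := by
    rw [StarPoints.image_tau_eq h₁ h₂]
    exact Set.ext fun L => StarPoints.mem_suitedLocus_iff hN hd2 he
  exact ⟨StarPoints.isSmoothOfRelDim_tau (by omega) (by omega),
    ⟨_, _, h₁, h₂, hloc, fun h => (StarPoints.V_eq_suitedLocus hN (by omega) he h).trans hloc⟩,
    StarPoints.codim_V_le hN hd he⟩
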